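/- Let $T>0$, let $\Omega\subset\mathbb{R}^N$ be a bounded domain and $\Omega_T=(0,T)\times\Omega$. Let $k\in L_{1,loc}([0,\infty))$ be nonnegative and nonincreasing on $(0,\infty)$, and let $l\in L_{1,loc}([0,\infty))$ satisfy $k\ast l=1$ on $(0,\infty)$, where $(k\ast v)(t)=\int_0^t k(t-s)v(s)\,ds$ (that is, $k$ is a $\mathcal{PC}$-kernel and $(k,l)\in\mathcal{PC}$). For $n\in\mathbb{N}$, $n\ge 1$, let $h_n\in L_{1,loc}([0,\infty))$ be the resolvent kernel of $nl$, i.e. $h_n+n\,(h_n\ast l)=n\,l$ on $(0,\infty)$, and put $k_n=k\ast h_n$. Write $$(l\star_T g)(t)=\int_t^T l(\tau-t)g(\tau)\,d\tau,\qquad t\in(0,T).$$ Let $V=\mathring{H}^1_2(\Omega)$ (the closure of $C_0^\infty(\Omega)$ in $H^1_2(\Omega)$; Dirichlet case) or $V=H^1_2(\Omega)$ (Neumann case). Let $m\ge 1$ be a real number, $u_0\in L_{m+1}(\Omega)$, $f\in L_{m+1}(\Omega_T)$, and let $a\in L_\infty(\Omega_T)$ satisfy $0<a_1\le a(t,x)\le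 a_2$ for a.a. $(t,x)\in\Omega_T$ with constants $a_1,a_2>0$. Let $u\ge 0$ on $\Omega_T$ be a weak subsolution of $$\partial_t\big(k\ast[u-u_0]\big)-\Delta\big(au^m\big)=f\quad\text{in }\Omega_T$$ with homogeneous Dirichlet or Neumann boundary condition, in the following sense: $au^m\in L_2((0,T);V)$; $k\ast u\in C([0,T];L_2(\Omega))$ with $(k\ast u)|_{t=0}=0$; and for all $n\ge 1$ and all nonnegative $\psi\in V$, $$\int_\Omega\Big(\psi\,\partial_t\big(k_n\ast[u-u_0]\big)+\big[h_n\ast\nabla(au^m)\big]\cdot\nabla\psi\Big)dx\le\int_\Omega (h_n\ast f)\,\psi\,dx\quad\text{for a.a. }t\in(0,T).$$ Then both integrals on the left-hand side below are finite, and $$\int_0^T\!\!\int_\Omega u^{m+1}\,dx\,dt+\frac1{a_1}\int_0^T\!\!\int_\Omega\big[k(T-t)+k(t)\big]\,\big|l\star_T\nabla(au^m)\big|^2\,dx\,dt$$ $$\le C(m)\Big(\frac{a_2}{a_1}\Big)^{m+1}\Big(T\,\|u_0\|_{L_{m+1}(\Omega)}^{m+1}+\|l\|_{L_1((0,T))}^{m+1}\,\|f\|_{L_{m+1}(\Omega_T)}^{m+1}\Big),\qquad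 C(m)=\frac{2(4m)^m}{(m+1)^{m+1}}.$$ -/

import Mathlib

open MeasureTheory Set
open scoped ContDiff

namespace Subdiffusion

/-- The Euclidean space `ℝ^N`. -/
abbrev Space (N : ℕ) : Type := EuclideanSpace ℝ (Fin N)

/-- Convolution on the half-line: `(k ∗ v)(t) = ∫_0^t k(t - s) v(s) ds`. -/
noncomputable def conv {F : Type*} [NormedAddCommGroup F] [NormedSpace ℝ F]
    (k : ℝ → ℝ) (v : ℝ → F) (t : ℝ) : F :=
  ∫ s in (0 : ℝ)..t, k (t - s) • v s

/-- Dual convolution on `(0, T)`: `(l ⋆_T g)(t) = ∫_t^T l(τ - t) g(τ) dτ`. -/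
noncomputable def dualConv {F : Type*} [NormedAddCommGroup F] [NormedSpace ℝ F]
    (T : ℝ) (l : ℝ → ℝ) (g : ℝ → F) (t : ℝ) : F :=
  ∫ τ in t..T, l (τ - t) • g τ

/-- `(k, l) ∈ PC`: `k` and `l` are in `L_{1,loc}([0, ∞))`, `k` is nonnegative and nonincreasing
on `(0, ∞)`, and `k ∗ l = 1` (almost everywhere) on `(0, ∞)`. -/
structure IsPCPair (k l : ℝ → ℝ) : Prop where
  locInt_k : LocallyIntegrableOn k (Ici 0)
  nonneg_k : ∀ t, 0 < t → 0 ≤ k t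
  antitone_k : AntitoneOn k (Ioi 0)
  locInt_l : LocallyIntegrableOn l (Ici 0)
  conv_eq_one : ∀ᵐ t ∂(volume.restrict (Ioi (0 : ℝ))), conv k l t = 1

/-- `h` is the resolvent kernel associated with `γ l`: the (almost everywhere unique) function in
`L_{1,loc}([0, ∞))` with `h + γ (h ∗ l) = γ l` on `(0, ∞)`. -/
structure IsResolventKernel (γ : ℝ) (l h : ℝ → ℝ) : Prop where
  locInt : LocallyIntegrableOn h (Ici 0)
  resolvent_eq : ∀ᵐ t ∂(volume.restrict (Ioi (0 : ℝ))), h t + γ * conv h l t = γ * l t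

/-- Lebesgue measure on the space-time cylinder `Ω_T = (0, T) × Ω`. -/
noncomputable def cylMeasure {N : ℕ} (T : ℝ) (Ω : Set (Space N)) : Measure (ℝ × Space N) :=
  (volume : Measure (ℝ × Space N)).restrict (Ioo 0 T ×ˢ Ω)

/-- Test functions `φ ∈ C_0^∞(Ω)`. -/
structure IsTestFunction {N : ℕ} (Ω : Set (Space N)) (φ : Space N → ℝ) : Prop where
  smooth : ContDiff ℝ ∞ φ
  compact : HasCompactSupport φ
  support : tsupport φ ⊆ Ω

/-- `g` is the weak (distributional) gradient of `ψ` on `Ω`. -/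
def HasWeakGradient {N : ℕ} (Ω : Set (Space N)) (ψ : Space N → ℝ) (g : Space N → Space N) : Prop :=
  ∀ φ : Space N → ℝ, IsTestFunction Ω φ → ∀ i : Fin N,
    ∫ x in Ω, ψ x * gradient φ x i = - ∫ x in Ω, g x i * φ x

/-- `ψ ∈ H^1_2(Ω)` with weak gradient `g`. -/
structure MemH1 {N : ℕ} (Ω : Set (Space N)) (ψ : Space N → ℝ) (g : Space N → Space N) : Prop where
  memLp : MemLp ψ 2 (volume.restrict Ω)
  memLp_grad : MemLp g 2 (volume.restrict Ω)
  weakGrad : HasWeakGradient Ω ψ g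

/-- `ψ` belongs to the closure of `C_0^∞(Ω)` in `H^1_2(Ω)`, with weak gradient `g`. -/
structure MemH10 {N : ℕ} (Ω : Set (Space N)) (ψ : Space N → ℝ) (g : Space N → Space N) : Prop where
  memH1 : MemH1 Ω ψ g
  approx : ∀ ε : ENNReal, 0 < ε → ∃ φ : Space N → ℝ, IsTestFunction Ω φ ∧
    eLpNorm (fun x => φ x - ψ x) 2 (volume.restrict Ω) < ε ∧
    eLpNorm (fun x => gradient φ x - g x) 2 (volume.restrict Ω) < ε

/-- The two homogeneous boundary conditions. -/
inductive BoundaryCondition : Type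
  | dirichlet : BoundaryCondition
  | neumann : BoundaryCondition

/-- `ψ`, with weak gradient `g`, lies in the energy space of the boundary condition: the closure of
`C_0^∞(Ω)` in `H^1_2(Ω)` (Dirichlet), or `H^1_2(Ω)` (Neumann). -/
def MemEnergySpace {N : ℕ} (bc : BoundaryCondition) (Ω : Set (Space N))
    (ψ : Space N → ℝ) (g : Space N → Space N) : Prop :=
  match bc with
  | BoundaryCondition.dirichlet => MemH10 Ω ψ g
  | BoundaryCondition.neumann => MemH1 Ω ψ g

/-- `w ∈ L_2((0, T); V)`, where `V` is the energy space of the boundary condition, and `G` is the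
spatial weak gradient of `w`. -/
structure MemL2EnergySpace {N : ℕ} (bc : BoundaryCondition) (T : ℝ) (Ω : Set (Space N))
    (w : ℝ → Space N → ℝ) (G : ℝ → Space N → Space N) : Prop where
  memLp : MemLp (fun z : ℝ × Space N => w z.1 z.2) 2 (cylMeasure T Ω)
  memLp_grad : MemLp (fun z : ℝ × Space N => G z.1 z.2) 2 (cylMeasure T Ω)
  mem : ∀ᵐ t ∂(volume.restrict (Ioo 0 T)), MemEnergySpace bc Ω (w t) (G t)

/-- `k ∗ u ∈ C([0, T]; L_2(Ω))` and `(k ∗ u)|_{t=0} = 0`. -/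
def ConvContinuousVanishing {N : ℕ} (T : ℝ) (Ω : Set (Space N)) (k : ℝ → ℝ)
    (u : ℝ → Space N → ℝ) : Prop :=
  ∃ U : ℝ → Lp ℝ 2 (volume.restrict Ω), ContinuousOn U (Icc 0 T) ∧ U 0 = 0 ∧
    ∀ᵐ t ∂(volume.restrict (Ioo 0 T)),
      (U t : Space N → ℝ) =ᵐ[volume.restrict Ω] fun x => conv k (fun s => u s x) t

/-- The weak form of `∂_t (k ∗ [u - u₀]) - Δ w ≤ f`, where `G` is the spatial gradient of `w`:
for all `n ≥ 1`, with `h = h_n` the resolvent kernel of `n l` and `k_n = k ∗ h_n`, and for all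
nonnegative `ψ` (with gradient `g`) in the energy space, for almost every `t ∈ (0, T)`,
`∫_Ω (ψ ∂_t (k_n ∗ [u - u₀]) + (h_n ∗ G) · ∇ψ) dx ≤ ∫_Ω (h_n ∗ f) ψ dx`.
The kernel `k_n` coincides almost everywhere with a locally absolutely continuous function, so the
classical derivative `∂_t (k_n ∗ [u - u₀])(t, x)` exists for almost every `(t, x)`. -/
def WeakInequality {N : ℕ} (bc : BoundaryCondition) (T : ℝ) (Ω : Set (Space N)) (k l : ℝ → ℝ)
    (u₀ : Space N → ℝ) (f u : ℝ → Space N → ℝ) (G : ℝ → Space N → Space N) : Prop :=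
  ∀ n : ℕ, 0 < n → ∀ h : ℝ → ℝ, IsResolventKernel (n : ℝ) l h →
    ∀ (ψ : Space N → ℝ) (g : Space N → Space N), MemEnergySpace bc Ω ψ g →
      (∀ᵐ x ∂(volume.restrict Ω), 0 ≤ ψ x) →
      ∀ᵐ t ∂(volume.restrict (Ioo 0 T)),
        ∫ x in Ω, (ψ x * deriv (fun τ => conv (conv k h) (fun s => u s x - u₀ x) τ) t
            + inner ℝ (conv h (fun s => G s x) t) (g x))
          ≤ ∫ x in Ω, conv h (fun s => f s x) t * ψ x

end Subdiffusion

namespace Subdiffusion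

open Filter Topology
open scoped ENNReal NNReal Convolution

/-! ### Half-line convolution: algebra, existence almost everywhere, mass bounds. -/

section ConvToolkit

variable {F : Type*} [NormedAddCommGroup F] [NormedSpace ℝ F]
  {T t : ℝ}

/-! Since `k ∗ l = 1`, convolving with `l` inverts `∂_t (k ∗ ·)`, and it preserves inequalities once
`l ≥ 0` is known. Applied to the regularized inequalities, it gives `h_n ∗ (V + l ∗ A) ≤ 0`, where
`V` is the pairing of `u - u₀` with a test function and `A` collects the gradient and source terms.
As `n → ∞` this leaves, for almost every time, a weak form of `u - u₀ - l ∗ Δw ≤ l ∗ f` with `w = a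
u^m` and no time derivative (`IsPCPair.ae_add_conv_nonpos`). By separability the exceptional times
can be chosen independently of the test function (`WeakInequality.ae_forall_le`), so `w(t)` itself
may be inserted. Integration in time gives `∫∫ w (u - u₀ - l ∗ f) + ∫∫ ⟨l ∗ ∇w, ∇w⟩ ≤ 0`
(`WeakInequality.integral_le`).

The quadratic term is coercive. Put `y = l ∗ g` and `H = 1 ∗ h` for the resolvent kernel `h` of `γ
l`. Then `h ∗ g = γ (y - h ∗ y)`, and `h ≥ 0` allows `⟨h ∗ y, y⟩` to be bounded by `½ h ∗ |y|² + ½ H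
|y|²`. After integration the weights `γ (1 - H(T - t))` and `γ (1 - H(t))` remain. They equal `k ∗
h` at `T - t` and at `t`, and monotonicity of `k` gives `k ∗ h ≥ k H`. As `γ → ∞`, `H → 1`, and
Fatou's lemma yields `∫ [k(T - t) + k(t)] |l ∗ g|² ≤ 2 ∫ ⟨g, l ∗ g⟩`
(`IsPCPair.lintegral_energy_le`). Reversing time replaces `l ∗ g` by `l ⋆_T g`.

All signs rest on `l ≥ 0` (`IsPCPair.ae_nonneg_l`), which follows from a maximum principle. Forward
averages of `k` are finite at `0` and nonincreasing, so `k ∗ l = 1` becomes, up to an error small in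
`L_1`, a Volterra equation with nonnegative kernel for `S = 1 ∗ l`. Comparison shows first that `S ≥
0`, then that its increments are nonnegative. Positivity of `h` is the same theorem for the pair `(k
+ γ, h/γ)`.

Finally `w u ≥ a₁ u^{m+1}`, and Young's inequality absorbs `w (u₀ + l ∗ f)` into half of this term
(`two_mul_rpow_mul_add_le`). Young's convolution inequality bounds `l ∗ f` in `L_{m+1}`. -/

theorem conv_eq_integral_Ioo (k : ℝ → ℝ) (v : ℝ → F) (ht : 0 ≤ t) :
    conv k v t = ∫ s in Ioo 0 t, k (t - s) • v s := by
  rw [conv, intervalIntegral.integral_of_le ht, integral_Ioc_eq_integral_Ioo]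

theorem indicator_smul_indicator_sub (k : ℝ → ℝ) (v : ℝ → F) (htT : t ≤ T) (s : ℝ) :
    (Ioo 0 T).indicator k (t - s) • (Ioo 0 T).indicator v s
      = (Ioo 0 t).indicator (fun s => k (t - s) • v s) s := by
  by_cases hs : s ∈ Ioo 0 t
  · have h1 : t - s ∈ Ioo 0 T := ⟨by linarith [hs.2], by linarith [hs.1]⟩
    have h2 : s ∈ Ioo 0 T := ⟨hs.1, by linarith [hs.2]⟩
    rw [indicator_of_mem h1, indicator_of_mem h2, indicator_of_mem hs]
  · rw [indicator_of_notMem hs]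
    by_cases h0 : 0 < s
    · have : t - s ∉ Ioo 0 T := fun h => hs ⟨h0, by linarith [h.1]⟩
      rw [indicator_of_notMem this, zero_smul]
    · have : s ∉ Ioo 0 T := fun h => h0 h.1
      rw [indicator_of_notMem this, smul_zero]

/-- For `t ≤ T`, the conditions `s ∈ (0, T)` and `t - s ∈ (0, T)` together mean `0 < s < t`. Cutting
both factors off therefore transfers the theory of convolution on the whole line. -/
theorem conv_eq_convolution (k : ℝ → ℝ) (v : ℝ → F) (ht : 0 ≤ t) (htT : t ≤ T) :
    conv k v t = ((Ioo 0 T).indicator k ⋆[ContinuousLinearMap.lsmul ℝ ℝ, volume]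
      (Ioo 0 T).indicator v) t := by
  rw [convolution_lsmul_swap, conv_eq_integral_Ioo k v ht, ← integral_indicator measurableSet_Ioo]
  exact integral_congr_ae (.of_forall fun s => (indicator_smul_indicator_sub k v htT s).symm)

theorem indicator_ae_eq_of_restrict {X : Type*} [Zero X] {f g : ℝ → X}
    (h : f =ᵐ[volume.restrict (Ioo 0 T)] g) :
    (Ioo 0 T).indicator f =ᵐ[volume] (Ioo 0 T).indicator g := by
  rw [Filter.EventuallyEq, ae_restrict_iff' measurableSet_Ioo] at h
  filter_upwards [h] with x hx
  by_cases hxT : x ∈ Ioo 0 T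
  · simp [hxT, hx hxT]
  · simp [hxT]

theorem conv_congr {k k' : ℝ → ℝ} {v v' : ℝ → F} (ht : 0 ≤ t) (htT : t ≤ T)
    (hk : k =ᵐ[volume.restrict (Ioo 0 T)] k') (hv : v =ᵐ[volume.restrict (Ioo 0 T)] v') :
    conv k v t = conv k' v' t := by
  rw [conv_eq_convolution k v ht htT, conv_eq_convolution k' v' ht htT,
    convolution_congr _ (indicator_ae_eq_of_restrict hk) (indicator_ae_eq_of_restrict hv)]

theorem conv_comm (k l : ℝ → ℝ) (t : ℝ) : conv k l t = conv l k t := by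
  rw [conv, conv]
  have := intervalIntegral.integral_comp_sub_left (fun s => k (t - s) • l s) t (a := 0) (b := t)
  simp only [sub_sub_cancel, sub_self, sub_zero] at this
  rw [← this]
  simp [mul_comm]

/-- Two integrable factors give a convergent integral only for almost every `t`; elsewhere `conv`
may take its default value. The additivity rules below therefore ask for integrability at the given
`t`. -/
theorem ae_integrableOn_conv_integrand {k : ℝ → ℝ} {v : ℝ → F} (hk : IntegrableOn k (Ioo 0 T))
    (hv : IntegrableOn v (Ioo 0 T)) :
    ∀ᵐ t ∂(volume.restrict (Ioo 0 T)), IntegrableOn (fun s => k (t - s) • v s) (Ioo 0 t) := by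
  have h := ((hk.integrable_indicator measurableSet_Ioo).ae_convolution_exists
    (ContinuousLinearMap.lsmul ℝ ℝ) (hv.integrable_indicator measurableSet_Ioo))
  filter_upwards [ae_restrict_of_ae h, ae_restrict_mem measurableSet_Ioo] with t ht htT
  rw [← integrable_indicator_iff measurableSet_Ioo]
  refine (ht.integrable_swap).congr (.of_forall fun s => ?_)
  exact indicator_smul_indicator_sub k v htT.2.le s

theorem integrableOn_conv {k : ℝ → ℝ} {v : ℝ → F} (hk : IntegrableOn k (Ioo 0 T))
    (hv : IntegrableOn v (Ioo 0 T)) : IntegrableOn (conv k v) (Ioo 0 T) := by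
  have h := ((hk.integrable_indicator measurableSet_Ioo).integrable_convolution
    (ContinuousLinearMap.lsmul ℝ ℝ) (hv.integrable_indicator measurableSet_Ioo))
  refine (h.integrableOn (s := Ioo 0 T)).congr ?_
  filter_upwards [ae_restrict_mem measurableSet_Ioo] with t ht
  exact (conv_eq_convolution k v ht.1.le ht.2.le).symm

theorem indicator_conv_ae (k : ℝ → ℝ) (v : ℝ → F) (T : ℝ) :
    conv k v =ᵐ[volume.restrict (Ioo 0 T)]
    ((Ioo 0 T).indicator k ⋆[ContinuousLinearMap.lsmul ℝ ℝ, volume] (Ioo 0 T).indicator v) := by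
  filter_upwards [ae_restrict_mem measurableSet_Ioo] with t ht
  exact conv_eq_convolution k v ht.1.le ht.2.le

/-- On `[0, T]` a convolution only sees its arguments on `(0, T)`. -/
theorem convolution_indicator_congr {f f' : ℝ → ℝ} {g g' : ℝ → F} (hT : 0 < T) (htT : t ≤ T)
    (hf : ∀ s, s < T → f s = f' s) (hg : ∀ s, s < T → g s = g' s) (hf0 : ∀ s ≤ 0, f s = 0)
    (hg0 : ∀ s ≤ 0, g s = 0) :
    (f ⋆[ContinuousLinearMap.lsmul ℝ ℝ, volume] g) t
      = (f' ⋆[ContinuousLinearMap.lsmul ℝ ℝ, volume] g') t := by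
  rw [convolution_lsmul, convolution_lsmul]
  refine integral_congr_ae (.of_forall fun s => ?_)
  dsimp only
  by_cases h0 : s ≤ 0
  · by_cases hs : s < T
    · rw [← hf s hs, hf0 s h0, zero_smul, zero_smul]
    · linarith
  · by_cases hs : s < T
    · rw [hf s hs]
      rw [hg (t - s) (by linarith)]
    · by_cases h' : t - s < T
      · have : t - s ≤ 0 := by linarith
        rw [← hg _ h', hg0 _ this, smul_zero, smul_zero]
      · linarith

theorem convolution_indicator_of_nonpos (g : ℝ → ℝ) (v : ℝ → F) (T : ℝ) (s : ℝ) (hs : s ≤ 0) :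
    ((Ioo 0 T).indicator g ⋆[ContinuousLinearMap.lsmul ℝ ℝ, volume]
      (Ioo 0 T).indicator v) s = 0 := by
  rw [convolution_lsmul]
  refine integral_eq_zero_of_ae (.of_forall fun r => ?_)
  dsimp only [Pi.zero_apply]
  by_cases hr : 0 < r
  · have : s - r ∉ Ioo 0 T := fun h => by linarith [h.1]
    rw [indicator_of_notMem this, smul_zero]
  · have : r ∉ Ioo 0 T := fun h => hr h.1
    rw [indicator_of_notMem this, zero_smul]

theorem indicator_conv_eq_convolution (g : ℝ → ℝ) (v : ℝ → F) (T : ℝ) (s : ℝ) (hs : s < T) :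
    (Ioo 0 T).indicator (conv g v) s = ((Ioo 0 T).indicator g
      ⋆[ContinuousLinearMap.lsmul ℝ ℝ, volume] (Ioo 0 T).indicator v) s := by
  by_cases h0 : 0 < s
  · rw [indicator_of_mem (show s ∈ Ioo 0 T from ⟨h0, hs⟩), conv_eq_convolution g v h0.le hs.le]
  · rw [indicator_of_notMem (fun h => h0 h.1),
      convolution_indicator_of_nonpos g v T s (not_lt.mp h0)]

/-- The pointwise form is kept beside the almost-everywhere one because identities for primitives
are needed at every `t`. -/
theorem conv_assoc_of_integrable [CompleteSpace F] {f g : ℝ → ℝ} {v : ℝ → F} (hf : IntegrableOn f (Ioo 0 T))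
    (hg : IntegrableOn g (Ioo 0 T)) (hv : IntegrableOn v (Ioo 0 T)) (ht : 0 ≤ t) (htT : t ≤ T)
    (hi : ConvolutionExistsAt (fun x => ‖(Ioo 0 T).indicator f x‖)
      ((fun x => ‖(Ioo 0 T).indicator g x‖) ⋆[ContinuousLinearMap.mul ℝ ℝ, volume]
        fun x => ‖(Ioo 0 T).indicator v x‖) t (ContinuousLinearMap.mul ℝ ℝ) volume) :
    conv f (conv g v) t = conv (conv f g) v t := by
  rcases ht.eq_or_lt with rfl | ht0
  · simp [conv]
  have hT : 0 < T := ht0.trans_le htT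
  have hf' := hf.integrable_indicator measurableSet_Ioo
  have hg' := hg.integrable_indicator measurableSet_Ioo
  have hv' := hv.integrable_indicator measurableSet_Ioo
  have key := convolution_assoc (ContinuousLinearMap.lsmul ℝ ℝ) (ContinuousLinearMap.lsmul ℝ ℝ)
    (ContinuousLinearMap.lsmul ℝ ℝ) (ContinuousLinearMap.lsmul ℝ ℝ) (f := (Ioo 0 T).indicator f)
    (g := (Ioo 0 T).indicator g) (k := (Ioo 0 T).indicator v) (x₀ := t) (μ := volume) (ν := volume)
    (fun x y z => mul_smul x y z) hf'.aestronglyMeasurable hg'.aestronglyMeasurable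
    hv'.aestronglyMeasurable (hf'.ae_convolution_exists _ hg')
    (hg'.norm.ae_convolution_exists _ hv'.norm) hi
  rw [conv_eq_convolution f _ ht htT, conv_eq_convolution _ v ht htT,
    convolution_indicator_congr hT htT (fun _ _ => rfl)
    (indicator_conv_eq_convolution g v T)
    (fun s hs => indicator_of_notMem (fun h => by linarith [h.1]) _)
    (fun s hs => indicator_of_notMem (fun h => by linarith [h.1]) _), ← key,
    convolution_indicator_congr hT htT
    (fun s hs => (indicator_conv_eq_convolution f g T s hs).symm) (fun _ _ => rfl)
    (convolution_indicator_of_nonpos f g T) (fun s hs => indicator_of_notMem (fun h => by linarith [h.1]) _)]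

theorem conv_assoc_ae [CompleteSpace F] {f g : ℝ → ℝ} {v : ℝ → F} (hf : IntegrableOn f (Ioo 0 T))
    (hg : IntegrableOn g (Ioo 0 T)) (hv : IntegrableOn v (Ioo 0 T)) :
    ∀ᵐ t ∂(volume.restrict (Ioo 0 T)), conv f (conv g v) t = conv (conv f g) v t := by
  have h := (hf.integrable_indicator measurableSet_Ioo).norm.ae_convolution_exists
    (ContinuousLinearMap.mul ℝ ℝ)
    ((hg.integrable_indicator measurableSet_Ioo).norm.integrable_convolution
    (ContinuousLinearMap.mul ℝ ℝ) (hv.integrable_indicator measurableSet_Ioo).norm)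
  filter_upwards [ae_restrict_of_ae h, ae_restrict_mem measurableSet_Ioo] with t ht htT
  exact conv_assoc_of_integrable hf hg hv htT.1.le htT.2.le ht

theorem conv_one (v : ℝ → F) (t : ℝ) : conv (fun _ => 1) v t = ∫ s in (0 : ℝ)..t, v s := by
  simp [conv]

/-- Integrating a convolution. -/
theorem integral_conv [CompleteSpace F] {g : ℝ → ℝ} {v : ℝ → F} (hg : IntegrableOn g (Ioo 0 T))
    (hv : IntegrableOn v (Ioo 0 T)) (ht : 0 ≤ t) (htT : t ≤ T) :
    ∫ s in (0 : ℝ)..t, conv g v s = conv (fun τ => ∫ s in (0 : ℝ)..τ, g s) v t := by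
  have h1 : IntegrableOn (fun _ : ℝ => (1 : ℝ)) (Ioo 0 T) := by simp
  have := conv_assoc_of_integrable (f := fun _ => 1) h1 hg hv ht htT ?_
  · simpa only [conv_one, funext (conv_one g)] using this
  -- With the constant `1` as first factor, the absolute triple convolution integrates a bounded
  -- function against an integrable one, so it exists at every point.
  · have hI := ((hg.integrable_indicator measurableSet_Ioo).norm.integrable_convolution
      (ContinuousLinearMap.mul ℝ ℝ) (hv.integrable_indicator measurableSet_Ioo).norm)
    unfold ConvolutionExistsAt
    simp only [ContinuousLinearMap.mul_apply']
    refine (hI.comp_sub_left t).bdd_mul (c := 1) ?_ ?_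
    · exact (h1.integrable_indicator measurableSet_Ioo).aestronglyMeasurable.norm
    · refine .of_forall fun s => ?_
      by_cases hs : s ∈ Ioo 0 T <;> simp [hs]

theorem conv_add_right {k : ℝ → ℝ} {v w : ℝ → F} (ht : 0 ≤ t)
    (hv : IntegrableOn (fun s => k (t - s) • v s) (Ioo 0 t))
    (hw : IntegrableOn (fun s => k (t - s) • w s) (Ioo 0 t)) :
    conv k (fun s => v s + w s) t = conv k v t + conv k w t := by
  simp only [conv_eq_integral_Ioo k _ ht, smul_add]
  exact integral_add hv hw

theorem conv_sub_right {k : ℝ → ℝ} {v w : ℝ → F} (ht : 0 ≤ t)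
    (hv : IntegrableOn (fun s => k (t - s) • v s) (Ioo 0 t))
    (hw : IntegrableOn (fun s => k (t - s) • w s) (Ioo 0 t)) :
    conv k (fun s => v s - w s) t = conv k v t - conv k w t := by
  simp only [conv_eq_integral_Ioo k _ ht, smul_sub]
  exact integral_sub hv hw

theorem conv_smul_right (k : ℝ → ℝ) (c : ℝ) (v : ℝ → F) (t : ℝ) :
    conv k (fun s => c • v s) t = c • conv k v t := by
  simp only [conv, smul_comm _ c]
  exact intervalIntegral.integral_smul c _

theorem conv_mul_left (c : ℝ) (k : ℝ → ℝ) (v : ℝ → F) (t : ℝ) :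
    conv (fun s => c * k s) v t = c • conv k v t := by
  simp only [conv, mul_smul]
  exact intervalIntegral.integral_smul c _

theorem conv_sub_left {k k' : ℝ → ℝ} {v : ℝ → F} (ht : 0 ≤ t)
    (hv : IntegrableOn (fun s => k (t - s) • v s) (Ioo 0 t))
    (hw : IntegrableOn (fun s => k' (t - s) • v s) (Ioo 0 t)) :
    conv (fun s => k s - k' s) v t = conv k v t - conv k' v t := by
  simp only [conv_eq_integral_Ioo _ _ ht, sub_smul]
  exact integral_sub hv hw

theorem conv_add_left {k k' : ℝ → ℝ} {v : ℝ → F} (ht : 0 ≤ t)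
    (hv : IntegrableOn (fun s => k (t - s) • v s) (Ioo 0 t))
    (hw : IntegrableOn (fun s => k' (t - s) • v s) (Ioo 0 t)) :
    conv (fun s => k s + k' s) v t = conv k v t + conv k' v t := by
  simp only [conv_eq_integral_Ioo _ _ ht, add_smul]
  exact integral_add hv hw

theorem ae_comp_sub_of_ae {p : ℝ → Prop} (h : ∀ᵐ s ∂(volume.restrict (Ioo 0 T)), p s)
    (htT : t ≤ T) : ∀ᵐ s ∂(volume.restrict (Ioo 0 t)), p (t - s) := by
  rw [ae_restrict_iff' measurableSet_Ioo] at h ⊢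
  have := (quasiMeasurePreserving_sub_left_of_right_invariant volume t).ae h
  filter_upwards [this] with s hs hst
  exact hs ⟨by linarith [hst.2], by linarith [hst.1]⟩

theorem ae_restrict_Ioo_of_le {p : ℝ → Prop} (h : ∀ᵐ s ∂(volume.restrict (Ioo 0 T)), p s)
    (htT : t ≤ T) : ∀ᵐ s ∂(volume.restrict (Ioo 0 t)), p s :=
  ae_mono (Measure.restrict_mono (Ioo_subset_Ioo_right htT) le_rfl) h

theorem conv_nonneg {k v : ℝ → ℝ} (ht : 0 ≤ t) (htT : t ≤ T)
    (hk : ∀ᵐ s ∂(volume.restrict (Ioo 0 T)), 0 ≤ k s)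
    (hv : ∀ᵐ s ∂(volume.restrict (Ioo 0 T)), 0 ≤ v s) : 0 ≤ conv k v t := by
  rw [conv_eq_integral_Ioo k v ht]
  refine integral_nonneg_of_ae ?_
  filter_upwards [ae_comp_sub_of_ae hk htT, ae_restrict_Ioo_of_le hv htT] with s h1 h2
  exact mul_nonneg h1 h2

theorem conv_mono {k v w : ℝ → ℝ} (ht : 0 ≤ t) (htT : t ≤ T)
    (hk : ∀ᵐ s ∂(volume.restrict (Ioo 0 T)), 0 ≤ k s)
    (hvw : ∀ᵐ s ∂(volume.restrict (Ioo 0 T)), v s ≤ w s)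
    (hv : IntegrableOn (fun s => k (t - s) • v s) (Ioo 0 t))
    (hw : IntegrableOn (fun s => k (t - s) • w s) (Ioo 0 t)) : conv k v t ≤ conv k w t := by
  rw [conv_eq_integral_Ioo k v ht, conv_eq_integral_Ioo k w ht]
  refine integral_mono_ae hv hw ?_
  filter_upwards [ae_comp_sub_of_ae hk htT, ae_restrict_Ioo_of_le hvw htT] with s h1 h2
  exact mul_le_mul_of_nonneg_left h2 h1

theorem norm_conv_le (k : ℝ → ℝ) (v : ℝ → F) (ht : 0 ≤ t) :
    ‖conv k v t‖ ≤ conv (fun s => |k s|) (fun s => ‖v s‖) t := by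
  rw [conv_eq_integral_Ioo k v ht, conv_eq_integral_Ioo _ _ ht]
  refine (norm_integral_le_integral_norm _).trans_eq ?_
  simp [norm_smul]

/-- Total mass of a convolution of nonnegative functions. -/
theorem integral_conv_le {k v : ℝ → ℝ} (hk : IntegrableOn k (Ioo 0 T))
    (hv : IntegrableOn v (Ioo 0 T)) (hk0 : ∀ᵐ s ∂(volume.restrict (Ioo 0 T)), 0 ≤ k s)
    (hv0 : ∀ᵐ s ∂(volume.restrict (Ioo 0 T)), 0 ≤ v s) :
    ∫ t in Ioo 0 T, conv k v t ≤ (∫ t in Ioo 0 T, k t) * ∫ t in Ioo 0 T, v t := by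
  have hk' := hk.integrable_indicator measurableSet_Ioo
  have hv' := hv.integrable_indicator measurableSet_Ioo
  have h0 : ∀ {f : ℝ → ℝ}, (∀ᵐ s ∂(volume.restrict (Ioo 0 T)), 0 ≤ f s) →
      ∀ᵐ s, 0 ≤ (Ioo 0 T).indicator f s := by
    intro f hf
    rw [ae_restrict_iff' measurableSet_Ioo] at hf
    filter_upwards [hf] with s hs
    exact indicator_apply_nonneg hs
  rw [integral_congr_ae (indicator_conv_ae k v T)]
  -- On all of `ℝ` the mass of the convolution of the cut-off factors is exactly the product of the
  -- masses; restriction to `(0, T)` only loses mass.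
  refine (setIntegral_le_integral (hk'.integrable_convolution _ hv') ?_).trans_eq ?_
  · refine .of_forall fun t => ?_
    rw [convolution_lsmul]
    refine integral_nonneg_of_ae ?_
    filter_upwards [h0 hk0, (quasiMeasurePreserving_sub_left_of_right_invariant volume t).ae
      (h0 hv0)] with s h1 h2
    exact mul_nonneg h1 h2
  · rw [integral_convolution _ hk' hv', integral_indicator measurableSet_Ioo,
      integral_indicator measurableSet_Ioo]
    rfl

theorem integral_norm_conv_le {k : ℝ → ℝ} {v : ℝ → F} (hk : IntegrableOn k (Ioo 0 T))
    (hv : IntegrableOn v (Ioo 0 T)) :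
    ∫ t in Ioo 0 T, ‖conv k v t‖ ≤ (∫ t in Ioo 0 T, |k t|) * ∫ t in Ioo 0 T, ‖v t‖ := by
  refine le_trans ?_ (integral_conv_le hk.abs hv.norm (.of_forall fun _ => abs_nonneg _)
    (.of_forall fun _ => norm_nonneg _))
  refine setIntegral_mono_on (integrableOn_conv hk hv).norm (integrableOn_conv hk.abs hv.norm)
    measurableSet_Ioo fun t ht => norm_conv_le k v ht.1.le

end ConvToolkit

/-! ### Forward averages of the kernel and their convergence in `L_1`. -/

section Positivity

theorem integrableOn_Ioo_of_locallyIntegrableOn {k : ℝ → ℝ}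
    (hk : LocallyIntegrableOn k (Ici 0)) (T : ℝ) : IntegrableOn k (Ioo 0 T) :=
  (hk.integrableOn_compact_subset (fun _ hx => hx.1) isCompact_Icc).mono_set
    (Ioo_subset_Icc_self (a := 0) (b := T))

theorem intervalIntegrable_of_integrableOn {F : Type*} [NormedAddCommGroup F] {v : ℝ → F}
    {T a b : ℝ} (hv : IntegrableOn v (Ioo 0 T)) (ha : 0 ≤ a) (hb : 0 ≤ b) (haT : a ≤ T)
    (hbT : b ≤ T) : IntervalIntegrable v volume a b := by
  rw [intervalIntegrable_iff]
  have : IntegrableOn v (Ioc 0 T) := by rwa [integrableOn_Ioc_iff_integrableOn_Ioo]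
  exact this.mono_set fun x hx => ⟨(le_min ha hb).trans_lt hx.1, hx.2.trans (max_le haT hbT)⟩

theorem continuousOn_integral {F : Type*} [NormedAddCommGroup F] [NormedSpace ℝ F] {v : ℝ → F}
    {T : ℝ} (hT : 0 ≤ T) (hv : IntegrableOn v (Ioo 0 T)) :
    ContinuousOn (fun t => ∫ s in (0 : ℝ)..t, v s) (Icc 0 T) := by
  have := intervalIntegral.continuousOn_primitive_interval (f := v) (a := 0) (b := T)
    (μ := volume) ?_
  · rwa [uIcc_of_le hT] at this
  · rwa [uIcc_of_le hT, integrableOn_Icc_iff_integrableOn_Ioo]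

/-- A function with nonnegative integrals over intervals is nonnegative. -/
theorem ae_nonneg_of_intervalIntegral_nonneg {v : ℝ → ℝ} {T : ℝ} (hv : IntegrableOn v (Ioo 0 T))
    (h : ∀ a b, 0 ≤ a → a ≤ b → b ≤ T → 0 ≤ ∫ s in a..b, v s) :
    ∀ᵐ t ∂(volume.restrict (Ioo 0 T)), 0 ≤ v t := by
  rcases le_or_gt T 0 with hT | hT
  · simp [Ioo_eq_empty (not_lt.mpr hT)]
  have hi := intervalIntegrable_of_integrableOn hv le_rfl hT.le hT.le le_rfl
  have hd := hi.ae_hasDerivAt_integral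
  rw [ae_restrict_iff' measurableSet_Ioo]
  filter_upwards [hd] with t ht htT
  rw [uIcc_of_le hT.le] at ht
  have h1 := ht ⟨htT.1.le, htT.2.le⟩ 0 ⟨le_rfl, hT.le⟩
  have hm : MonotoneOn (fun x => ∫ s in (0 : ℝ)..x, v s) (Ioo 0 T) := by
    intro a ha b hb hab
    have := h a b ha.1.le hab hb.2.le
    have h2 := intervalIntegral.integral_add_adjacent_intervals
      (intervalIntegrable_of_integrableOn hv le_rfl ha.1.le hT.le ha.2.le)
      (intervalIntegrable_of_integrableOn hv ha.1.le hb.1.le ha.2.le hb.2.le)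
    dsimp only
    linarith
  have h2 := hm.derivWithin_nonneg (x := t)
  rwa [derivWithin_of_isOpen isOpen_Ioo htT, h1.deriv] at h2

/-- A continuous function that is almost everywhere nonnegative is nonnegative. -/
theorem nonneg_of_ae_nonneg {f : ℝ → ℝ} {T : ℝ} (hT : 0 < T) (hf : ContinuousOn f (Icc 0 T))
    (h : ∀ᵐ t ∂(volume.restrict (Ioo 0 T)), 0 ≤ f t) {t : ℝ} (ht : t ∈ Icc 0 T) : 0 ≤ f t := by
  have h' : f =ᵐ[volume.restrict (Icc 0 T)] fun t => max (f t) 0 := by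
    rw [← restrict_Ioo_eq_restrict_Icc]
    filter_upwards [h] with t ht
    rw [max_eq_left ht]
  have := Measure.eqOn_Icc_of_ae_eq volume hT.ne h' hf (hf.sup continuousOn_const) ht
  rw [this]
  exact le_max_right _ _

/-- Forward averages of a kernel. -/
noncomputable def forwardAvg (k : ℝ → ℝ) (ε t : ℝ) : ℝ := ε⁻¹ * ∫ s in t..t + ε, k s

/-- Forward difference quotients of a kernel. -/
noncomputable def decrement (k : ℝ → ℝ) (ε t : ℝ) : ℝ := ε⁻¹ * (k t - k (t + ε))

variable {k l : ℝ → ℝ} {ε T : ℝ}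

theorem IsPCPair.integrableOn_k (h : IsPCPair k l) (T : ℝ) : IntegrableOn k (Ioo 0 T) :=
  integrableOn_Ioo_of_locallyIntegrableOn h.locInt_k T

theorem IsPCPair.integrableOn_l (h : IsPCPair k l) (T : ℝ) : IntegrableOn l (Ioo 0 T) :=
  integrableOn_Ioo_of_locallyIntegrableOn h.locInt_l T

theorem IsPCPair.intervalIntegrable_k (h : IsPCPair k l) {a b : ℝ} (ha : 0 ≤ a) (hb : 0 ≤ b) :
    IntervalIntegrable k volume a b :=
  intervalIntegrable_of_integrableOn (h.integrableOn_k (max a b)) ha hb (le_max_left _ _)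
    (le_max_right _ _)

theorem IsPCPair.ae_nonneg_k (h : IsPCPair k l) (T : ℝ) :
    ∀ᵐ t ∂(volume.restrict (Ioo 0 T)), 0 ≤ k t := by
  filter_upwards [ae_restrict_mem measurableSet_Ioo] with t ht using h.nonneg_k t ht.1

theorem IsPCPair.ae_conv_eq_one (h : IsPCPair k l) (T : ℝ) :
    ∀ᵐ t ∂(volume.restrict (Ioo 0 T)), conv k l t = 1 :=
  ae_mono (Measure.restrict_mono (fun _ hx => hx.1) le_rfl) h.conv_eq_one

theorem IsPCPair.decrement_nonneg (h : IsPCPair k l) (hε : 0 < ε) {t : ℝ} (ht : 0 < t) :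
    0 ≤ decrement k ε t := by
  have := h.antitone_k (mem_Ioi.mpr ht) (mem_Ioi.mpr (by linarith : 0 < t + ε)) (by linarith)
  exact mul_nonneg (by positivity) (by linarith)

theorem IsPCPair.intervalIntegrable_shift (h : IsPCPair k l) (hε : 0 < ε) {a b : ℝ} (ha : 0 ≤ a)
    (hb : 0 ≤ b) : IntervalIntegrable (fun s => k (s + ε)) volume a b := by
  have := (h.intervalIntegrable_k (a := a + ε) (b := b + ε) (by linarith)
    (by linarith)).comp_add_right ε
  simpa using this

theorem IsPCPair.integrableOn_shift (h : IsPCPair k l) (hε : 0 < ε) (T : ℝ) :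
    IntegrableOn (fun s => k (s + ε)) (Ioo 0 T) := by
  rcases le_or_gt T 0 with hT | hT
  · simp [Ioo_eq_empty (not_lt.mpr hT)]
  have := h.intervalIntegrable_shift hε le_rfl hT.le
  rwa [intervalIntegrable_iff, uIoc_of_le hT.le, integrableOn_Ioc_iff_integrableOn_Ioo] at this

theorem IsPCPair.integrableOn_decrement (h : IsPCPair k l) (hε : 0 < ε) (T : ℝ) :
    IntegrableOn (decrement k ε) (Ioo 0 T) :=
  ((h.integrableOn_k T).sub (h.integrableOn_shift hε T)).const_mul _

/-- Averaging yields a kernel that is finite at `0`, even if `k` blows up there, and absolutely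
continuous with derivative minus the nonnegative `decrement`. -/
theorem IsPCPair.forwardAvg_eq (h : IsPCPair k l) (hε : 0 < ε) {t : ℝ} (ht : 0 ≤ t) :
    forwardAvg k ε t = forwardAvg k ε 0 - ∫ s in (0 : ℝ)..t, decrement k ε s := by
  have hc := intervalIntegral.integral_comp_add_right k ε (a := 0) (b := t)
  have h1 := intervalIntegral.integral_interval_sub_interval_comm
    (h.intervalIntegrable_k (a := 0) (b := t) le_rfl ht)
    (h.intervalIntegrable_k (a := ε) (b := t + ε) hε.le (by linarith))
    (h.intervalIntegrable_k (a := 0) (b := ε) le_rfl hε.le)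
  simp only [decrement, forwardAvg, intervalIntegral.integral_const_mul]
  rw [intervalIntegral.integral_sub (h.intervalIntegrable_k le_rfl ht)
    (h.intervalIntegrable_shift hε le_rfl ht), hc]
  simp only [zero_add] at h1 ⊢
  rw [h1]
  ring

theorem IsPCPair.forwardAvg_le (h : IsPCPair k l) (hε : 0 < ε) {t : ℝ} (ht : 0 < t) :
    forwardAvg k ε t ≤ k t := by
  have : ∫ s in t..t + ε, k s ≤ ∫ s in t..t + ε, k t :=
    intervalIntegral.integral_mono_on (by linarith)
      (h.intervalIntegrable_k ht.le (by linarith)) (by simp) fun s hs =>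
        h.antitone_k (mem_Ioi.mpr ht) (mem_Ioi.mpr (ht.trans_le hs.1)) hs.1
  rw [intervalIntegral.integral_const, add_sub_cancel_left, smul_eq_mul] at this
  rw [forwardAvg, inv_mul_le_iff₀ hε]
  exact this

theorem IsPCPair.le_forwardAvg (h : IsPCPair k l) (hε : 0 < ε) {t : ℝ} (ht : 0 < t) :
    k (t + ε) ≤ forwardAvg k ε t := by
  have : ∫ s in t..t + ε, k (t + ε) ≤ ∫ s in t..t + ε, k s :=
    intervalIntegral.integral_mono_on (by linarith) (by simp)
      (h.intervalIntegrable_k ht.le (by linarith)) fun s hs =>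
        h.antitone_k (mem_Ioi.mpr (ht.trans_le hs.1)) (mem_Ioi.mpr (by linarith)) hs.2
  rw [intervalIntegral.integral_const, add_sub_cancel_left, smul_eq_mul] at this
  rw [forwardAvg, le_inv_mul_iff₀ hε]
  exact this

theorem IsPCPair.integrableOn_forwardAvg (h : IsPCPair k l) (hε : 0 < ε) (T : ℝ) :
    IntegrableOn (forwardAvg k ε) (Ioo 0 T) := by
  rcases le_or_gt T 0 with hT | hT
  · simp [Ioo_eq_empty (not_lt.mpr hT)]
  have hc : ContinuousOn (fun t => forwardAvg k ε 0 - ∫ s in (0 : ℝ)..t, decrement k ε s)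
      (Icc 0 T) := continuousOn_const.sub
        (continuousOn_integral hT.le (h.integrableOn_decrement hε T))
  refine (hc.integrableOn_Icc.mono_set Ioo_subset_Icc_self).congr ?_
  filter_upwards [ae_restrict_mem measurableSet_Ioo] with t ht
  rw [h.forwardAvg_eq hε ht.1.le]

/-- The average dominates `k (t + ε)`, and the integral of `k t - k (t + ε)` telescopes to boundary
pieces at `0` and `T`; the one at `T` has a favourable sign. -/
theorem IsPCPair.integral_sub_forwardAvg_le (h : IsPCPair k l) (hε : 0 < ε) (hT : 0 < T) :
    ∫ t in Ioo 0 T, (k t - forwardAvg k ε t) ≤ ∫ t in (0 : ℝ)..ε, k t := by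
  have h1 : ∫ t in Ioo 0 T, (k t - forwardAvg k ε t) ≤ ∫ t in Ioo 0 T, (k t - k (t + ε)) :=
    setIntegral_mono_on ((h.integrableOn_k T).sub (h.integrableOn_forwardAvg hε T))
      ((h.integrableOn_k T).sub (h.integrableOn_shift hε T)) measurableSet_Ioo fun t ht => by
        have := h.le_forwardAvg hε ht.1
        linarith
  refine h1.trans ?_
  rw [← integral_Ioc_eq_integral_Ioo, ← intervalIntegral.integral_of_le hT.le]
  rw [intervalIntegral.integral_sub (h.intervalIntegrable_k le_rfl hT.le)
    (h.intervalIntegrable_shift hε le_rfl hT.le),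
    intervalIntegral.integral_comp_add_right k ε (a := 0) (b := T)]
  have h2 := intervalIntegral.integral_interval_sub_interval_comm
    (h.intervalIntegrable_k (a := 0) (b := T) le_rfl hT.le)
    (h.intervalIntegrable_k (a := ε) (b := T + ε) hε.le (by linarith))
    (h.intervalIntegrable_k (a := 0) (b := ε) le_rfl hε.le)
  have h3 : 0 ≤ ∫ t in T..T + ε, k t := intervalIntegral.integral_nonneg (by linarith)
    fun t ht => h.nonneg_k t (hT.trans_le ht.1)
  rw [zero_add, h2]
  linarith

theorem IsPCPair.tendsto_integral_sub_forwardAvg (h : IsPCPair k l) (hT : 0 < T) :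
    Tendsto (fun ε => ∫ t in Ioo 0 T, (k t - forwardAvg k ε t)) (𝓝[>] 0) (𝓝 0) := by
  have hc := (continuousOn_integral zero_le_one (h.integrableOn_k 1)) 0 (by simp)
  have hc' : Tendsto (fun t => ∫ s in (0 : ℝ)..t, k s) (𝓝[>] 0) (𝓝 0) := by
    have h0 := hc.mono_left (nhdsWithin_mono 0 (Ioo_subset_Icc_self (a := (0 : ℝ)) (b := 1)))
    simpa [nhdsWithin_Ioo_eq_nhdsGT] using h0
  refine squeeze_zero' ?_ ?_ hc'
  · filter_upwards [self_mem_nhdsWithin] with ε hε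
    exact setIntegral_nonneg measurableSet_Ioo fun t ht => sub_nonneg.mpr (h.forwardAvg_le hε ht.1)
  · filter_upwards [self_mem_nhdsWithin] with ε hε
    exact h.integral_sub_forwardAvg_le hε hT

end Positivity

/-! ### A maximum principle for `k`, and nonnegativity of `l`. -/

section PositivityOfConjugate

variable {k l : ℝ → ℝ} {ε T : ℝ}

theorem ae_eq_zero_of_integral_eq_zero {m : ℝ → ℝ} (hT : 0 < T) (hm : IntegrableOn m (Ioo 0 T))
    (hm0 : ∀ t, 0 ≤ m t)
    (h : ∀ᵐ t ∂(volume.restrict (Ioo 0 T)), ∫ s in (0 : ℝ)..t, m s = 0) :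
    ∀ᵐ t ∂(volume.restrict (Ioo 0 T)), m t = 0 := by
  have h1 : 0 ≤ - ∫ s in (0 : ℝ)..T, m s :=
    nonneg_of_ae_nonneg hT (continuousOn_integral hT.le hm).neg
      (by filter_upwards [h] with t ht; simp [ht]) ⟨hT.le, le_rfl⟩
  rw [intervalIntegral.integral_of_le hT.le, integral_Ioc_eq_integral_Ioo] at h1
  have h2 : ∫ s in Ioo 0 T, m s = 0 :=
    le_antisymm (by linarith) (integral_nonneg hm0)
  exact (integral_eq_zero_iff_of_nonneg hm0 hm).mp h2

/-- A nonnegative function annihilated by a kernel with a conjugate kernel vanishes. -/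
theorem IsPCPair.ae_eq_zero_of_conv (h : IsPCPair k l) (hT : 0 < T) {m : ℝ → ℝ}
    (hm : IntegrableOn m (Ioo 0 T)) (hm0 : ∀ t, 0 ≤ m t)
    (h0 : ∀ᵐ t ∂(volume.restrict (Ioo 0 T)), conv k m t = 0) :
    ∀ᵐ t ∂(volume.restrict (Ioo 0 T)), m t = 0 := by
  refine ae_eq_zero_of_integral_eq_zero hT hm hm0 ?_
  filter_upwards [conv_assoc_ae (h.integrableOn_l T) (h.integrableOn_k T) hm,
    ae_restrict_mem measurableSet_Ioo] with t ht htT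
  -- This is `1 ∗ m = (l ∗ k) ∗ m = l ∗ (k ∗ m) = l ∗ 0`; the sign of `l`, not yet known, plays no
  -- role.
  rw [← conv_one, ← conv_congr (T := T) (k := conv l k) htT.1.le htT.2.le _ (ae_eq_refl m), ← ht,
    conv_congr (T := T) (k' := l) (v' := fun _ => 0) htT.1.le htT.2.le (ae_eq_refl l) h0]
  · simp [conv]
  · filter_upwards [h.ae_conv_eq_one T] with s hs
    rw [conv_comm, hs]

/-- Convolution with the forward average, in terms of its decrements. -/
theorem IsPCPair.conv_forwardAvg (h : IsPCPair k l) (hε : 0 < ε) {m : ℝ → ℝ}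
    (hm : IntegrableOn m (Ioo 0 T)) : ∀ᵐ t ∂(volume.restrict (Ioo 0 T)),
    conv (forwardAvg k ε) m t = forwardAvg k ε 0 * (∫ s in (0 : ℝ)..t, m s)
      - ∫ s in (0 : ℝ)..t, conv (decrement k ε) m s := by
  have hq := h.integrableOn_decrement hε T
  rcases le_or_gt T 0 with hT | hT
  · simp [Ioo_eq_empty (not_lt.mpr hT)]
  have hQ : IntegrableOn (fun t => ∫ s in (0 : ℝ)..t, decrement k ε s) (Ioo 0 T) :=
    (continuousOn_integral hT.le hq).integrableOn_Icc.mono_set Ioo_subset_Icc_self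
  have h1 : IntegrableOn (fun _ : ℝ => forwardAvg k ε 0) (Ioo 0 T) := by simp
  filter_upwards [ae_integrableOn_conv_integrand h1 hm, ae_integrableOn_conv_integrand hQ hm,
    ae_restrict_mem measurableSet_Ioo] with t hc hQt htT
  rw [integral_conv hq hm htT.1.le htT.2.le,
    conv_congr (T := T) (k' := fun t => forwardAvg k ε 0 - ∫ s in (0 : ℝ)..t, decrement k ε s)
      htT.1.le htT.2.le _ (ae_eq_refl m), conv_sub_left htT.1.le hc hQt]
  · congr 1
    simp [conv]
  · filter_upwards [ae_restrict_mem measurableSet_Ioo] with s hs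
    rw [h.forwardAvg_eq hε hs.1.le]

/-- A maximum principle: a function satisfying, up to errors vanishing in `L_1`, the differential
inequality `∂_t (k ∗ D) ≥ 0` for the regularized kernels is nonnegative. -/
theorem IsPCPair.ae_nonneg_of_decrement_le (h : IsPCPair k l) (hT : 0 < T) {D : ℝ → ℝ}
    (hD : IntegrableOn D (Ioo 0 T)) (e : ℝ → ℝ → ℝ)
    (he : ∀ ε, 0 < ε → IntegrableOn (e ε) (Ioo 0 T)) (he0 : ∀ ε t, 0 ≤ e ε t)
    (hlim : Tendsto (fun ε => ∫ t in Ioo 0 T, e ε t) (𝓝[>] 0) (𝓝 0))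
    (hle : ∀ ε, 0 < ε → ∀ᵐ t ∂(volume.restrict (Ioo 0 T)),
      conv (decrement k ε) D t - e ε t ≤ forwardAvg k ε 0 * D t) :
    ∀ᵐ t ∂(volume.restrict (Ioo 0 T)), 0 ≤ D t := by
  -- The negative part of `D`; it is shown to satisfy `k ∗ m = 0`.
  set m : ℝ → ℝ := fun t => max (-D t) 0 with hm_def
  have hm : IntegrableOn m (Ioo 0 T) := hD.neg.pos_part
  have hm0 : ∀ t, 0 ≤ m t := fun t => le_max_right _ _
  have hkm := integrableOn_conv (h.integrableOn_k T) hm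
  have key : ∀ ε, 0 < ε → ∀ᵐ t ∂(volume.restrict (Ioo 0 T)),
      conv k m t ≤ (∫ t in Ioo 0 T, e ε t) + conv (fun s => k s - forwardAvg k ε s) m t := by
    intro ε hε
    have hq := h.integrableOn_decrement hε T
    have hq0 : ∀ᵐ s ∂(volume.restrict (Ioo 0 T)), 0 ≤ decrement k ε s := by
      filter_upwards [ae_restrict_mem measurableSet_Ioo] with s hs using h.decrement_nonneg hε hs.1
    have hA := h.integrableOn_forwardAvg hε T
    have hqm := integrableOn_conv hq hm
    have hstep : ∀ᵐ t ∂(volume.restrict (Ioo 0 T)),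
        forwardAvg k ε 0 * m t ≤ conv (decrement k ε) m t + e ε t := by
      filter_upwards [hle ε hε, ae_integrableOn_conv_integrand hq hD,
        ae_integrableOn_conv_integrand hq hm.neg, ae_restrict_mem measurableSet_Ioo]
        with t h1 h2 h3 htT
      have h5 := conv_nonneg htT.1.le htT.2.le hq0 (.of_forall hm0)
      rcases le_total 0 (D t) with h4 | h4
      · have : m t = 0 := max_eq_right (by linarith)
        rw [this, mul_zero]
        exact add_nonneg h5 (he0 ε t)
      -- Where `D ≤ 0`, the hypothesis bounds `-D` times the averaged kernel at `0` by `-(q ∗ D) +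
      -- e`, and `-m ≤ D` with `q ≥ 0` (the decrement) bounds this by `q ∗ m + e`.
      · have : m t = - D t := max_eq_left (by linarith)
        have h6 : conv (decrement k ε) (-m) t ≤ conv (decrement k ε) D t :=
          conv_mono htT.1.le htT.2.le hq0 (.of_forall fun s => by
            have := le_max_left (-D s) 0
            simp only [Pi.neg_apply, hm_def]
            linarith) h3 h2
        have h7 : conv (decrement k ε) (-m) t = - conv (decrement k ε) m t := by
          simp [conv]
        rw [this, mul_neg]
        linarith
    filter_upwards [h.conv_forwardAvg hε hm, ae_integrableOn_conv_integrand (h.integrableOn_k T) hm,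
      ae_integrableOn_conv_integrand hA hm, ae_restrict_mem measurableSet_Ioo]
      with t h1 h2 h3 htT
    rw [conv_sub_left htT.1.le h2 h3, h1]
    have hi : ∀ {f : ℝ → ℝ}, IntegrableOn f (Ioo 0 T) → IntervalIntegrable f volume 0 t :=
      fun hf => intervalIntegrable_of_integrableOn hf le_rfl htT.1.le hT.le htT.2.le
    -- Integrating `hstep` reconstructs the averaged kernel convolved with `m`: by
    -- `conv_forwardAvg`, it is the difference of these two primitives of `m` and `q ∗ m`.
    have h4 : ∫ s in (0 : ℝ)..t, forwardAvg k ε 0 * m s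
        ≤ ∫ s in (0 : ℝ)..t, (conv (decrement k ε) m s + e ε s) := by
      refine intervalIntegral.integral_mono_ae_restrict htT.1.le ((hi hm).const_mul _)
        ((hi hqm).add (hi (he ε hε))) ?_
      rw [← restrict_Ioo_eq_restrict_Icc]
      exact ae_restrict_Ioo_of_le hstep htT.2.le
    rw [intervalIntegral.integral_const_mul,
      intervalIntegral.integral_add (hi hqm) (hi (he ε hε))] at h4
    have h5 : ∫ s in (0 : ℝ)..t, e ε s ≤ ∫ t in Ioo 0 T, e ε t := by
      rw [intervalIntegral.integral_of_le htT.1.le, integral_Ioc_eq_integral_Ioo]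
      exact setIntegral_mono_set (he ε hε) (.of_forall (he0 ε))
        (Ioo_subset_Ioo_right htT.2.le).eventuallyLE
    linarith
  -- Both errors in `key` vanish in `L_1` as `ε → 0`.
  have hint : ∫ t in Ioo 0 T, conv k m t ≤ 0 := by
    have hl : Tendsto (fun ε => (∫ t in Ioo 0 T, e ε t) * T
        + (∫ t in Ioo 0 T, (k t - forwardAvg k ε t)) * ∫ t in Ioo 0 T, m t) (𝓝[>] 0)
        (𝓝 (0 * T + 0 * ∫ t in Ioo 0 T, m t)) :=
      (hlim.mul_const _).add ((h.tendsto_integral_sub_forwardAvg hT).mul_const _)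
    rw [zero_mul, zero_mul, zero_add] at hl
    refine ge_of_tendsto hl ?_
    filter_upwards [self_mem_nhdsWithin] with ε hε
    have hkA : IntegrableOn (fun s => k s - forwardAvg k ε s) (Ioo 0 T) :=
      (h.integrableOn_k T).sub (h.integrableOn_forwardAvg hε T)
    have h1 := integral_mono_ae hkm ((integrable_const _).add (integrableOn_conv hkA hm))
      (key ε hε)
    refine h1.trans ?_
    simp only [Pi.add_apply]
    rw [integral_add (integrable_const _) (integrableOn_conv hkA hm)]
    refine add_le_add ?_ (integral_conv_le hkA hm ?_ (.of_forall hm0))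
    · simp [hT.le, mul_comm]
    · filter_upwards [ae_restrict_mem measurableSet_Ioo] with t ht
      exact sub_nonneg.mpr (h.forwardAvg_le hε ht.1)
  have hnn : 0 ≤ᵐ[volume.restrict (Ioo 0 T)] conv k m := by
    filter_upwards [ae_restrict_mem measurableSet_Ioo] with t ht
    exact conv_nonneg ht.1.le ht.2.le (h.ae_nonneg_k T) (.of_forall hm0)
  have hz := (integral_eq_zero_iff_of_nonneg_ae hnn hkm).mp
    (le_antisymm hint (integral_nonneg_of_ae hnn))
  filter_upwards [h.ae_eq_zero_of_conv hT hm hm0 hz] with t ht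
  have := le_max_left (-D t) 0
  rw [show max (-D t) 0 = m t from rfl, ht] at this
  linarith

/-- The defect of the regularized kernel from being conjugate to `l`. -/
noncomputable def avgDefect (k l : ℝ → ℝ) (ε t : ℝ) : ℝ :=
  conv (fun s => k s - forwardAvg k ε s) l t

theorem IsPCPair.integrableOn_sub_forwardAvg (h : IsPCPair k l) (hε : 0 < ε) (T : ℝ) :
    IntegrableOn (fun s => k s - forwardAvg k ε s) (Ioo 0 T) :=
  (h.integrableOn_k T).sub (h.integrableOn_forwardAvg hε T)

theorem IsPCPair.integrableOn_avgDefect (h : IsPCPair k l) (hε : 0 < ε) (T : ℝ) :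
    IntegrableOn (avgDefect k l ε) (Ioo 0 T) :=
  integrableOn_conv (h.integrableOn_sub_forwardAvg hε T) (h.integrableOn_l T)

theorem IsPCPair.tendsto_avgDefect (h : IsPCPair k l) (hT : 0 < T) :
    Tendsto (fun ε => ∫ t in Ioo 0 T, |avgDefect k l ε t|) (𝓝[>] 0) (𝓝 0) := by
  have h1 := (h.tendsto_integral_sub_forwardAvg hT).mul_const (∫ t in Ioo 0 T, ‖l t‖)
  rw [zero_mul] at h1
  refine squeeze_zero' (.of_forall fun ε => integral_nonneg fun _ => abs_nonneg _) ?_ h1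
  filter_upwards [self_mem_nhdsWithin] with ε hε
  refine (integral_norm_conv_le (h.integrableOn_sub_forwardAvg hε T) (h.integrableOn_l T)).trans_eq
    ?_
  congr 1
  refine setIntegral_congr_fun measurableSet_Ioo fun t ht => ?_
  exact abs_of_nonneg (sub_nonneg.mpr (h.forwardAvg_le hε ht.1))

/-- Replacing `k` by its average in `k ∗ l = 1` costs the defect; writing the average as its value
at `0` minus the primitive of the decrement moves the integration onto `l`. The source `1` is
positive, so comparison applies to the primitive of `l`. -/
theorem IsPCPair.integral_l_equation (h : IsPCPair k l) (hε : 0 < ε) (T : ℝ) :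
    ∀ᵐ t ∂(volume.restrict (Ioo 0 T)), forwardAvg k ε 0 * (∫ s in (0 : ℝ)..t, l s)
      = conv (decrement k ε) (fun t => ∫ s in (0 : ℝ)..t, l s) t + 1 - avgDefect k l ε t := by
  have hq := h.integrableOn_decrement hε T
  filter_upwards [h.conv_forwardAvg hε (h.integrableOn_l T), h.ae_conv_eq_one T,
    ae_integrableOn_conv_integrand (h.integrableOn_k T) (h.integrableOn_l T),
    ae_integrableOn_conv_integrand (h.integrableOn_forwardAvg hε T) (h.integrableOn_l T),
    ae_restrict_mem measurableSet_Ioo] with t h1 h2 h3 h4 htT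
  rw [avgDefect, conv_sub_left htT.1.le h3 h4, h1, h2, conv_comm (decrement k ε),
    ← integral_conv (h.integrableOn_l T) hq htT.1.le htT.2.le]
  simp only [conv_comm l]
  ring

theorem IsPCPair.integrableOn_integral_l (h : IsPCPair k l) (T : ℝ) :
    IntegrableOn (fun t => ∫ s in (0 : ℝ)..t, l s) (Ioo 0 T) := by
  rcases le_or_gt T 0 with hT | hT
  · simp [Ioo_eq_empty (not_lt.mpr hT)]
  exact (continuousOn_integral hT.le (h.integrableOn_l T)).integrableOn_Icc.mono_set
    Ioo_subset_Icc_self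

theorem IsPCPair.integral_l_nonneg (h : IsPCPair k l) {t : ℝ} (ht : 0 ≤ t) :
    0 ≤ ∫ s in (0 : ℝ)..t, l s := by
  have hT : 0 < t + 1 := by linarith
  refine nonneg_of_ae_nonneg hT (continuousOn_integral hT.le (h.integrableOn_l _)) ?_
    (t := t) ⟨ht, by linarith⟩
  refine h.ae_nonneg_of_decrement_le hT (h.integrableOn_integral_l _)
    (fun ε t => |avgDefect k l ε t|) (fun ε hε => (h.integrableOn_avgDefect hε _).abs)
    (fun _ _ => abs_nonneg _) (h.tendsto_avgDefect hT) fun ε hε => ?_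
  filter_upwards [h.integral_l_equation hε (t + 1)] with s hs
  rw [hs]
  linarith [le_abs_self (avgDefect k l ε s)]

theorem ae_comp_add_of_ae {p : ℝ → Prop} {δ : ℝ}
    (h : ∀ᵐ s ∂(volume.restrict (Ioo 0 (T + δ))), p s) (hδ : 0 ≤ δ) :
    ∀ᵐ s ∂(volume.restrict (Ioo 0 T)), p (s + δ) := by
  rw [ae_restrict_iff' measurableSet_Ioo] at h ⊢
  have := (measurePreserving_add_right volume δ).quasiMeasurePreserving.ae h
  filter_upwards [this] with s hs hst
  exact hs ⟨by linarith [hst.1], by linarith [hst.2]⟩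

theorem integrableOn_comp_add {v : ℝ → ℝ} {δ : ℝ} (hv : IntegrableOn v (Ioo 0 (T + δ)))
    (hδ : 0 ≤ δ) : IntegrableOn (fun s => v (s + δ)) (Ioo 0 T) := by
  have := (measurePreserving_add_right volume δ).integrableOn_comp_preimage
    (measurableEmbedding_addRight δ) (f := v) (s := Ioo 0 (T + δ))
  refine (this.mpr hv).mono_set fun s hs => ?_
  exact ⟨by linarith [hs.1], by linarith [hs.2]⟩

theorem setIntegral_comp_add_le {v : ℝ → ℝ} {δ : ℝ} (hv : IntegrableOn v (Ioo 0 (T + δ)))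
    (hδ : 0 ≤ δ) (hv0 : ∀ t, 0 ≤ v t) :
    ∫ s in Ioo 0 T, v (s + δ) ≤ ∫ s in Ioo 0 (T + δ), v s := by
  have := (measurePreserving_add_right volume δ).setIntegral_preimage_emb
    (measurableEmbedding_addRight δ) v (Ioo 0 (T + δ))
  rw [← this]
  have h2 := (measurePreserving_add_right volume δ).integrableOn_comp_preimage
    (measurableEmbedding_addRight δ) (f := v) (s := Ioo 0 (T + δ))
  refine setIntegral_mono_set (h2.mpr hv) (.of_forall fun s => hv0 _)
    (LE.le.eventuallyLE fun s hs => ?_)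
  exact ⟨by linarith [hs.1], by linarith [hs.2]⟩

/-- Subtracting the equations at `t + δ` and `t` cancels the source `1`. What remains besides the
convolution of the increment is the history on `(0, δ)`, which is nonnegative because the primitive
of `l` is; the maximum principle then applies to the increment. -/
theorem IsPCPair.integral_l_mono (h : IsPCPair k l) {t δ : ℝ} (ht : 0 ≤ t) (hδ : 0 ≤ δ) :
    ∫ s in (0 : ℝ)..t, l s ≤ ∫ s in (0 : ℝ)..t + δ, l s := by
  set S : ℝ → ℝ := fun t => ∫ s in (0 : ℝ)..t, l s with hS
  have hT : 0 < t + 1 := by linarith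
  set T := t + 1 with hT_def
  have hTδ : 0 < T + δ := by linarith
  have hcS : ContinuousOn S (Icc 0 (T + δ)) := continuousOn_integral hTδ.le (h.integrableOn_l _)
  have hc : ContinuousOn (fun r => S (r + δ) - S r) (Icc 0 T) := by
    refine (hcS.comp (by fun_prop) fun r hr => ?_).sub (hcS.mono (Icc_subset_Icc_right (by linarith)))
    exact ⟨by linarith [hr.1], by linarith [hr.2]⟩
  have hS2 : IntegrableOn (fun r => S (r + δ)) (Ioo 0 T) :=
    integrableOn_comp_add (h.integrableOn_integral_l _) hδ
  have hS1 : IntegrableOn S (Ioo 0 T) := h.integrableOn_integral_l T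
  have hDi : IntegrableOn (fun r => S (r + δ) - S r) (Ioo 0 T) := hS2.sub hS1
  refine sub_nonneg.mp (nonneg_of_ae_nonneg hT hc ?_ (t := t) ⟨ht, by linarith⟩)
  have he2 : ∀ ε, 0 < ε → IntegrableOn (fun r => |avgDefect k l ε (r + δ)|) (Ioo 0 T) :=
    fun ε hε => integrableOn_comp_add (v := fun r => |avgDefect k l ε r|)
      (h.integrableOn_avgDefect hε (T + δ)).abs hδ
  have he1 : ∀ ε, 0 < ε → IntegrableOn (fun r => |avgDefect k l ε r|) (Ioo 0 T) :=
    fun ε hε => (h.integrableOn_avgDefect hε T).abs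
  refine h.ae_nonneg_of_decrement_le hT hDi
    (fun ε r => |avgDefect k l ε (r + δ)| + |avgDefect k l ε r|)
    (fun ε hε => (he2 ε hε).add (he1 ε hε))
    (fun _ _ => add_nonneg (abs_nonneg _) (abs_nonneg _)) ?_ fun ε hε => ?_
  · have h1 := (h.tendsto_avgDefect hTδ).add (h.tendsto_avgDefect hT)
    rw [add_zero] at h1
    refine squeeze_zero' (.of_forall fun ε => integral_nonneg fun _ =>
      add_nonneg (abs_nonneg _) (abs_nonneg _)) ?_ h1
    filter_upwards [self_mem_nhdsWithin] with ε hε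
    rw [integral_add (he2 ε hε) (he1 ε hε)]
    exact add_le_add (setIntegral_comp_add_le (v := fun r => |avgDefect k l ε r|)
      (h.integrableOn_avgDefect hε (T + δ)).abs hδ fun _ => abs_nonneg _) le_rfl
  · have hq := h.integrableOn_decrement hε T
    have hqδ := h.integrableOn_decrement hε (T + δ)
    filter_upwards [h.integral_l_equation hε T,
      ae_comp_add_of_ae (h.integral_l_equation hε (T + δ)) hδ,
      ae_comp_add_of_ae (ae_integrableOn_conv_integrand hqδ (h.integrableOn_integral_l (T + δ))) hδ,
      ae_integrableOn_conv_integrand hq hS1, ae_integrableOn_conv_integrand hq hS2,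
      ae_restrict_mem measurableSet_Ioo] with r h1 h2 h3 h4 h5 hr
    have hr0 : 0 ≤ r + δ := by linarith [hr.1]
    rw [conv_sub_right hr.1.le h5 h4, mul_sub]
    have hint : IntervalIntegrable (fun s => decrement k ε (r + δ - s) • S s) volume 0 (r + δ) := by
      rw [intervalIntegrable_iff, uIoc_of_le hr0, integrableOn_Ioc_iff_integrableOn_Ioo]
      exact h3
    have hsplit : conv (decrement k ε) S (r + δ)
        = (∫ s in (0 : ℝ)..δ, decrement k ε (r + δ - s) • S s)
          + conv (decrement k ε) (fun r => S (r + δ)) r := by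
      have h6 := intervalIntegral.integral_add_adjacent_intervals
        (hint.mono_set (c := 0) (d := δ) ?_) (hint.mono_set (c := δ) (d := r + δ) ?_)
      · have h7 := intervalIntegral.integral_comp_add_right
          (fun s => decrement k ε (r + δ - s) • S s) δ (a := 0) (b := r)
        simp only [zero_add, add_sub_add_right_eq_sub] at h7
        rw [conv, conv, ← h6, ← h7]
      · rw [uIcc_of_le hδ, uIcc_of_le hr0]
        exact Icc_subset_Icc_right (by linarith [hr.1])
      · rw [uIcc_of_le (by linarith [hr.1]), uIcc_of_le hr0]
        exact Icc_subset_Icc_left hδ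
    have hpos : 0 ≤ ∫ s in (0 : ℝ)..δ, decrement k ε (r + δ - s) • S s :=
      intervalIntegral.integral_nonneg hδ fun s hs =>
        mul_nonneg (h.decrement_nonneg hε (by linarith [hs.2, hr.1])) (h.integral_l_nonneg hs.1)
    have h8 : forwardAvg k ε 0 * S (r + δ) = _ := h2
    have h9 : forwardAvg k ε 0 * S r = _ := h1
    rw [h8, h9, show conv (decrement k ε) (fun t => ∫ s in (0 : ℝ)..t, l s) (r + δ) = _ from hsplit]
    have a1 := le_abs_self (avgDefect k l ε (r + δ))
    have a2 := neg_abs_le (avgDefect k l ε r)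
    have : conv (decrement k ε) (fun t => ∫ s in (0 : ℝ)..t, l s) r = conv (decrement k ε) S r := rfl
    linarith

/-- The kernel conjugate to a `PC`-kernel is nonnegative. -/
theorem IsPCPair.ae_nonneg_l (h : IsPCPair k l) (T : ℝ) :
    ∀ᵐ t ∂(volume.restrict (Ioo 0 T)), 0 ≤ l t := by
  refine ae_nonneg_of_intervalIntegral_nonneg (h.integrableOn_l T) fun a b ha hab hbT => ?_
  have h1 := h.integral_l_mono ha (sub_nonneg.mpr hab)
  have h2 := intervalIntegral.integral_add_adjacent_intervals
    (intervalIntegrable_of_integrableOn (h.integrableOn_l T) le_rfl ha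
      (ha.trans (hab.trans hbT)) (hab.trans hbT))
    (intervalIntegrable_of_integrableOn (h.integrableOn_l T) ha (ha.trans hab) (hab.trans hbT) hbT)
  rw [add_sub_cancel] at h1
  linarith

end PositivityOfConjugate

/-! ### Resolvent kernels: existence, positivity, mass, and the limit of large parameter. -/

section Resolvent

variable {k l h : ℝ → ℝ} {γ T : ℝ}

theorem tsum_lintegral_ne_top_of_summable {α : Type*} [MeasurableSpace α] {μ : Measure α}
    {f : ℕ → α → ℝ} (hf : ∀ i, Integrable (f i) μ) (hs : Summable fun i => ∫ a, ‖f i a‖ ∂μ) :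
    ∑' i, ∫⁻ a, ‖f i a‖ₑ ∂μ ≠ ⊤ := by
  have h1 : ∀ i, ∫⁻ a, ‖f i a‖ₑ ∂μ = ENNReal.ofReal (∫ a, ‖f i a‖ ∂μ) := fun i =>
    (ofReal_integral_norm_eq_lintegral_enorm (hf i)).symm
  simp only [h1]
  exact hs.tsum_ofReal_ne_top

theorem ae_summable_of_summable_integral {α : Type*} [MeasurableSpace α] {μ : Measure α}
    {f : ℕ → α → ℝ} (hf : ∀ i, Integrable (f i) μ) (hs : Summable fun i => ∫ a, ‖f i a‖ ∂μ) :
    ∀ᵐ a ∂μ, Summable fun i => ‖f i a‖ :=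
  summable_norm_of_tsum_eLpNorm_ne_top le_rfl (fun i => (hf i).aestronglyMeasurable) (by
    simpa only [eLpNorm_one_eq_lintegral_enorm] using tsum_lintegral_ne_top_of_summable hf hs)

theorem integrable_tsum_of_summable_integral {α : Type*} [MeasurableSpace α] {μ : Measure α}
    {f : ℕ → α → ℝ} (hf : ∀ i, Integrable (f i) μ) (hs : Summable fun i => ∫ a, ‖f i a‖ ∂μ) :
    Integrable (fun a => ∑' i, f i a) μ := by
  have hsum := ae_summable_of_summable_integral hf hs
  refine ⟨?_, ?_⟩
  · refine aestronglyMeasurable_of_tendsto_ae atTop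
      (f := fun (n : ℕ) a => ∑ i ∈ Finset.range n, f i a) (fun n => ?_) ?_
    · exact Finset.aestronglyMeasurable_fun_sum _ fun i _ => (hf i).aestronglyMeasurable
    · filter_upwards [hsum] with a ha
      exact ha.of_norm.hasSum.tendsto_sum_nat
  · refine lt_of_le_of_lt (lintegral_mono_ae (g := fun a => ∑' i, ‖f i a‖ₑ) ?_) ?_
    · filter_upwards [hsum] with a ha
      exact enorm_tsum_le_tsum_enorm
    · rw [lintegral_tsum fun i => (hf i).aestronglyMeasurable.enorm]
      exact (tsum_lintegral_ne_top_of_summable hf hs).lt_top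

theorem locallyIntegrableOn_Ici_of_forall (hh : ∀ T, IntegrableOn h (Ioo 0 T)) :
    LocallyIntegrableOn h (Ici 0) := by
  intro x hx
  refine ⟨Icc 0 (x + 1), ?_, ?_⟩
  · have : Iic (x + 1) ∈ 𝓝 x := Iic_mem_nhds (by linarith)
    exact mem_nhdsWithin.mpr ⟨Iio (x + 1), isOpen_Iio, by simp,
      fun y hy => ⟨hy.2, hy.1.le⟩⟩
  · rw [integrableOn_Icc_iff_integrableOn_Ioo]
    exact hh _

theorem ae_restrict_Ioi_of_forall_Ioo {p : ℝ → Prop}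
    (hp : ∀ T, ∀ᵐ t ∂(volume.restrict (Ioo 0 T)), p t) :
    ∀ᵐ t ∂(volume.restrict (Ioi (0 : ℝ))), p t := by
  have : Ioi (0 : ℝ) = ⋃ n : ℕ, Ioo (0 : ℝ) n := by
    ext x
    simp only [mem_Ioi, mem_iUnion, mem_Ioo, exists_and_left]
    exact ⟨fun hx => ⟨hx, exists_nat_gt x⟩, fun hx => hx.1⟩
  rw [this, ae_restrict_iUnion_iff]
  exact fun n => hp n

/-- Terms of the Neumann series for the resolvent kernel. -/
noncomputable def neumannTerm (p : ℝ → ℝ) : ℕ → ℝ → ℝ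
  | 0 => p
  | j + 1 => conv p (neumannTerm p j)

theorem integrableOn_neumannTerm {p : ℝ → ℝ} (hp : IntegrableOn p (Ioo 0 T)) (j : ℕ) :
    IntegrableOn (neumannTerm p j) (Ioo 0 T) := by
  induction j with
  | zero => exact hp
  | succ j ih => exact integrableOn_conv hp ih

theorem exp_mul_conv (c : ℝ) (k v : ℝ → ℝ) (t : ℝ) :
    Real.exp (c * t) * conv k v t
      = conv (fun s => Real.exp (c * s) * k s) (fun s => Real.exp (c * s) * v s) t := by
  rw [conv, conv, ← intervalIntegral.integral_const_mul]
  refine intervalIntegral.integral_congr fun s _ => ?_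
  have : Real.exp (c * t) = Real.exp (c * (t - s)) * Real.exp (c * s) := by
    rw [← Real.exp_add]; ring_nf
  simp only [smul_eq_mul]
  rw [this]
  ring

theorem integrableOn_exp_mul {v : ℝ → ℝ} (c : ℝ) (hv : IntegrableOn v (Ioo 0 T)) :
    IntegrableOn (fun s => Real.exp (c * s) * v s) (Ioo 0 T) := by
  refine Integrable.bdd_mul (c := Real.exp (|c| * T)) hv (by fun_prop) ?_
  filter_upwards [ae_restrict_mem measurableSet_Ioo] with s hs
  rw [Real.norm_eq_abs, Real.abs_exp]
  refine Real.exp_le_exp.mpr ((mul_le_mul_of_nonneg_right (le_abs_self c) hs.1.le).trans ?_)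
  exact mul_le_mul_of_nonneg_left hs.2.le (abs_nonneg c)

/-- Exponential weights are multiplicative under convolution (`exp_mul_conv`), so this makes
convolution with `p` a contraction of a weighted `L_1`, whatever the size of `p`. As `c → -∞` the
weighted mass tends to `0` by dominated convergence. -/
theorem exists_exp_weight {p : ℝ → ℝ} (hp : IntegrableOn p (Ioo 0 T)) :
    ∃ c : ℝ, c ≤ 0 ∧ ∫ t in Ioo 0 T, ‖Real.exp (c * t) * p t‖ ≤ 1 / 2 := by
  have h1 : Tendsto (fun c : ℝ => ∫ t in Ioo 0 T, ‖Real.exp (c * t) * p t‖) atBot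
      (𝓝 (∫ t in Ioo 0 T, (0 : ℝ))) := by
    refine tendsto_integral_filter_of_dominated_convergence (fun t => ‖p t‖) ?_ ?_ hp.norm ?_
    · exact .of_forall fun c => (integrableOn_exp_mul c hp).norm.aestronglyMeasurable
    · filter_upwards [eventually_le_atBot 0] with c hc
      filter_upwards [ae_restrict_mem measurableSet_Ioo] with s hs
      rw [norm_norm, norm_mul, Real.norm_eq_abs, Real.abs_exp]
      refine mul_le_of_le_one_left (norm_nonneg _) (Real.exp_le_one_iff.mpr ?_)
      exact mul_nonpos_of_nonpos_of_nonneg hc hs.1.le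
    · filter_upwards [ae_restrict_mem measurableSet_Ioo] with s hs
      have : Tendsto (fun c : ℝ => Real.exp (c * s) * p s) atBot (𝓝 (0 * p s)) :=
        (Real.tendsto_exp_atBot.comp (tendsto_id.atBot_mul_const hs.1)).mul_const _
      simpa using this.norm
  rw [integral_zero] at h1
  obtain ⟨c, hc0, hc⟩ := ((eventually_le_atBot 0).and
    (h1.eventually_le_const (by norm_num : (0 : ℝ) < 1 / 2))).exists
  exact ⟨c, hc0, hc⟩

/-- Each convolution with `p` at least halves the weighted bound; removing the weight on `(0, T)`
costs the fixed factor `exp (-c T)`. -/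
theorem summable_integral_neumannTerm {p : ℝ → ℝ} (hp : IntegrableOn p (Ioo 0 T)) :
    Summable fun j => ∫ t in Ioo 0 T, ‖neumannTerm p j t‖ := by
  obtain ⟨c, hc0, hc⟩ := exists_exp_weight hp
  have h1 : ∀ j, ∫ t in Ioo 0 T, ‖Real.exp (c * t) * neumannTerm p j t‖ ≤ (1 / 2) ^ (j + 1) := by
    intro j
    induction j with
    | zero => simpa [neumannTerm] using hc
    | succ j ih =>
      simp only [neumannTerm, exp_mul_conv]
      refine (integral_norm_conv_le (integrableOn_exp_mul c hp)
        (integrableOn_exp_mul c (integrableOn_neumannTerm hp j))).trans ?_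
      rw [pow_succ' _ (j + 1)]
      exact mul_le_mul hc ih (integral_nonneg fun _ => norm_nonneg _) (by norm_num)
  have h2 : ∀ j, ∫ t in Ioo 0 T, ‖neumannTerm p j t‖ ≤ Real.exp (-c * T) * (1 / 2) ^ (j + 1) := by
    intro j
    refine le_trans ?_ (mul_le_mul_of_nonneg_left (h1 j) (Real.exp_pos _).le)
    rw [← integral_const_mul]
    refine setIntegral_mono_on (integrableOn_neumannTerm hp j).norm
      ((integrableOn_exp_mul c (integrableOn_neumannTerm hp j)).norm.const_mul _)
      measurableSet_Ioo fun t ht => ?_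
    rw [norm_mul, Real.norm_eq_abs (Real.exp _), Real.abs_exp, ← mul_assoc, ← Real.exp_add]
    refine le_mul_of_one_le_left (norm_nonneg _) (Real.one_le_exp ?_)
    nlinarith [ht.2]
  refine Summable.of_nonneg_of_le (fun j => integral_nonneg fun _ => norm_nonneg _) h2 ?_
  refine Summable.mul_left _ ?_
  exact (summable_nat_add_iff 1).mpr (summable_geometric_of_lt_one (by norm_num) (by norm_num))

/-- The linear Volterra equation with an integrable kernel is solvable. -/
theorem exists_volterra_solution {p : ℝ → ℝ} (hp : ∀ T, IntegrableOn p (Ioo 0 T)) :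
    ∃ r : ℝ → ℝ, (∀ T, IntegrableOn r (Ioo 0 T)) ∧
      ∀ T, ∀ᵐ t ∂(volume.restrict (Ioo 0 T)), r t = p t + conv p r t := by
  -- The weight used for summability depends on `T`, but the series does not, so one function solves
  -- the equation on every `(0, T)`.
  refine ⟨fun t => ∑' j, neumannTerm p j t, fun T => integrable_tsum_of_summable_integral
    (integrableOn_neumannTerm (hp T)) (summable_integral_neumannTerm (hp T)), fun T => ?_⟩
  have hs := summable_integral_neumannTerm (hp T)
  have hq := integrableOn_neumannTerm (hp T)
  have habs : Summable fun j => ∫ t in Ioo 0 T,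
      ‖conv (fun s => |p s|) (fun s => ‖neumannTerm p j s‖) t‖ := by
    refine Summable.of_nonneg_of_le (fun j => integral_nonneg fun _ => norm_nonneg _) (fun j => ?_)
      (hs.mul_left (∫ t in Ioo 0 T, ‖p t‖))
    refine (integral_norm_conv_le (hp T).abs (hq j).norm).trans_eq ?_
    simp
  filter_upwards [ae_summable_of_summable_integral hq hs,
    ae_summable_of_summable_integral (fun j => integrableOn_conv (hp T).abs (hq j).norm) habs,
    ae_all_iff.mpr fun j => ae_integrableOn_conv_integrand (hp T) (hq j),
    ae_restrict_mem measurableSet_Ioo] with t h1 h2 h3 htT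
  have h4 : conv p (fun t => ∑' j, neumannTerm p j t) t = ∑' j, neumannTerm p (j + 1) t := by
    rw [conv_eq_integral_Ioo _ _ htT.1.le]
    simp only [smul_eq_mul, ← tsum_mul_left]
    have h5 := integral_tsum_of_summable_integral_norm h3 ?_
    · simp only [smul_eq_mul] at h5
      rw [← h5]
      simp only [neumannTerm, conv_eq_integral_Ioo _ _ htT.1.le, smul_eq_mul]
    · refine (h2.congr fun j => ?_)
      rw [Real.norm_of_nonneg (conv_nonneg htT.1.le htT.2.le (.of_forall fun _ => abs_nonneg _)
        (.of_forall fun _ => norm_nonneg _)), conv_eq_integral_Ioo _ _ htT.1.le]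
      simp
  rw [h4, h1.of_norm.tsum_eq_zero_add]
  rfl

/-- The Volterra solution for `p = -γ l`, with its sign reversed. Existence matters because the weak
inequality speaks of every resolvent kernel and would say nothing if there were none. -/
theorem exists_isResolventKernel (hl : LocallyIntegrableOn l (Ici 0)) (γ : ℝ) :
    ∃ h, IsResolventKernel γ l h := by
  have hp : ∀ T, IntegrableOn (fun t => -γ * l t) (Ioo 0 T) := fun T =>
    (integrableOn_Ioo_of_locallyIntegrableOn hl T).const_mul _
  obtain ⟨r, hr, hre⟩ := exists_volterra_solution hp
  refine ⟨fun t => - r t, (locallyIntegrableOn_Ici_of_forall hr).neg,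
    ae_restrict_Ioi_of_forall_Ioo fun T => ?_⟩
  filter_upwards [hre T] with t ht
  have h1 : conv (fun t => -γ * l t) r t = -γ * conv l r t := conv_mul_left _ _ _ _
  have h2 : conv (fun t => - r t) l t = - conv l r t := by
    rw [conv_comm]
    simp [conv]
  rw [h1] at ht
  rw [h2, ht]
  ring

theorem IsResolventKernel.integrableOn (hh : IsResolventKernel γ l h) (T : ℝ) :
    IntegrableOn h (Ioo 0 T) :=
  integrableOn_Ioo_of_locallyIntegrableOn hh.locInt T

theorem IsResolventKernel.ae_eq (hh : IsResolventKernel γ l h) (T : ℝ) :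
    ∀ᵐ t ∂(volume.restrict (Ioo 0 T)), h t + γ * conv h l t = γ * l t :=
  ae_mono (Measure.restrict_mono (fun _ hx => hx.1) le_rfl) hh.resolvent_eq

/-- `k ∗ h = γ (1 - 1 ∗ h)` for the resolvent kernel `h` of `γ l`. -/
theorem IsResolventKernel.conv_k (hh : IsResolventKernel γ l h) (hkl : IsPCPair k l) (T : ℝ) :
    ∀ᵐ t ∂(volume.restrict (Ioo 0 T)), conv k h t = γ * (1 - ∫ s in (0 : ℝ)..t, h s) := by
  have hk := hkl.integrableOn_k T
  have hl := hkl.integrableOn_l T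
  have hi := hh.integrableOn T
  have hlh := integrableOn_conv hl hi
  filter_upwards [conv_assoc_ae hk hl hi, hkl.ae_conv_eq_one T,
    ae_integrableOn_conv_integrand hk hi, ae_integrableOn_conv_integrand hk (hlh.const_mul γ),
    ae_restrict_mem measurableSet_Ioo] with t h1 h2 h3 h4 htT
  -- The resolvent equation convolved with `k`; `k ∗ l = 1` then collapses `k ∗ (l ∗ h)` to the
  -- primitive of `h`.
  have h5 : conv k (fun t => h t + γ * conv l h t) t = conv k (fun t => γ * l t) t := by
    refine conv_congr (T := T) htT.1.le htT.2.le (ae_eq_refl k) ?_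
    filter_upwards [hh.ae_eq T] with s hs
    rw [conv_comm l, hs]
  have h6 : conv (conv k l) h t = ∫ s in (0 : ℝ)..t, h s := by
    rw [← conv_one]
    exact conv_congr htT.1.le htT.2.le (hkl.ae_conv_eq_one T) (ae_eq_refl h)
  rw [conv_add_right htT.1.le h3 h4] at h5
  have h7 : conv k (fun t => γ * conv l h t) t = γ * conv k (conv l h) t :=
    conv_smul_right k γ (conv l h) t
  have h8 : conv k (fun t => γ * l t) t = γ * conv k l t := conv_smul_right k γ l t
  rw [h7, h8, h1, h6, h2] at h5
  linarith

/-- From `k ∗ h = γ (1 - 1 ∗ h)`, the product `(k + γ) ∗ (h/γ)` is `(1 - 1 ∗ h) + 1 ∗ h = 1`.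
Positivity of conjugate kernels thus yields positivity of `h`. -/
theorem IsResolventKernel.isPCPair (hh : IsResolventKernel γ l h) (hkl : IsPCPair k l)
    (hγ : 0 < γ) : IsPCPair (fun t => k t + γ) (fun t => γ⁻¹ * h t) where
  locInt_k := hkl.locInt_k.add (locallyIntegrableOn_const γ)
  nonneg_k t ht := add_nonneg (hkl.nonneg_k t ht) hγ.le
  antitone_k a ha b hb hab := add_le_add (hkl.antitone_k ha hb hab) le_rfl
  locInt_l := locallyIntegrableOn_Ici_of_forall fun T => (hh.integrableOn T).const_mul _
  conv_eq_one := by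
    refine ae_restrict_Ioi_of_forall_Ioo fun T => ?_
    have h1 : IntegrableOn (fun _ : ℝ => γ) (Ioo 0 T) := by simp
    filter_upwards [hh.conv_k hkl T, ae_integrableOn_conv_integrand (hkl.integrableOn_k T)
      ((hh.integrableOn T).const_mul γ⁻¹), ae_integrableOn_conv_integrand h1
      ((hh.integrableOn T).const_mul γ⁻¹), ae_restrict_mem measurableSet_Ioo] with t ht h2 h3 htT
    rw [conv_add_left htT.1.le h2 h3, show conv k (fun t => γ⁻¹ * h t) t = γ⁻¹ * conv k h t from
      conv_smul_right k γ⁻¹ h t, ht]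
    simp only [conv, smul_eq_mul, intervalIntegral.integral_const_mul]
    field_simp
    ring

theorem IsResolventKernel.ae_nonneg (hh : IsResolventKernel γ l h) (hkl : IsPCPair k l)
    (hγ : 0 < γ) (T : ℝ) : ∀ᵐ t ∂(volume.restrict (Ioo 0 T)), 0 ≤ h t := by
  filter_upwards [(hh.isPCPair hkl hγ).ae_nonneg_l T] with t ht
  exact nonneg_of_mul_nonneg_right ht (by positivity)

theorem IsResolventKernel.integral_nonneg (hh : IsResolventKernel γ l h) (hkl : IsPCPair k l)
    (hγ : 0 < γ) {t : ℝ} (ht : 0 ≤ t) : 0 ≤ ∫ s in (0 : ℝ)..t, h s := by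
  rw [intervalIntegral.integral_of_le ht, integral_Ioc_eq_integral_Ioo]
  exact integral_nonneg_of_ae (hh.ae_nonneg hkl hγ t)

theorem IsResolventKernel.integral_mono (hh : IsResolventKernel γ l h) (hkl : IsPCPair k l)
    (hγ : 0 < γ) {t t' : ℝ} (ht : 0 ≤ t) (htt : t ≤ t') :
    ∫ s in (0 : ℝ)..t, h s ≤ ∫ s in (0 : ℝ)..t', h s := by
  rw [intervalIntegral.integral_of_le ht, integral_Ioc_eq_integral_Ioo,
    intervalIntegral.integral_of_le (ht.trans htt), integral_Ioc_eq_integral_Ioo]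
  exact setIntegral_mono_set (hh.integrableOn t') (hh.ae_nonneg hkl hγ t')
    (Ioo_subset_Ioo_right htt).eventuallyLE

theorem IsResolventKernel.integral_le_one (hh : IsResolventKernel γ l h) (hkl : IsPCPair k l)
    (hγ : 0 < γ) {t : ℝ} (ht : 0 ≤ t) : ∫ s in (0 : ℝ)..t, h s ≤ 1 := by
  have hT : 0 < t + 1 := by linarith
  refine sub_nonneg.mp (nonneg_of_ae_nonneg (f := fun t => 1 - ∫ s in (0 : ℝ)..t, h s) hT
    (continuousOn_const.sub (continuousOn_integral hT.le (hh.integrableOn _))) ?_ (t := t)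
    ⟨ht, by linarith⟩)
  filter_upwards [hh.conv_k hkl (t + 1), ae_restrict_mem measurableSet_Ioo] with s hs hsT
  have := conv_nonneg hsT.1.le hsT.2.le (hkl.ae_nonneg_k _) (hh.ae_nonneg hkl hγ (t + 1))
  rw [hs] at this
  exact nonneg_of_mul_nonneg_right this hγ

theorem IsResolventKernel.setIntegral_le_one (hh : IsResolventKernel γ l h) (hkl : IsPCPair k l)
    (hγ : 0 < γ) (hT : 0 ≤ T) : ∫ s in Ioo 0 T, h s ≤ 1 := by
  rw [← integral_Ioc_eq_integral_Ioo, ← intervalIntegral.integral_of_le hT]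
  exact hh.integral_le_one hkl hγ hT

/-- The mass of the resolvent kernel on `(0, t)` tends to one as `γ → ∞`. -/
theorem IsResolventKernel.mul_one_sub_integral_le (hh : IsResolventKernel γ l h)
    (hkl : IsPCPair k l) (hγ : 0 < γ) {t : ℝ} (ht : 0 ≤ t) :
    t * (1 - ∫ s in (0 : ℝ)..t, h s) ≤ γ⁻¹ * ∫ s in Ioo 0 t, k s := by
  have hH : IntegrableOn (fun r => 1 - ∫ s in (0 : ℝ)..r, h s) (Ioo 0 t) :=
    (continuousOn_const.sub (continuousOn_integral ht (hh.integrableOn _))).integrableOn_Icc.mono_set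
      Ioo_subset_Icc_self
  -- The function `1 - 1 ∗ h` is nonincreasing, so `t` times its value at `t` is at most its
  -- integral over `(0, t)`, and that integral is the one of `γ⁻¹ (k ∗ h)`.
  have h1 : ∫ r in Ioo 0 t, (1 - ∫ s in (0 : ℝ)..t, h s)
      ≤ ∫ r in Ioo 0 t, (1 - ∫ s in (0 : ℝ)..r, h s) :=
    setIntegral_mono_on (by simp) hH measurableSet_Ioo fun r hr =>
      sub_le_sub_left (hh.integral_mono hkl hγ hr.1.le hr.2.le) 1
  have h2 : ∫ r in Ioo 0 t, conv k h r ≤ ∫ s in Ioo 0 t, k s := by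
    refine (integral_conv_le (hkl.integrableOn_k t) (hh.integrableOn t) (hkl.ae_nonneg_k t)
      (hh.ae_nonneg hkl hγ t)).trans ?_
    exact mul_le_of_le_one_right (integral_nonneg_of_ae (hkl.ae_nonneg_k t))
      (hh.setIntegral_le_one hkl hγ ht)
  rw [integral_congr_ae (hh.conv_k hkl t), integral_const_mul] at h2
  simp only [integral_const, MeasurableSet.univ, measureReal_restrict_apply, univ_inter,
    Real.volume_real_Ioo_of_le ht, smul_eq_mul, sub_zero] at h1
  rw [le_inv_mul_iff₀ hγ]
  exact (mul_le_mul_of_nonneg_left h1 hγ.le).trans h2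

/-- Monotonicity gives `k (t - s) ≥ k t` inside `k ∗ h = γ (1 - 1 ∗ h)`. This is how the weight `k`
enters the energy estimate. -/
theorem IsResolventKernel.mul_integral_le (hh : IsResolventKernel γ l h) (hkl : IsPCPair k l)
    (hγ : 0 < γ) (T : ℝ) : ∀ᵐ t ∂(volume.restrict (Ioo 0 T)),
      k t * (∫ s in (0 : ℝ)..t, h s) ≤ γ * (1 - ∫ s in (0 : ℝ)..t, h s) := by
  filter_upwards [hh.conv_k hkl T, ae_integrableOn_conv_integrand (hkl.integrableOn_k T)
    (hh.integrableOn T), ae_restrict_mem measurableSet_Ioo] with t h1 h2 htT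
  rw [← h1, conv_eq_integral_Ioo _ _ htT.1.le, intervalIntegral.integral_of_le htT.1.le,
    integral_Ioc_eq_integral_Ioo, ← integral_const_mul]
  refine integral_mono_ae ((hh.integrableOn t).const_mul _) h2 ?_
  filter_upwards [hh.ae_nonneg hkl hγ t, ae_restrict_mem measurableSet_Ioo] with s hs hst
  exact mul_le_mul_of_nonneg_right (hkl.antitone_k (mem_Ioi.mpr (by linarith [hst.2]))
    (mem_Ioi.mpr htT.1) (by linarith [hst.1])) hs

/-- If `h n` are resolvent kernels of `n l`, their primitives converge to one pointwise. -/
theorem tendsto_integral_resolvent (hkl : IsPCPair k l) {h : ℕ → ℝ → ℝ}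
    (hh : ∀ n : ℕ, 0 < n → IsResolventKernel n l (h n)) {t : ℝ} (ht : 0 < t) :
    Tendsto (fun n => ∫ s in (0 : ℝ)..t, h n s) atTop (𝓝 1) := by
  have h1 : Tendsto (fun n : ℕ => 1 - t⁻¹ * ((n : ℝ)⁻¹ * ∫ s in Ioo 0 t, k s)) atTop
      (𝓝 (1 - t⁻¹ * (0 * ∫ s in Ioo 0 t, k s))) :=
    ((tendsto_inv_atTop_nhds_zero_nat.mul_const _).const_mul _).const_sub _
  rw [zero_mul, mul_zero, sub_zero] at h1
  refine tendsto_of_tendsto_of_tendsto_of_le_of_le' h1 tendsto_const_nhds ?_ ?_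
  · filter_upwards [eventually_gt_atTop 0] with n hn
    have h2 := (hh n hn).mul_one_sub_integral_le hkl (by exact_mod_cast hn) ht.le
    have h3 : 1 - ∫ s in (0 : ℝ)..t, h n s ≤ t⁻¹ * ((n : ℝ)⁻¹ * ∫ s in Ioo 0 t, k s) := by
      rwa [le_inv_mul_iff₀ ht]
    linarith
  · filter_upwards [eventually_gt_atTop 0] with n hn
    exact (hh n hn).integral_le_one hkl (by exact_mod_cast hn) ht.le

/-- If `h_n ∗ P ≤ 0` for all `n`, then `P ≤ 0`. -/
theorem ae_nonpos_of_conv_resolvent_nonpos (hkl : IsPCPair k l) {P : ℝ → ℝ}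
    (hP : IntegrableOn P (Ioo 0 T)) {h : ℕ → ℝ → ℝ}
    (hh : ∀ n : ℕ, 0 < n → IsResolventKernel n l (h n))
    (hle : ∀ n : ℕ, 0 < n → ∀ᵐ t ∂(volume.restrict (Ioo 0 T)), conv (h n) P t ≤ 0) :
    ∀ᵐ t ∂(volume.restrict (Ioo 0 T)), P t ≤ 0 := by
  -- The primitive of `h_n ∗ P` is `(1 ∗ h_n) ∗ P`, and `1 ∗ h_n` is bounded by `1` and tends to `1`
  -- pointwise. Dominated convergence on primitives suffices, without strong convergence of `h_n ∗
  -- P`.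
  have hlim : ∀ t, 0 ≤ t → t ≤ T → Tendsto (fun n => ∫ s in (0 : ℝ)..t, conv (h n) P s) atTop
      (𝓝 (∫ s in (0 : ℝ)..t, P s)) := by
    intro t ht htT
    have hPt : IntegrableOn P (Ioo 0 t) := hP.mono_set (Ioo_subset_Ioo_right htT)
    have h1 : Tendsto (fun n => conv (fun τ => ∫ s in (0 : ℝ)..τ, h n s) P t) atTop
        (𝓝 (∫ s in (0 : ℝ)..t, P s)) := by
      simp only [conv_eq_integral_Ioo _ _ ht, smul_eq_mul]
      rw [intervalIntegral.integral_of_le ht, integral_Ioc_eq_integral_Ioo]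
      refine tendsto_integral_filter_of_dominated_convergence (fun s => ‖P s‖) ?_ ?_ hPt.norm ?_
      · filter_upwards [eventually_gt_atTop 0] with n hn
        refine AEStronglyMeasurable.mul ?_ hPt.aestronglyMeasurable
        refine ContinuousOn.aestronglyMeasurable ?_ measurableSet_Ioo
        refine (continuousOn_integral ht ((hh n hn).integrableOn t)).comp (by fun_prop) ?_
        exact fun s hs => ⟨by linarith [hs.2], by linarith [hs.1]⟩
      · filter_upwards [eventually_gt_atTop 0] with n hn
        filter_upwards [ae_restrict_mem measurableSet_Ioo] with s hs
        have hn' : (0 : ℝ) < n := by exact_mod_cast hn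
        have hts : 0 ≤ t - s := by linarith [hs.2]
        rw [norm_mul, Real.norm_of_nonneg ((hh n hn).integral_nonneg hkl hn' hts)]
        exact mul_le_of_le_one_left (norm_nonneg _) ((hh n hn).integral_le_one hkl hn' hts)
      · filter_upwards [ae_restrict_mem measurableSet_Ioo] with s hs
        have h2 : Tendsto (fun n => ∫ r in (0 : ℝ)..t - s, h n r) atTop (𝓝 1) :=
          tendsto_integral_resolvent hkl hh (by linarith [hs.2])
        simpa using h2.mul_const (P s)
    refine h1.congr' ?_
    filter_upwards [eventually_gt_atTop 0] with n hn
    exact (integral_conv ((hh n hn).integrableOn T) hP ht htT).symm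
  have hneg : ∀ᵐ t ∂(volume.restrict (Ioo 0 T)), 0 ≤ - P t := by
    refine ae_nonneg_of_intervalIntegral_nonneg hP.neg fun a b ha hab hbT => ?_
    have hT := ha.trans (hab.trans hbT)
    have h1 : Tendsto (fun n => (∫ s in (0 : ℝ)..b, conv (h n) P s)
        - ∫ s in (0 : ℝ)..a, conv (h n) P s) atTop
        (𝓝 ((∫ s in (0 : ℝ)..b, P s) - ∫ s in (0 : ℝ)..a, P s)) :=
      (hlim b (ha.trans hab) hbT).sub (hlim a ha (hab.trans hbT))
    have hsub : ∀ {f : ℝ → ℝ}, IntegrableOn f (Ioo 0 T) →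
        (∫ s in (0 : ℝ)..b, f s) - ∫ s in (0 : ℝ)..a, f s = ∫ s in a..b, f s := fun hf =>
      intervalIntegral.integral_interval_sub_left
        (intervalIntegrable_of_integrableOn hf le_rfl (ha.trans hab) hT hbT)
        (intervalIntegrable_of_integrableOn hf le_rfl ha hT (hab.trans hbT))
    rw [hsub hP] at h1
    rw [intervalIntegral.integral_neg]
    refine neg_nonneg.mpr (le_of_tendsto h1 ?_)
    filter_upwards [eventually_gt_atTop 0] with n hn
    have hci := integrableOn_conv ((hh n hn).integrableOn T) hP
    rw [hsub hci]
    have h2 : ∫ s in a..b, conv (h n) P s ≤ ∫ s in a..b, (0 : ℝ) := by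
      refine intervalIntegral.integral_mono_ae_restrict hab
        (intervalIntegrable_of_integrableOn hci ha (ha.trans hab) (hab.trans hbT) hbT) (by simp) ?_
      rw [← restrict_Ioo_eq_restrict_Icc]
      exact ae_mono (Measure.restrict_mono (Ioo_subset_Ioo ha hbT) le_rfl) (hle n hn)
    simpa using h2
  filter_upwards [hneg] with t ht
  linarith

end Resolvent

/-! ### Young's convolution inequality in time. -/

section Young

variable {T q : ℝ}

/-- Hölder's inequality against the constant `1`. It is used for the measure with density `k (t -
s)`, so that the power falls on `f` alone and Tonelli's theorem finishes the convolution bound. -/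
theorem rpow_lintegral_le {α : Type*} [MeasurableSpace α] (κ : Measure α) (hq : 1 ≤ q)
    {f : α → ℝ≥0∞} (hf : AEMeasurable f κ) :
    (∫⁻ a, f a ∂κ) ^ q ≤ κ univ ^ (q - 1) * ∫⁻ a, f a ^ q ∂κ := by
  rcases hq.eq_or_lt with rfl | hq1
  · simp
  have hc := Real.HolderConjugate.conjExponent hq1
  have h1 := ENNReal.lintegral_mul_le_Lp_mul_Lq κ hc hf (aemeasurable_const (b := (1 : ℝ≥0∞)))
  simp only [Pi.mul_apply, mul_one, ENNReal.one_rpow, lintegral_const, one_mul] at h1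
  have hq0 : 0 < q := by linarith
  refine (ENNReal.rpow_le_rpow h1 hq0.le).trans_eq ?_
  rw [ENNReal.mul_rpow_of_nonneg _ _ hq0.le, ← ENNReal.rpow_mul, ← ENNReal.rpow_mul,
    one_div_mul_cancel hq0.ne', ENNReal.rpow_one, mul_comm]
  congr 2
  have := hc.sub_one_mul_conj
  have h0 := hc.symm.pos
  field_simp
  linarith

/-- Young's convolution inequality for nonnegative functions, with one factor in `L_1`. -/
theorem lintegral_rpow_convolution_le {k f : ℝ → ℝ≥0∞} (hq : 1 ≤ q) (hk : AEMeasurable k)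
    (hf : AEMeasurable f) :
    ∫⁻ t, (∫⁻ s, k (t - s) * f s) ^ q ≤ (∫⁻ s, k s) ^ q * ∫⁻ s, f s ^ q := by
  have hkt : ∀ t, AEMeasurable (fun s => k (t - s)) := fun t =>
    hk.comp_quasiMeasurePreserving (quasiMeasurePreserving_sub_left_of_right_invariant volume t)
  have h1 : ∀ t, (∫⁻ s, k (t - s) * f s) ^ q
      ≤ (∫⁻ s, k s) ^ (q - 1) * ∫⁻ s, k (t - s) * f s ^ q := by
    intro t
    have h2 := rpow_lintegral_le (volume.withDensity fun s => k (t - s)) hq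
      (hf.mono_ac (withDensity_absolutelyContinuous _ _))
    rw [lintegral_withDensity_eq_lintegral_mul₀ (hkt t) hf,
      lintegral_withDensity_eq_lintegral_mul₀ (hkt t) (hf.pow_const q),
      withDensity_apply _ MeasurableSet.univ, Measure.restrict_univ,
      lintegral_sub_left_eq_self] at h2
    exact h2
  refine (lintegral_mono h1).trans ?_
  have hm : AEMeasurable (fun p : ℝ × ℝ => k (p.1 - p.2) * f p.2 ^ q)
      (volume.prod volume) :=
    (hk.comp_quasiMeasurePreserving
      (quasiMeasurePreserving_sub_of_right_invariant volume volume)).mul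
      ((hf.pow_const q).comp_quasiMeasurePreserving Measure.quasiMeasurePreserving_snd)
  rw [lintegral_const_mul'' _ hm.lintegral_prod_right', lintegral_lintegral_swap hm]
  have h3 : ∀ s, ∫⁻ t, k (t - s) * f s ^ q = (∫⁻ t, k t) * f s ^ q := by
    intro s
    have hks : AEMeasurable fun t => k (t - s) := hk.comp_quasiMeasurePreserving
      (measurePreserving_sub_right volume s).quasiMeasurePreserving
    rw [lintegral_mul_const'' _ hks, lintegral_sub_right_eq_self]
  simp only [h3]
  rw [lintegral_const_mul'' _ (hf.pow_const q), ← mul_assoc]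
  refine mul_le_mul_left ?_ _
  calc (∫⁻ s, k s) ^ (q - 1) * ∫⁻ s, k s = (∫⁻ s, k s) ^ (q - 1) * (∫⁻ s, k s) ^ (1 : ℝ) := by
        rw [ENNReal.rpow_one]
    _ ≤ (∫⁻ s, k s) ^ q := by
        rw [← ENNReal.rpow_add_of_nonneg _ _ (by linarith) zero_le_one, sub_add_cancel]

variable {F : Type*} [NormedAddCommGroup F] [NormedSpace ℝ F]

theorem lintegral_enorm_conv_rpow_le {l : ℝ → ℝ} {v : ℝ → F} (hq : 1 ≤ q)
    (hl : AEStronglyMeasurable l (volume.restrict (Ioo 0 T)))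
    (hv : AEStronglyMeasurable v (volume.restrict (Ioo 0 T))) :
    ∫⁻ t in Ioo 0 T, ‖conv l v t‖ₑ ^ q
      ≤ (∫⁻ t in Ioo 0 T, ‖l t‖ₑ) ^ q * ∫⁻ t in Ioo 0 T, ‖v t‖ₑ ^ q := by
  have hl' : AEMeasurable ((Ioo 0 T).indicator fun s => ‖l s‖ₑ) :=
    (aemeasurable_indicator_iff measurableSet_Ioo).mpr hl.enorm
  have hv' : AEMeasurable ((Ioo 0 T).indicator fun s => ‖v s‖ₑ) :=
    (aemeasurable_indicator_iff measurableSet_Ioo).mpr hv.enorm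
  have hq0 : 0 < q := by linarith
  have h1 := lintegral_rpow_convolution_le hq hl' hv'
  rw [lintegral_indicator measurableSet_Ioo] at h1
  have h2 : ∫⁻ s, (Ioo 0 T).indicator (fun s => ‖v s‖ₑ) s ^ q
      = ∫⁻ t in Ioo 0 T, ‖v t‖ₑ ^ q := by
    rw [← lintegral_indicator measurableSet_Ioo]
    refine lintegral_congr fun s => ?_
    by_cases hs : s ∈ Ioo 0 T <;> simp [hs, hq0]
  rw [h2] at h1
  refine le_trans ?_ h1
  refine (lintegral_mono_ae ?_).trans (setLIntegral_le_lintegral (Ioo 0 T) _)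
  filter_upwards [ae_restrict_mem measurableSet_Ioo] with t ht
  refine ENNReal.rpow_le_rpow ?_ hq0.le
  rw [conv_eq_convolution l v ht.1.le ht.2.le, convolution_lsmul_swap]
  refine (enorm_integral_le_lintegral_enorm _).trans_eq (lintegral_congr fun s => ?_)
  rw [enorm_smul]
  congr 1 <;> exact enorm_indicator_eq_indicator_enorm _ _

theorem memLp_conv {l : ℝ → ℝ} {v : ℝ → F} (hl : IntegrableOn l (Ioo 0 T))
    (hv : MemLp v 2 (volume.restrict (Ioo 0 T))) :
    MemLp (conv l v) 2 (volume.restrict (Ioo 0 T)) := by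
  have hvi : IntegrableOn v (Ioo 0 T) := hv.integrable one_le_two
  refine ⟨(integrableOn_conv hl hvi).aestronglyMeasurable, ?_⟩
  rw [eLpNorm_lt_top_iff_lintegral_rpow_enorm_lt_top two_ne_zero ENNReal.ofNat_ne_top]
  refine (lintegral_enorm_conv_rpow_le (by norm_num) hl.aestronglyMeasurable
    hv.aestronglyMeasurable).trans_lt ?_
  refine ENNReal.mul_lt_top (ENNReal.rpow_lt_top_of_nonneg (by norm_num) hl.2.ne) ?_
  rw [← eLpNorm_lt_top_iff_lintegral_rpow_enorm_lt_top two_ne_zero ENNReal.ofNat_ne_top]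
  exact hv.2

end Young

/-! ### Resolvent kernels as an approximate identity. -/

section ApproximateIdentity

variable {k l : ℝ → ℝ} {T : ℝ} {E : Type*} [NormedAddCommGroup E] [InnerProductSpace ℝ E]

/-- Resolvent kernels act as an approximate identity at functions continuous at the origin. -/
theorem tendsto_integral_resolvent_mul (hkl : IsPCPair k l) {h : ℕ → ℝ → ℝ} (hT : 0 < T)
    (hh : ∀ n : ℕ, 0 < n → IsResolventKernel n l (h n)) {C : ℝ → ℝ} {B : ℝ}
    (hB : ∀ t, |C t| ≤ B) (hC : ContinuousAt C 0)
    (hi : ∀ n : ℕ, 0 < n → IntegrableOn (fun t => h n t * C t) (Ioo 0 T)) :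
    Tendsto (fun n => ∫ t in Ioo 0 T, h n t * C t) atTop (𝓝 (C 0)) := by
  have hmass : ∀ t, 0 < t → Tendsto (fun n => ∫ s in Ioo 0 t, h n s) atTop (𝓝 1) := by
    intro t ht
    have := tendsto_integral_resolvent hkl hh ht
    simpa only [intervalIntegral.integral_of_le ht.le, integral_Ioc_eq_integral_Ioo] using this
  rw [Metric.tendsto_atTop]
  intro ε hε
  obtain ⟨δ, hδ, hCδ⟩ := Metric.continuousAt_iff.mp hC (ε / 2) (half_pos hε)
  -- On `(0, d)` the oscillation of `C` is below `ε / 2`; beyond `d` it is at most `2 B`, and the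
  -- mass of `h_n` there tends to `0`. The last term of `hlim` accounts for the total mass not being
  -- exactly one.
  set d := min δ T with hd_def
  have hd : 0 < d := lt_min hδ hT
  have hlim : Tendsto (fun n => ε / 2 + 2 * B * ((∫ s in Ioo 0 T, h n s) - ∫ s in Ioo 0 d, h n s)
      + |C 0| * |(∫ s in Ioo 0 T, h n s) - 1|) atTop (𝓝 (ε / 2 + 2 * B * (1 - 1)
      + |C 0| * |(1 : ℝ) - 1|)) :=
    ((((hmass T hT).sub (hmass d hd)).const_mul _).const_add _).add
      ((((hmass T hT).sub_const 1).abs).const_mul _)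
  have hev := hlim.eventually_lt_const (u := ε) (by simp; linarith)
  obtain ⟨n₀, hn₀⟩ := eventually_atTop.mp hev
  refine ⟨max n₀ 1, fun n hn => ?_⟩
  have hn1 : 0 < n := le_trans (le_max_right _ _) hn
  have hn' : (0 : ℝ) < n := by exact_mod_cast hn1
  refine lt_of_le_of_lt ?_ (hn₀ n (le_trans (le_max_left _ _) hn))
  have hr := hh n hn1
  have hint := hr.integrableOn T
  have hnn := hr.ae_nonneg hkl hn' T
  have hsplit : (∫ t in Ioo 0 T, h n t * C t) - C 0 = (∫ t in Ioo 0 T, h n t * (C t - C 0))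
      + C 0 * ((∫ s in Ioo 0 T, h n s) - 1) := by
    simp only [mul_sub]
    rw [integral_sub (hi n hn1) (hint.mul_const _), integral_mul_const]
    ring
  have hbd : ∀ᵐ t ∂(volume.restrict (Ioo 0 T)), ‖h n t * (C t - C 0)‖
      ≤ ε / 2 * h n t + 2 * B * (h n t - (Ioo 0 d).indicator (h n) t) := by
    filter_upwards [hnn, ae_restrict_mem measurableSet_Ioo] with t ht htT
    rw [norm_mul, Real.norm_of_nonneg ht, Real.norm_eq_abs]
    have hB0 : 0 ≤ B := (abs_nonneg _).trans (hB 0)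
    by_cases htd : t ∈ Ioo 0 d
    · rw [indicator_of_mem htd, sub_self, mul_zero, add_zero, mul_comm]
      refine mul_le_mul_of_nonneg_right ?_ ht
      have := hCδ (x := t) (by
        rw [Real.dist_eq, sub_zero, abs_of_pos htT.1]
        exact htd.2.trans_le (min_le_left _ _))
      exact this.le
    · rw [indicator_of_notMem htd, sub_zero]
      have : |C t - C 0| ≤ 2 * B := (abs_sub _ _).trans (by linarith [hB t, hB 0])
      have := mul_le_mul_of_nonneg_left this ht
      have := mul_nonneg (half_pos hε).le ht
      linarith
  have hind : IntegrableOn ((Ioo 0 d).indicator (h n)) (Ioo 0 T) :=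
    hint.indicator measurableSet_Ioo
  have hsub : IntegrableOn (fun t => h n t - (Ioo 0 d).indicator (h n) t) (Ioo 0 T) :=
    hint.sub hind
  have hbd2 := norm_integral_le_of_norm_le ((hint.const_mul (ε / 2)).add
    (hsub.const_mul (2 * B))) hbd
  have hval : ∫ t in Ioo 0 T, (ε / 2 * h n t + 2 * B * (h n t - (Ioo 0 d).indicator (h n) t))
      ≤ ε / 2 + 2 * B * ((∫ s in Ioo 0 T, h n s) - ∫ s in Ioo 0 d, h n s) := by
    have e2 : ∫ t in Ioo 0 T, (Ioo 0 d).indicator (h n) t = ∫ s in Ioo 0 d, h n s := by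
      rw [setIntegral_indicator measurableSet_Ioo,
        inter_eq_right.mpr (Ioo_subset_Ioo_right (min_le_right _ _))]
    have e1 : ∫ t in Ioo 0 T, (ε / 2 * h n t + 2 * B * (h n t - (Ioo 0 d).indicator (h n) t))
        = ε / 2 * (∫ s in Ioo 0 T, h n s)
          + 2 * B * ((∫ s in Ioo 0 T, h n s) - ∫ s in Ioo 0 d, h n s) := by
      rw [integral_add (hint.const_mul _) (hsub.const_mul (2 * B)), integral_const_mul,
        integral_const_mul]
      congr 2
      rw [← e2]
      exact integral_sub hint hind
    rw [e1]
    have := mul_le_of_le_one_right (half_pos hε).le (hr.setIntegral_le_one hkl hn' hT.le)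
    linarith
  rw [Real.dist_eq, hsplit]
  refine (abs_add_le _ _).trans ?_
  rw [abs_mul (C 0)]
  exact add_le_add ((Real.norm_eq_abs _ ▸ hbd2).trans hval) le_rfl

/-- The correlation of two `L_2` functions is continuous at the origin. -/
theorem continuousAt_correlation {g y : ℝ → E} (hg : MemLp g 2 volume) (hy : MemLp y 2 volume) :
    ContinuousAt (fun τ => ∫ t, inner ℝ (g (t - τ)) (y t)) 0 := by
  -- Translations act continuously on `L_2`, so the correlation is the inner product of a continuous
  -- curve with a fixed vector.
  let φ : ℝ → C(ℝ, ℝ) := fun τ => ⟨fun t => t - τ, by fun_prop⟩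
  have hφ : Continuous φ := by
    refine ContinuousMap.continuous_of_continuous_uncurry _ ?_
    simp only [φ, Function.uncurry_def, ContinuousMap.coe_mk]
    fun_prop
  have hφm : ∀ τ, MeasurePreserving (φ τ) volume volume := fun τ =>
    measurePreserving_sub_right volume τ
  have h1 : Continuous fun τ => Lp.compMeasurePreserving (φ τ) (hφm τ) (hg.toLp g) :=
    continuous_const.compMeasurePreservingLp hφ hφm ENNReal.ofNat_ne_top
  have h2 : Continuous fun τ =>
      inner ℝ (Lp.compMeasurePreserving (φ τ) (hφm τ) (hg.toLp g)) (hy.toLp y) :=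
    h1.inner continuous_const
  refine (h2.congr fun τ => ?_).continuousAt
  rw [L2.inner_def]
  refine integral_congr_ae ?_
  rw [Lp.toLp_compMeasurePreserving hg (hφm τ)]
  filter_upwards [MemLp.coeFn_toLp (hg.comp_measurePreserving (hφm τ)), hy.coeFn_toLp] with t h3 h4
  rw [h3, h4]
  rfl

end ApproximateIdentity

/-! ### The energy estimate in time, for functions with values in a Hilbert space. -/

section Energy

theorem memLp_indicator_Ioo {E : Type*} [NormedAddCommGroup E] {T : ℝ} {g : ℝ → E} (hg : MemLp g 2 (volume.restrict (Ioo 0 T))) :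
    MemLp ((Ioo 0 T).indicator g) 2 volume :=
  (memLp_indicator_iff_restrict measurableSet_Ioo).mpr hg

variable {k l h : ℝ → ℝ} {T γ : ℝ} {E : Type*} [NormedAddCommGroup E] [InnerProductSpace ℝ E]

theorem abs_inner_le_half_sq_add_half_sq (x y : E) :
    |inner ℝ x y| ≤ 1 / 2 * ‖x‖ ^ 2 + 1 / 2 * ‖y‖ ^ 2 := by
  have h1 := abs_real_inner_le_norm x y
  nlinarith [sq_nonneg (‖x‖ - ‖y‖)]

theorem integrable_inner_of_memLp {α : Type*} [MeasurableSpace α] {μ : Measure α} {f g : α → E}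
    (hf : MemLp f 2 μ) (hg : MemLp g 2 μ) : Integrable (fun a => (inner ℝ (f a) (g a) : ℝ)) μ := by
  have hf2 : Integrable (fun a => ‖f a‖ ^ 2) μ := hf.integrable_norm_pow two_ne_zero
  have hg2 : Integrable (fun a => ‖g a‖ ^ 2) μ := hg.integrable_norm_pow two_ne_zero
  exact ((hf2.const_mul (1 / 2)).add (hg2.const_mul (1 / 2))).mono' (hf.1.inner hg.1)
    (.of_forall fun a => abs_inner_le_half_sq_add_half_sq _ _)

theorem integrable_correlation_integrand {g y : ℝ → E} (hh : Integrable h)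
    (hg : MemLp g 2 volume) (hy : MemLp y 2 volume) :
    Integrable (fun p : ℝ × ℝ => h p.2 * inner ℝ (g (p.1 - p.2)) (y p.1))
      (volume.prod volume) := by
  have hg2 : Integrable fun t => ‖g t‖ ^ 2 := hg.integrable_norm_pow two_ne_zero
  have hy2 : Integrable fun t => ‖y t‖ ^ 2 := hy.integrable_norm_pow two_ne_zero
  have h1 : Integrable (fun p : ℝ × ℝ => |h p.2| * ‖g (p.1 - p.2)‖ ^ 2) (volume.prod volume) :=
    hh.abs.convolution_integrand (ContinuousLinearMap.mul ℝ ℝ) hg2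
  have h2 : Integrable (fun p : ℝ × ℝ => ‖y p.1‖ ^ 2 * |h p.2|) (volume.prod volume) :=
    hy2.mul_prod hh.abs
  have hm1 : AEStronglyMeasurable (fun p : ℝ × ℝ => h p.2) (volume.prod volume) :=
    hh.aestronglyMeasurable.comp_quasiMeasurePreserving Measure.quasiMeasurePreserving_snd
  have hm2 : AEStronglyMeasurable (fun p : ℝ × ℝ => y p.1) (volume.prod volume) :=
    hy.1.comp_quasiMeasurePreserving Measure.quasiMeasurePreserving_fst
  have hm3 : AEStronglyMeasurable (fun p : ℝ × ℝ => g (p.1 - p.2)) (volume.prod volume) :=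
    hg.1.comp_quasiMeasurePreserving
      (quasiMeasurePreserving_sub_of_right_invariant volume volume)
  refine ((h1.const_mul (1 / 2)).add (h2.const_mul (1 / 2))).mono' (hm1.mul (hm3.inner hm2))
    (.of_forall fun p => ?_)
  rw [norm_mul, Real.norm_eq_abs, Real.norm_eq_abs]
  have := mul_le_mul_of_nonneg_left (abs_inner_le_half_sq_add_half_sq (g (p.1 - p.2)) (y p.1))
    (abs_nonneg (h p.2))
  simp only [Pi.add_apply]
  linarith

theorem integrableOn_mul_correlation {g y : ℝ → E} (hh : IntegrableOn h (Ioo 0 T))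
    (hg : MemLp g 2 volume) (hy : MemLp y 2 volume) :
    IntegrableOn (fun τ => h τ * ∫ t, inner ℝ (g (t - τ)) (y t)) (Ioo 0 T) := by
  have := (integrable_correlation_integrand (hh.integrable_indicator measurableSet_Ioo)
    hg hy).integral_prod_right
  refine (this.integrableOn (s := Ioo 0 T)).congr ?_
  filter_upwards [ae_restrict_mem measurableSet_Ioo] with τ hτ
  simp only [indicator_of_mem hτ]
  exact integral_const_mul _ _

/-- Fubini separates the kernel from a correlation that does not depend on it. The limit of large
parameter and the invariance under time reversal both become statements about that correlation. -/
theorem integral_inner_conv [CompleteSpace E] {g y : ℝ → E} (hh : IntegrableOn h (Ioo 0 T))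
    (hg : MemLp g 2 (volume.restrict (Ioo 0 T))) (hy : MemLp y 2 (volume.restrict (Ioo 0 T))) :
    ∫ t in Ioo 0 T, inner ℝ (conv h g t) (y t)
      = ∫ τ in Ioo 0 T, h τ * ∫ t, inner ℝ ((Ioo 0 T).indicator g (t - τ))
          ((Ioo 0 T).indicator y t) := by
  have hg' := memLp_indicator_Ioo hg
  have hy' := memLp_indicator_Ioo hy
  have hh' := hh.integrable_indicator measurableSet_Ioo
  have hgi : Integrable ((Ioo 0 T).indicator g) :=
    IntegrableOn.integrable_indicator (hg.integrable one_le_two) measurableSet_Ioo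
  have hi := integrable_correlation_integrand hh' hg' hy'
  have hswap := integral_integral_swap (f := fun t τ => (Ioo 0 T).indicator h τ *
    inner ℝ ((Ioo 0 T).indicator g (t - τ)) ((Ioo 0 T).indicator y t)) hi
  have hR : ∫ τ, ∫ t, (Ioo 0 T).indicator h τ *
      inner ℝ ((Ioo 0 T).indicator g (t - τ)) ((Ioo 0 T).indicator y t)
      = ∫ τ in Ioo 0 T, h τ * ∫ t, inner ℝ ((Ioo 0 T).indicator g (t - τ))
          ((Ioo 0 T).indicator y t) := by
    rw [← integral_indicator measurableSet_Ioo]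
    refine integral_congr_ae (.of_forall fun τ => ?_)
    dsimp only
    rw [integral_const_mul]
    by_cases hτ : τ ∈ Ioo 0 T <;> simp [hτ]
  rw [← hR, ← hswap, ← integral_indicator measurableSet_Ioo]
  refine integral_congr_ae ?_
  filter_upwards [hh'.ae_convolution_exists (ContinuousLinearMap.lsmul ℝ ℝ) hgi] with t ht
  by_cases htT : t ∈ Ioo 0 T
  · have ht' : Integrable (fun τ => (Ioo 0 T).indicator h τ •
        (Ioo 0 T).indicator g (t - τ)) volume := ht
    rw [indicator_of_mem htT]
    simp only [indicator_of_mem (f := y) htT]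
    rw [conv_eq_convolution h g htT.1.le htT.2.le, convolution_lsmul, real_inner_comm,
      ← integral_inner (𝕜 := ℝ) ht' (y t)]
    refine integral_congr_ae (.of_forall fun τ => ?_)
    simp only [inner_smul_right]
    rw [real_inner_comm]
  · simp [htT]

theorem tendsto_integral_inner_conv_resolvent [CompleteSpace E] (hkl : IsPCPair k l) (hT : 0 < T)
    {h : ℕ → ℝ → ℝ} (hh : ∀ n : ℕ, 0 < n → IsResolventKernel n l (h n)) {g y : ℝ → E}
    (hg : MemLp g 2 (volume.restrict (Ioo 0 T))) (hy : MemLp y 2 (volume.restrict (Ioo 0 T))) :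
    Tendsto (fun n => ∫ t in Ioo 0 T, inner ℝ (conv (h n) g t) (y t)) atTop
      (𝓝 (∫ t in Ioo 0 T, inner ℝ (g t) (y t))) := by
  have hg' := memLp_indicator_Ioo hg
  have hy' := memLp_indicator_Ioo hy
  have hg2 : Integrable fun t => ‖(Ioo 0 T).indicator g t‖ ^ 2 :=
    hg'.integrable_norm_pow two_ne_zero
  have hy2 : Integrable fun t => ‖(Ioo 0 T).indicator y t‖ ^ 2 :=
    hy'.integrable_norm_pow two_ne_zero
  have h0 := tendsto_integral_resolvent_mul hkl hT hh
    (C := fun τ => ∫ t, inner ℝ ((Ioo 0 T).indicator g (t - τ)) ((Ioo 0 T).indicator y t))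
    (B := 1 / 2 * (∫ t, ‖(Ioo 0 T).indicator g t‖ ^ 2)
      + 1 / 2 * ∫ t, ‖(Ioo 0 T).indicator y t‖ ^ 2) ?_ (continuousAt_correlation hg' hy')
    fun n hn => integrableOn_mul_correlation ((hh n hn).integrableOn T) hg' hy'
  · have hlim : ∫ t, inner ℝ ((Ioo 0 T).indicator g (t - 0)) ((Ioo 0 T).indicator y t)
        = ∫ t in Ioo 0 T, inner ℝ (g t) (y t) := by
      rw [← integral_indicator measurableSet_Ioo]
      refine integral_congr_ae (.of_forall fun t => ?_)
      by_cases htT : t ∈ Ioo 0 T <;> simp [htT]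
    rw [hlim] at h0
    refine h0.congr' ?_
    filter_upwards [eventually_gt_atTop 0] with n hn
    exact (integral_inner_conv ((hh n hn).integrableOn T) hg hy).symm
  · intro τ
    have hg3 : Integrable fun t => ‖(Ioo 0 T).indicator g (t - τ)‖ ^ 2 := hg2.comp_sub_right τ
    have := norm_integral_le_of_norm_le ((hg3.const_mul (1 / 2)).add (hy2.const_mul (1 / 2)))
      (f := fun t => inner ℝ ((Ioo 0 T).indicator g (t - τ)) ((Ioo 0 T).indicator y t))
      (.of_forall fun t => abs_inner_le_half_sq_add_half_sq _ _)
    refine this.trans_eq ?_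
    simp only [Pi.add_apply]
    rw [integral_add (hg3.const_mul (1 / 2)) (hy2.const_mul (1 / 2)), integral_const_mul,
      integral_const_mul]
    congr 2
    exact integral_sub_right_eq_self (fun t => ‖(Ioo 0 T).indicator g t‖ ^ 2) τ

/-- `h ∗ g = γ (y - h ∗ y)` for `y = l ∗ g` and the resolvent kernel `h` of `γ l`. -/
theorem IsResolventKernel.conv_eq [CompleteSpace E] (hh : IsResolventKernel γ l h)
    (hkl : IsPCPair k l) {g : ℝ → E} (hg : IntegrableOn g (Ioo 0 T)) :
    ∀ᵐ t ∂(volume.restrict (Ioo 0 T)),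
      conv h g t = γ • (conv l g t - conv h (conv l g) t) := by
  have hl := hkl.integrableOn_l T
  have hi := hh.integrableOn T
  filter_upwards [conv_assoc_ae hi hl hg, ae_integrableOn_conv_integrand (hl.const_mul γ) hg,
    ae_integrableOn_conv_integrand ((integrableOn_conv hi hl).const_mul γ) hg,
    ae_restrict_mem measurableSet_Ioo] with t h1 h2 h3 htT
  rw [h1, smul_sub, ← conv_mul_left, ← conv_mul_left, ← conv_sub_left htT.1.le h2 h3]
  -- The remaining identity of kernels, `h = γ l - γ (h ∗ l)`, is the resolvent equation.
  refine conv_congr (T := T) htT.1.le htT.2.le ?_ (ae_eq_refl g)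
  filter_upwards [hh.ae_eq T] with s hs
  linarith

/-- Since `h ≥ 0`, the arithmetic-geometric mean inequality for `⟨y s, y t⟩` can be applied under
the integral; the part frozen at `t` collects the mass of `h` on `(0, t)`. -/
theorem IsResolventKernel.inner_conv_le [CompleteSpace E] (hh : IsResolventKernel γ l h)
    (hkl : IsPCPair k l) (hγ : 0 < γ) {y : ℝ → E} (hy : MemLp y 2 (volume.restrict (Ioo 0 T))) :
    ∀ᵐ t ∂(volume.restrict (Ioo 0 T)), inner ℝ (conv h y t) (y t)
      ≤ 1 / 2 * conv h (fun s => ‖y s‖ ^ 2) t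
        + 1 / 2 * ((∫ s in (0 : ℝ)..t, h s) * ‖y t‖ ^ 2) := by
  have hi := hh.integrableOn T
  have hyi : IntegrableOn y (Ioo 0 T) := hy.integrable one_le_two
  have hy2 : IntegrableOn (fun t => ‖y t‖ ^ 2) (Ioo 0 T) := hy.integrable_norm_pow two_ne_zero
  filter_upwards [ae_integrableOn_conv_integrand hi hyi, ae_integrableOn_conv_integrand hi hy2,
    ae_restrict_mem measurableSet_Ioo] with t h1 h2 htT
  have hht : IntegrableOn (fun s => h (t - s)) (Ioo 0 t) := by
    have := intervalIntegrable_of_integrableOn hi le_rfl htT.1.le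
      (htT.1.le.trans htT.2.le) htT.2.le
    have := this.comp_sub_left t
    rw [sub_zero, sub_self] at this
    have := this.symm
    rwa [intervalIntegrable_iff, uIoc_of_le htT.1.le,
      integrableOn_Ioc_iff_integrableOn_Ioo] at this
  have hH : ∫ s in (0 : ℝ)..t, h s = ∫ s in Ioo 0 t, h (t - s) := by
    rw [← integral_Ioc_eq_integral_Ioo, ← intervalIntegral.integral_of_le htT.1.le]
    simp
  rw [conv_eq_integral_Ioo h y htT.1.le, conv_eq_integral_Ioo h _ htT.1.le, real_inner_comm,
    ← integral_inner (𝕜 := ℝ) h1 (y t), hH, ← integral_mul_const, ← integral_const_mul,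
    ← integral_const_mul, ← integral_add (h2.const_mul _) ((hht.mul_const _).const_mul _)]
  refine integral_mono_ae (h1.const_inner (y t)) ((h2.const_mul _).add
    ((hht.mul_const _).const_mul _)) ?_
  filter_upwards [ae_comp_sub_of_ae (hh.ae_nonneg hkl hγ T) htT.2.le] with s hs
  simp only [smul_eq_mul, inner_smul_right]
  have := mul_le_mul_of_nonneg_left ((le_abs_self _).trans
    (abs_inner_le_half_sq_add_half_sq (y t) (y s))) hs
  linarith

theorem measurePreserving_const_sub (T : ℝ) :
    MeasurePreserving (fun t => T - t) (volume.restrict (Ioo 0 T)) (volume.restrict (Ioo 0 T)) := by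
  have h1 := (Measure.measurePreserving_sub_left volume T).restrict_preimage_emb
    (measurableEmbedding_subLeft T) (Ioo 0 T)
  simpa using h1

/-- The primitive of `h ∗ φ` is `(1 ∗ h) ∗ φ`, here evaluated at the final time. The reflected
argument `T - t` is the origin of the weight `k (T - t)`. -/
theorem integral_sub_conv_eq {φ : ℝ → ℝ} (hh : IntegrableOn h (Ioo 0 T)) (hT : 0 ≤ T)
    (hφ : IntegrableOn φ (Ioo 0 T)) :
    ∫ t in Ioo 0 T, conv h φ t
      = ∫ t in Ioo 0 T, (∫ s in (0 : ℝ)..T - t, h s) * φ t := by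
  rw [← integral_Ioc_eq_integral_Ioo, ← intervalIntegral.integral_of_le hT,
    integral_conv hh hφ hT le_rfl, conv_eq_integral_Ioo _ _ hT]
  simp

/-- The energy estimate at the level of the resolvent kernels. -/
theorem IsResolventKernel.lintegral_energy_le [CompleteSpace E] (hh : IsResolventKernel γ l h)
    (hkl : IsPCPair k l) (hγ : 0 < γ) (hT : 0 < T) {g : ℝ → E}
    (hg : MemLp g 2 (volume.restrict (Ioo 0 T))) :
    0 ≤ ∫ t in Ioo 0 T, inner ℝ (conv h g t) (conv l g t) ∧
    ∫⁻ t in Ioo 0 T, ENNReal.ofReal ((k (T - t) * (∫ s in (0 : ℝ)..T - t, h s)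
        + k t * ∫ s in (0 : ℝ)..t, h s) * ‖conv l g t‖ ^ 2)
      ≤ ENNReal.ofReal (2 * ∫ t in Ioo 0 T, inner ℝ (conv h g t) (conv l g t)) := by
  set y := conv l g with hy_def
  have hl := hkl.integrableOn_l T
  have hi := hh.integrableOn T
  have hgi : IntegrableOn g (Ioo 0 T) := hg.integrable one_le_two
  have hy : MemLp y 2 (volume.restrict (Ioo 0 T)) := memLp_conv hl hg
  have hy2 : IntegrableOn (fun t => ‖y t‖ ^ 2) (Ioo 0 T) := hy.integrable_norm_pow two_ne_zero
  have hhg : MemLp (conv h g) 2 (volume.restrict (Ioo 0 T)) := memLp_conv hi hg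
  set H : ℝ → ℝ := fun t => ∫ s in (0 : ℝ)..t, h s with hH_def
  have hHc : ContinuousOn H (Icc 0 T) := continuousOn_integral hT.le hi
  have hH1 : ∀ t ∈ Ioo 0 T, 0 ≤ H t ∧ H t ≤ 1 := fun t ht =>
    ⟨hh.integral_nonneg hkl hγ ht.1.le, hh.integral_le_one hkl hγ ht.1.le⟩
  have hrev : ∀ t ∈ Ioo 0 T, T - t ∈ Ioo 0 T := fun t ht =>
    ⟨by linarith [ht.2], by linarith [ht.1]⟩
  have hHy : IntegrableOn (fun t => H t * ‖y t‖ ^ 2) (Ioo 0 T) := by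
    refine hy2.bdd_mul (c := 1) ((hHc.mono Ioo_subset_Icc_self).aestronglyMeasurable
      measurableSet_Ioo) ?_
    filter_upwards [ae_restrict_mem measurableSet_Ioo] with t ht
    rw [Real.norm_of_nonneg (hH1 t ht).1]
    exact (hH1 t ht).2
  have hHy' : IntegrableOn (fun t => H (T - t) * ‖y t‖ ^ 2) (Ioo 0 T) := by
    refine hy2.bdd_mul (c := 1) ((hHc.comp (s := Ioo 0 T) (by fun_prop) fun t ht =>
      Ioo_subset_Icc_self (hrev t ht)).aestronglyMeasurable measurableSet_Ioo) ?_
    filter_upwards [ae_restrict_mem measurableSet_Ioo] with t ht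
    rw [Real.norm_of_nonneg (hH1 _ (hrev t ht)).1]
    exact (hH1 _ (hrev t ht)).2
  have hcy : IntegrableOn (conv h fun s => ‖y s‖ ^ 2) (Ioo 0 T) := integrableOn_conv hi hy2
  -- Insert `h ∗ g = γ (y - h ∗ y)` and split `2 ‖y‖²` evenly between the two halves of the bound on
  -- `⟨h ∗ y, y⟩`.
  have hpt : ∀ᵐ t ∂(volume.restrict (Ioo 0 T)),
      γ * (‖y t‖ ^ 2 - conv h (fun s => ‖y s‖ ^ 2) t) + γ * (‖y t‖ ^ 2 - H t * ‖y t‖ ^ 2)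
        ≤ 2 * inner ℝ (conv h g t) (y t) := by
    filter_upwards [hh.conv_eq hkl hgi, hh.inner_conv_le hkl hγ hy] with t h1 h2
    rw [h1, real_inner_smul_left, inner_sub_left, real_inner_self_eq_norm_sq]
    have := mul_le_mul_of_nonneg_left h2 hγ.le
    simp only [hH_def]
    linarith
  have hinn : IntegrableOn (fun t => inner ℝ (conv h g t) (y t)) (Ioo 0 T) :=
    integrable_inner_of_memLp hhg hy
  have hA : IntegrableOn (fun t => γ * (‖y t‖ ^ 2 - H (T - t) * ‖y t‖ ^ 2)) (Ioo 0 T) :=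
    (hy2.sub hHy').const_mul γ
  have hB : IntegrableOn (fun t => γ * (‖y t‖ ^ 2 - H t * ‖y t‖ ^ 2)) (Ioo 0 T) :=
    (hy2.sub hHy).const_mul γ
  have hC : IntegrableOn (fun t => γ * (‖y t‖ ^ 2 - conv h (fun s => ‖y s‖ ^ 2) t)) (Ioo 0 T) :=
    (hy2.sub hcy).const_mul γ
  have hW : IntegrableOn (fun t => γ * (1 - H (T - t)) * ‖y t‖ ^ 2 + γ * (1 - H t) * ‖y t‖ ^ 2)
      (Ioo 0 T) := by
    refine (hA.add hB).congr (.of_forall fun t => ?_)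
    simp only [Pi.add_apply]
    ring
  have hWeq : ∫ t in Ioo 0 T, (γ * (1 - H (T - t)) * ‖y t‖ ^ 2 + γ * (1 - H t) * ‖y t‖ ^ 2)
      ≤ 2 * ∫ t in Ioo 0 T, inner ℝ (conv h g t) (y t) := by
    rw [← integral_const_mul]
    refine le_trans (le_of_eq ?_) (integral_mono_ae (hC.add hB) (hinn.const_mul 2) hpt)
    have e1 : ∫ t in Ioo 0 T, conv h (fun s => ‖y s‖ ^ 2) t
      = ∫ t in Ioo 0 T, H (T - t) * ‖y t‖ ^ 2 := integral_sub_conv_eq hi hT.le hy2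
    have e2 : ∫ t in Ioo 0 T, γ * (‖y t‖ ^ 2 - H (T - t) * ‖y t‖ ^ 2)
        = ∫ t in Ioo 0 T, γ * (‖y t‖ ^ 2 - conv h (fun s => ‖y s‖ ^ 2) t) := by
      rw [integral_const_mul, integral_const_mul, integral_sub hy2 hHy', integral_sub hy2 hcy, e1]
    simp only [Pi.add_apply]
    rw [integral_add hC hB, ← e2, ← integral_add hA hB]
    refine integral_congr_ae (.of_forall fun t => ?_)
    dsimp only
    ring
  have hW0 : ∀ᵐ t ∂(volume.restrict (Ioo 0 T)),
      0 ≤ γ * (1 - H (T - t)) * ‖y t‖ ^ 2 + γ * (1 - H t) * ‖y t‖ ^ 2 := by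
    filter_upwards [ae_restrict_mem measurableSet_Ioo] with t ht
    have h1 := (hH1 t ht).2
    have h2 := (hH1 _ (hrev t ht)).2
    exact add_nonneg (mul_nonneg (mul_nonneg hγ.le (by linarith)) (sq_nonneg _))
      (mul_nonneg (mul_nonneg hγ.le (by linarith)) (sq_nonneg _))
  refine ⟨by linarith [integral_nonneg_of_ae hW0], ?_⟩
  refine le_trans ?_ (ENNReal.ofReal_le_ofReal hWeq)
  rw [ofReal_integral_eq_lintegral_ofReal hW hW0]
  refine lintegral_mono_ae ?_
  have hk := hh.mul_integral_le hkl hγ T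
  -- The bound `k H ≤ γ (1 - H)` is needed both at `t` and at the reflected time `T - t`.
  filter_upwards [hk, (measurePreserving_const_sub T).quasiMeasurePreserving.ae hk] with t h1 h2
  refine ENNReal.ofReal_le_ofReal ?_
  rw [← add_mul]
  exact mul_le_mul_of_nonneg_right (add_le_add h2 h1) (sq_nonneg _)

/-- Conjugate kernels are of positive type. -/
theorem IsPCPair.integral_inner_conv_nonneg [CompleteSpace E] (hkl : IsPCPair k l) (hT : 0 < T)
    {g : ℝ → E} (hg : MemLp g 2 (volume.restrict (Ioo 0 T))) :
    0 ≤ ∫ t in Ioo 0 T, inner ℝ (conv l g t) (g t) := by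
  choose h hh using fun n : ℕ => exists_isResolventKernel hkl.locInt_l (n : ℝ)
  have hy : MemLp (conv l g) 2 (volume.restrict (Ioo 0 T)) := memLp_conv (hkl.integrableOn_l T) hg
  simp only [real_inner_comm (g _)]
  refine ge_of_tendsto (tendsto_integral_inner_conv_resolvent hkl hT (fun n _ => hh n) hg hy) ?_
  filter_upwards [eventually_gt_atTop 0] with n hn
  exact ((hh n).lintegral_energy_le hkl (by exact_mod_cast hn) hT hg).1

/-- The energy estimate `∫ ([k(T - t) + k(t)] |l ∗ g|²) ≤ 2 ∫ ⟨g, l ∗ g⟩`. -/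
theorem IsPCPair.lintegral_energy_le [CompleteSpace E] (hkl : IsPCPair k l) (hT : 0 < T)
    {g : ℝ → E} (hg : MemLp g 2 (volume.restrict (Ioo 0 T))) :
    ∫⁻ t in Ioo 0 T, ENNReal.ofReal ((k (T - t) + k t) * ‖conv l g t‖ ^ 2)
      ≤ ENNReal.ofReal (2 * ∫ t in Ioo 0 T, inner ℝ (g t) (conv l g t)) := by
  choose h hh using fun n : ℕ => exists_isResolventKernel hkl.locInt_l (n : ℝ)
  have hl := hkl.integrableOn_l T
  have hy : MemLp (conv l g) 2 (volume.restrict (Ioo 0 T)) := memLp_conv hl hg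
  have hk := (hkl.integrableOn_k T).aestronglyMeasurable.aemeasurable
  have hk' : AEMeasurable (fun t => k (T - t)) (volume.restrict (Ioo 0 T)) :=
    hk.comp_quasiMeasurePreserving (measurePreserving_const_sub T).quasiMeasurePreserving
  have hHm : ∀ n, AEMeasurable (fun t => ∫ s in (0 : ℝ)..t, h n s)
      (volume.restrict (Ioo 0 T)) := fun n =>
    ((continuousOn_integral hT.le ((hh n).integrableOn T)).mono
      Ioo_subset_Icc_self).aemeasurable measurableSet_Ioo
  have hHm' : ∀ n, AEMeasurable (fun t => ∫ s in (0 : ℝ)..T - t, h n s)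
      (volume.restrict (Ioo 0 T)) := fun n =>
    (hHm n).comp_quasiMeasurePreserving (measurePreserving_const_sub T).quasiMeasurePreserving
  set Φ : ℕ → ℝ → ℝ≥0∞ := fun n t => ENNReal.ofReal ((k (T - t) * (∫ s in (0 : ℝ)..T - t, h n s)
    + k t * ∫ s in (0 : ℝ)..t, h n s) * ‖conv l g t‖ ^ 2) with hΦ
  have hΦm : ∀ n, AEMeasurable (Φ n) (volume.restrict (Ioo 0 T)) := fun n =>
    (((hk'.mul (hHm' n)).add (hk.mul (hHm n))).mul
      (hy.1.norm.aemeasurable.pow_const 2)).ennreal_ofReal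
  have hpt : ∀ t ∈ Ioo 0 T, Tendsto (fun n => Φ n t) atTop
      (𝓝 (ENNReal.ofReal ((k (T - t) + k t) * ‖conv l g t‖ ^ 2))) := by
    intro t ht
    refine (ENNReal.continuous_ofReal.tendsto _).comp ?_
    have h1 := tendsto_integral_resolvent hkl (fun n _ => hh n) ht.1
    have h2 := tendsto_integral_resolvent hkl (fun n _ => hh n) (sub_pos.mpr ht.2)
    simpa using ((h2.const_mul (k (T - t))).add (h1.const_mul (k t))).mul_const
      (‖conv l g t‖ ^ 2)
  -- Fatou's lemma on the left, where the weights converge pointwise; on the right, `h_n ∗ g` is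
  -- paired with the fixed function `l ∗ g`, and the pairing converges.
  calc ∫⁻ t in Ioo 0 T, ENNReal.ofReal ((k (T - t) + k t) * ‖conv l g t‖ ^ 2)
      = ∫⁻ t in Ioo 0 T, liminf (fun n => Φ n t) atTop :=
        setLIntegral_congr_fun measurableSet_Ioo fun t ht => (hpt t ht).liminf_eq.symm
    _ ≤ liminf (fun n => ∫⁻ t in Ioo 0 T, Φ n t) atTop := lintegral_liminf_le' hΦm
    _ ≤ liminf (fun n => ENNReal.ofReal (2 * ∫ t in Ioo 0 T,
          inner ℝ (conv (h n) g t) (conv l g t))) atTop := by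
        refine liminf_le_liminf ?_
        filter_upwards [eventually_gt_atTop 0] with n hn
        exact ((hh n).lintegral_energy_le hkl (by exact_mod_cast hn) hT hg).2
    _ = ENNReal.ofReal (2 * ∫ t in Ioo 0 T, inner ℝ (g t) (conv l g t)) :=
        ((ENNReal.continuous_ofReal.tendsto _).comp ((tendsto_integral_inner_conv_resolvent hkl hT
          (fun n _ => hh n) hg hy).const_mul 2)).liminf_eq

theorem dualConv_eq_conv (l : ℝ → ℝ) (g : ℝ → E) (T t : ℝ) :
    dualConv T l g t = conv l (fun s => g (T - s)) (T - t) := by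
  rw [dualConv, conv]
  have := intervalIntegral.integral_comp_sub_left (fun τ => l (τ - t) • g τ) T (a := 0)
    (b := T - t)
  simp only [sub_zero, sub_sub_cancel] at this
  rw [← this]
  refine intervalIntegral.integral_congr fun s _ => ?_
  ring_nf

theorem setLIntegral_comp_const_sub (f : ℝ → ℝ≥0∞) (T : ℝ) :
    ∫⁻ t in Ioo 0 T, f (T - t) = ∫⁻ t in Ioo 0 T, f t :=
  (measurePreserving_const_sub T).lintegral_comp_emb (measurableEmbedding_subLeft T) f

/-- The correlation of `g` with itself is invariant under time reversal. -/
theorem integral_inner_conv_reverse [CompleteSpace E] {g : ℝ → E} (hl : IntegrableOn l (Ioo 0 T))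
    (hg : MemLp g 2 (volume.restrict (Ioo 0 T))) :
    ∫ t in Ioo 0 T, inner ℝ (conv l (fun s => g (T - s)) t) (g (T - t))
      = ∫ t in Ioo 0 T, inner ℝ (conv l g t) (g t) := by
  have hg' : MemLp (fun s => g (T - s)) 2 (volume.restrict (Ioo 0 T)) :=
    hg.comp_measurePreserving (measurePreserving_const_sub T)
  rw [integral_inner_conv hl hg' hg', integral_inner_conv hl hg hg]
  refine setIntegral_congr_fun measurableSet_Ioo fun τ _ => ?_
  congr 1
  -- The substitution `t ↦ T + τ - t` exchanges the two arguments of the inner product in the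
  -- correlation of the reversed function.
  rw [← integral_sub_left_eq_self _ volume (T + τ)]
  refine integral_congr_ae (.of_forall fun t => ?_)
  have hrev : ∀ s, (Ioo 0 T).indicator (fun s => g (T - s)) s
      = (Ioo 0 T).indicator g (T - s) := by
    intro s
    by_cases hs : s ∈ Ioo 0 T
    · rw [indicator_of_mem hs, indicator_of_mem (show T - s ∈ Ioo 0 T from
        ⟨by linarith [hs.2], by linarith [hs.1]⟩)]
    · rw [indicator_of_notMem hs, indicator_of_notMem fun h' => hs
        ⟨by linarith [h'.2], by linarith [h'.1]⟩]
  dsimp only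
  rw [hrev, hrev, real_inner_comm]
  congr 2 <;> ring

/-- The energy estimate for the dual convolution. -/
theorem IsPCPair.lintegral_dual_energy_le [CompleteSpace E] (hkl : IsPCPair k l) (hT : 0 < T)
    {g : ℝ → E} (hg : MemLp g 2 (volume.restrict (Ioo 0 T))) :
    ∫⁻ t in Ioo 0 T, ENNReal.ofReal ((k (T - t) + k t) * ‖dualConv T l g t‖ ^ 2)
      ≤ ENNReal.ofReal (2 * ∫ t in Ioo 0 T, inner ℝ (conv l g t) (g t)) := by
  have hg' : MemLp (fun s => g (T - s)) 2 (volume.restrict (Ioo 0 T)) :=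
    hg.comp_measurePreserving (measurePreserving_const_sub T)
  have h1 := hkl.lintegral_energy_le hT hg'
  rw [← setLIntegral_comp_const_sub]
  -- The weight `k (T - t) + k t` is symmetric under reversal, which turns the dual convolution into
  -- an ordinary one.
  simp only [dualConv_eq_conv, sub_sub_cancel, add_comm (k _) (k (T - _))]
  rw [← integral_inner_conv_reverse (hkl.integrableOn_l T) hg]
  simpa only [real_inner_comm] using h1

end Energy

/-! ### Convolution in time on the cylinder: measurability, Fubini, differentiation. -/

section Cylinder

theorem ae_prod_of_ae_snd {X Y : Type*} [MeasurableSpace X] [MeasurableSpace Y] {μ : Measure X}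
    {κ : Measure Y} [SFinite κ] {p : X → Prop} (h : ∀ᵐ x ∂μ, p x) : ∀ᵐ z ∂(κ.prod μ), p z.2 :=
  Measure.quasiMeasurePreserving_snd.ae h

theorem ae_prod_of_ae_fst {X Y : Type*} [MeasurableSpace X] [MeasurableSpace Y] {μ : Measure X}
    {κ : Measure Y} [SFinite κ] {p : Y → Prop} (h : ∀ᵐ y ∂κ, p y) : ∀ᵐ z ∂(κ.prod μ), p z.1 :=
  Measure.quasiMeasurePreserving_fst.ae h

variable {X : Type*} [MeasurableSpace X] {μ : Measure X} [SFinite μ] {T : ℝ}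
  {F : Type*} [NormedAddCommGroup F]

theorem ae_ae_swap_of_ae_prod {Y : Type*} [MeasurableSpace Y] {κ : Measure Y} [SFinite κ]
    {p : Y × X → Prop} (h : ∀ᵐ z ∂(κ.prod μ), p z) : ∀ᵐ x ∂μ, ∀ᵐ y ∂κ, p (y, x) := by
  have := Measure.ae_ae_of_ae_prod (μ := μ) (ν := κ) (p := fun z => p z.swap)
    ((Measure.measurePreserving_swap (μ := μ) (ν := κ)).quasiMeasurePreserving.ae h)
  simpa using this

variable [NormedSpace ℝ F]

/-- Strongly measurable representatives, cut off in time, give a strongly measurable parametric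
integral. For almost every `x` the section of `v` agrees with that of its representative, so the
convolutions coincide at every time in `(0, T)`. -/
theorem aestronglyMeasurable_conv_prod {k : ℝ → ℝ} {v : ℝ → X → F}
    (hk : AEStronglyMeasurable k (volume.restrict (Ioo 0 T)))
    (hv : AEStronglyMeasurable (fun z : ℝ × X => v z.1 z.2)
      ((volume.restrict (Ioo 0 T)).prod μ)) :
    AEStronglyMeasurable (fun z : ℝ × X => conv k (fun s => v s z.2) z.1)
      ((volume.restrict (Ioo 0 T)).prod μ) := by
  set k₁ := (Ioo 0 T).indicator (hk.mk k) with hk₁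
  set v₁ := (Ioo 0 T ×ˢ (univ : Set X)).indicator (hv.mk _) with hv₁
  have hk₁m : StronglyMeasurable k₁ := hk.stronglyMeasurable_mk.indicator measurableSet_Ioo
  have hv₁m : StronglyMeasurable v₁ :=
    hv.stronglyMeasurable_mk.indicator (measurableSet_Ioo.prod MeasurableSet.univ)
  refine ⟨fun z => ∫ s, k₁ (z.1 - s) • v₁ (s, z.2), ?_, ?_⟩
  · refine StronglyMeasurable.integral_prod_right (f := fun (z : ℝ × X) s => k₁ (z.1 - s) • v₁ (s, z.2)) ?_
    exact (hk₁m.comp_measurable (g := fun p : (ℝ × X) × ℝ => p.1.1 - p.2) (by fun_prop)).smul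
      (hv₁m.comp_measurable (g := fun p : (ℝ × X) × ℝ => (p.2, p.1.2)) (by fun_prop))
  · filter_upwards [ae_prod_of_ae_snd (κ := volume.restrict (Ioo 0 T))
      (ae_ae_swap_of_ae_prod hv.ae_eq_mk),
      ae_prod_of_ae_fst (μ := μ) (ae_restrict_mem (μ := volume) measurableSet_Ioo)] with z hz ht
    rw [conv_congr ht.1.le ht.2.le hk.ae_eq_mk hz, conv_eq_convolution _ _ ht.1.le ht.2.le,
      convolution_lsmul_swap]
    refine integral_congr_ae (.of_forall fun s => ?_)
    simp only [hk₁, hv₁]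
    congr 1
    by_cases hs : s ∈ Ioo 0 T
    · rw [indicator_of_mem hs, indicator_of_mem (show (s, z.2) ∈ Ioo 0 T ×ˢ univ from ⟨hs, trivial⟩)]
    · rw [indicator_of_notMem hs, indicator_of_notMem fun h => hs h.1]

theorem lintegral_enorm_conv_prod_rpow_le {q : ℝ} (hq : 1 ≤ q) {l : ℝ → ℝ} {v : ℝ → X → F}
    (hl : AEStronglyMeasurable l (volume.restrict (Ioo 0 T)))
    (hv : AEStronglyMeasurable (fun z : ℝ × X => v z.1 z.2)
      ((volume.restrict (Ioo 0 T)).prod μ)) :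
    ∫⁻ z, ‖conv l (fun s => v s z.2) z.1‖ₑ ^ q ∂((volume.restrict (Ioo 0 T)).prod μ)
      ≤ (∫⁻ t in Ioo 0 T, ‖l t‖ₑ) ^ q
        * ∫⁻ z, ‖v z.1 z.2‖ₑ ^ q ∂((volume.restrict (Ioo 0 T)).prod μ) := by
  rw [lintegral_prod_symm _ ((aestronglyMeasurable_conv_prod hl hv).enorm.pow_const q),
    lintegral_prod_symm _ (hv.enorm.pow_const q)]
  have hm : AEMeasurable (fun x => ∫⁻ t in Ioo 0 T, ‖v t x‖ₑ ^ q) μ :=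
    (hv.enorm.pow_const q).prod_swap.lintegral_prod_right'
  rw [← lintegral_const_mul'' _ hm]
  refine lintegral_mono_ae ?_
  filter_upwards [hv.prod_swap.prodMk_left] with x hx
  exact lintegral_enorm_conv_rpow_le hq hl hx

theorem memLp_conv_prod {l : ℝ → ℝ} {v : ℝ → X → F} {q : ℝ} (hq : 1 ≤ q)
    (hl : IntegrableOn l (Ioo 0 T))
    (hv : MemLp (fun z : ℝ × X => v z.1 z.2) (ENNReal.ofReal q)
      ((volume.restrict (Ioo 0 T)).prod μ)) :
    MemLp (fun z : ℝ × X => conv l (fun s => v s z.2) z.1) (ENNReal.ofReal q)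
      ((volume.restrict (Ioo 0 T)).prod μ) := by
  have hq0 : 0 < q := by linarith
  have h0 : ENNReal.ofReal q ≠ 0 := by simpa using hq0
  refine ⟨aestronglyMeasurable_conv_prod hl.aestronglyMeasurable hv.1, ?_⟩
  have h1 := hv.2
  rw [eLpNorm_lt_top_iff_lintegral_rpow_enorm_lt_top h0 ENNReal.ofReal_ne_top,
    ENNReal.toReal_ofReal hq0.le] at h1 ⊢
  exact (lintegral_enorm_conv_prod_rpow_le hq hl.aestronglyMeasurable hv.1).trans_lt
    (ENNReal.mul_lt_top (ENNReal.rpow_lt_top_of_nonneg hq0.le hl.2.ne) h1)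

theorem integrable_conv_prod {l : ℝ → ℝ} {v : ℝ → X → F} (hl : IntegrableOn l (Ioo 0 T))
    (hv : Integrable (fun z : ℝ × X => v z.1 z.2) ((volume.restrict (Ioo 0 T)).prod μ)) :
    Integrable (fun z : ℝ × X => conv l (fun s => v s z.2) z.1)
      ((volume.restrict (Ioo 0 T)).prod μ) := by
  have := memLp_conv_prod (q := 1) le_rfl hl (v := v) (μ := μ)
  simp only [ENNReal.ofReal_one, memLp_one_iff_integrable] at this
  exact this hv

theorem memLp_two_conv_prod {l : ℝ → ℝ} {v : ℝ → X → F} (hl : IntegrableOn l (Ioo 0 T))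
    (hv : MemLp (fun z : ℝ × X => v z.1 z.2) 2 ((volume.restrict (Ioo 0 T)).prod μ)) :
    MemLp (fun z : ℝ × X => conv l (fun s => v s z.2) z.1) 2
      ((volume.restrict (Ioo 0 T)).prod μ) := by
  have := memLp_conv_prod (q := 2) (by norm_num) hl (v := v) (μ := μ)
  simp only [ENNReal.ofReal_ofNat] at this
  exact this hv

/-- For almost every `t` the integrand of a convolution is integrable in time and space. -/
theorem ae_integrable_conv_integrand_prod {k : ℝ → ℝ} {v : ℝ → X → F}
    (hk : IntegrableOn k (Ioo 0 T))
    (hv : Integrable (fun z : ℝ × X => v z.1 z.2) ((volume.restrict (Ioo 0 T)).prod μ)) :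
    ∀ᵐ t ∂(volume.restrict (Ioo 0 T)),
      Integrable (fun z : ℝ × X => k (t - z.1) • v z.1 z.2)
        ((volume.restrict (Ioo 0 t)).prod μ) := by
  have hΨ : IntegrableOn (fun s => ∫ x, ‖v s x‖ ∂μ) (Ioo 0 T) := hv.norm.integral_prod_left
  filter_upwards [ae_integrableOn_conv_integrand hk.abs hΨ, ae_restrict_mem measurableSet_Ioo]
    with t ht htT
  have hle : volume.restrict (Ioo 0 t) ≤ volume.restrict (Ioo 0 T) :=
    Measure.restrict_mono (Ioo_subset_Ioo_right htT.2.le) le_rfl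
  have hkt : AEStronglyMeasurable (fun s => k (t - s)) (volume.restrict (Ioo 0 t)) :=
    (hk.aestronglyMeasurable.mono_measure hle).comp_quasiMeasurePreserving
      (measurePreserving_const_sub t).quasiMeasurePreserving
  have hvt : AEStronglyMeasurable (fun z : ℝ × X => v z.1 z.2)
      ((volume.restrict (Ioo 0 t)).prod μ) :=
    hv.1.mono_ac (Measure.AbsolutelyContinuous.prod hle.absolutelyContinuous
      Measure.AbsolutelyContinuous.rfl)
  have hm : AEStronglyMeasurable (fun z : ℝ × X => k (t - z.1) • v z.1 z.2)
      ((volume.restrict (Ioo 0 t)).prod μ) :=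
    (hkt.comp_quasiMeasurePreserving Measure.quasiMeasurePreserving_fst).smul hvt
  rw [integrable_prod_iff hm]
  refine ⟨?_, ?_⟩
  · filter_upwards [ae_restrict_Ioo_of_le hv.prod_right_ae htT.2.le] with s hs
    exact hs.smul _
  · refine ht.congr (.of_forall fun s => ?_)
    simp only [norm_smul, smul_eq_mul, Real.norm_eq_abs]
    exact (integral_const_mul _ _).symm

theorem conv_integral_eq_integral_conv [CompleteSpace F] {k : ℝ → ℝ} {v : ℝ → X → F} {t : ℝ} (ht : 0 ≤ t)
    (h : Integrable (fun z : ℝ × X => k (t - z.1) • v z.1 z.2)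
        ((volume.restrict (Ioo 0 t)).prod μ)) :
    conv k (fun s => ∫ x, v s x ∂μ) t = ∫ x, conv k (fun s => v s x) t ∂μ := by
  simp only [conv_eq_integral_Ioo _ _ ht]
  rw [← integral_integral_swap (f := fun s x => k (t - s) • v s x) h]
  refine integral_congr_ae (.of_forall fun s => ?_)
  exact (integral_smul _ _).symm

theorem ae_ae_mem_of_measurableSet {Y : Type*} [MeasurableSpace Y] {κ : Measure Y} [SFinite κ]
    {s : Set (Y × X)} (hs : MeasurableSet s) (h : ∀ᵐ x ∂μ, ∀ᵐ y ∂κ, (y, x) ∈ s) :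
    ∀ᵐ z ∂(κ.prod μ), z ∈ s := by
  have h1 : MeasurableSet (Prod.swap ⁻¹' s : Set (X × Y)) := measurable_swap hs
  have h2 : ∀ᵐ z ∂(μ.prod κ), z ∈ (Prod.swap ⁻¹' s : Set (X × Y)) :=
    (Measure.ae_prod_mem_iff_ae_ae_mem h1).mpr h
  have h3 := (Measure.measurePreserving_swap (μ := κ) (ν := μ)).quasiMeasurePreserving.ae h2
  filter_upwards [h3] with z hz
  simpa using hz

/-- Difference quotients along rationals determine the derivative of a continuous function. -/
theorem hasDerivAt_of_forall_rat {f : ℝ → ℝ} (hf : Continuous f) {d t : ℝ}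
    (h : ∀ j : ℕ, ∃ i : ℕ, ∀ r : ℚ, |(r : ℝ)| < 1 / (i + 1) →
      |f (t + r) - f t - r * d| ≤ |(r : ℝ)| * (1 / (j + 1))) : HasDerivAt f d t := by
  rw [hasDerivAt_iff_isLittleO_nhds_zero, Asymptotics.isLittleO_iff]
  intro ε hε
  obtain ⟨j, hj⟩ := exists_nat_one_div_lt hε
  obtain ⟨i, hi⟩ := h j
  have hδ : (0 : ℝ) < 1 / (i + 1) := by positivity
  have hcl : IsClosed {r : ℝ | |f (t + r) - f t - r * d| ≤ |r| * (1 / (j + 1))} :=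
    isClosed_le (by fun_prop) (by fun_prop)
  have hopen : IsOpen {r : ℝ | |r| < 1 / (i + 1)} := isOpen_lt (by fun_prop) (by fun_prop)
  have hsub : {r : ℝ | |r| < 1 / (i + 1)}
      ⊆ {r : ℝ | |f (t + r) - f t - r * d| ≤ |r| * (1 / (j + 1))} := by
    refine (Rat.denseRange_cast (𝕜 := ℝ)).open_subset_closure_inter hopen |>.trans
      (closure_minimal ?_ hcl)
    rintro _ ⟨hr, r, rfl⟩
    exact hi r hr
  filter_upwards [hopen.mem_nhds (x := (0 : ℝ)) (by simpa using hδ)] with r hr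
  have : |f (t + r) - f t - r * d| ≤ |r| * (1 / (j + 1)) := hsub hr
  rw [Real.norm_eq_abs, Real.norm_eq_abs, smul_eq_mul]
  exact this.trans ((mul_le_mul_of_nonneg_left hj.le (abs_nonneg r)).trans_eq (mul_comm _ _))

/-- Lebesgue differentiation in time for functions on the cylinder, jointly in time and space. -/
theorem ae_hasDerivAt_integral_prod {w : ℝ → X → ℝ}
    (hw : Integrable (fun z : ℝ × X => w z.1 z.2) ((volume.restrict (Ioo 0 T)).prod μ)) :
    ∀ᵐ z ∂((volume.restrict (Ioo 0 T)).prod μ),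
      HasDerivAt (fun τ => ∫ s in (0 : ℝ)..τ, w s z.2) (w z.1 z.2) z.1 := by
  set w₁ := (Ioo 0 T ×ˢ (univ : Set X)).indicator (hw.1.mk _) with hw₁
  have hw₁m : StronglyMeasurable w₁ :=
    hw.1.stronglyMeasurable_mk.indicator (measurableSet_Ioo.prod MeasurableSet.univ)
  have hsec : ∀ x, (fun s => w₁ (s, x)) = (Ioo 0 T).indicator fun s => hw.1.mk _ (s, x) := by
    intro x
    ext s
    by_cases hs : s ∈ Ioo 0 T
    · rw [indicator_of_mem hs, hw₁, indicator_of_mem (show (s, x) ∈ Ioo 0 T ×ˢ univ from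
        ⟨hs, trivial⟩)]
    · rw [indicator_of_notMem hs, hw₁, indicator_of_notMem fun h => hs h.1]
  -- A jointly measurable version of the primitive in time.
  set Φ : ℝ × X → ℝ := fun z => ∫ s, (Iic z.1).indicator (fun s => w₁ (s, z.2)) s with hΦ
  have hΦm : Measurable Φ := by
    refine StronglyMeasurable.measurable ?_
    refine StronglyMeasurable.integral_prod_right
      (f := fun (z : ℝ × X) s => (Iic z.1).indicator (fun s => w₁ (s, z.2)) s) ?_
    have h1 : StronglyMeasurable fun p : (ℝ × X) × ℝ => w₁ (p.2, p.1.2) :=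
      hw₁m.comp_measurable (by fun_prop)
    have h2 : MeasurableSet {p : (ℝ × X) × ℝ | p.2 ≤ p.1.1} :=
      measurableSet_le (by fun_prop) (by fun_prop)
    exact h1.indicator h2
  have hsecI : ∀ᵐ x ∂μ, Integrable (fun s => w₁ (s, x)) volume ∧
      (fun s => w s x) =ᵐ[volume.restrict (Ioo 0 T)] fun s => w₁ (s, x) := by
    filter_upwards [ae_ae_swap_of_ae_prod hw.1.ae_eq_mk, hw.prod_left_ae] with x h1 h2
    refine ⟨?_, ?_⟩
    · rw [hsec, integrable_indicator_iff measurableSet_Ioo]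
      exact h2.congr h1
    · filter_upwards [h1, ae_restrict_mem measurableSet_Ioo] with s hs hsT
      rw [congrFun (hsec x) s, indicator_of_mem hsT]
      exact hs
  have hΦint : ∀ x, Integrable (fun s => w₁ (s, x)) volume →
      (fun t => Φ (t, x)) = fun t => ∫ s in (0 : ℝ)..t, w₁ (s, x) := by
    intro x hx
    ext t
    simp only [hΦ]
    rw [integral_indicator measurableSet_Iic,
      ← intervalIntegral.integral_Iic_sub_Iic hx.integrableOn hx.integrableOn]
    have : ∫ s in Iic 0, w₁ (s, x) = 0 := by
      refine setIntegral_eq_zero_of_forall_eq_zero fun s hs => ?_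
      rw [congrFun (hsec x) s, indicator_of_notMem fun h => absurd h.1 (not_lt.mpr hs)]
    rw [this, sub_zero]
  -- Differentiability is known for almost every `t` at each good `x`. Lifting this to the product
  -- measure requires a measurable set, so the derivative is expressed by countably many
  -- inequalities over rational increments.
  set A : Set (ℝ × X) := {z | ∀ j : ℕ, ∃ i : ℕ, ∀ r : ℚ, |(r : ℝ)| < 1 / (i + 1) →
    |Φ (z.1 + r, z.2) - Φ (z.1, z.2) - r * w₁ z| ≤ |(r : ℝ)| * (1 / (j + 1))} with hA
  have hAm : MeasurableSet A := by
    simp only [hA, ofPred_forall, ofPred_exists]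
    refine MeasurableSet.iInter fun j => .iUnion fun i => .iInter fun r => .iInter fun _ => ?_
    have h3 := hw₁m.measurable
    exact measurableSet_le (by fun_prop) measurable_const
  have hAae : ∀ᵐ x ∂μ, ∀ᵐ t ∂(volume.restrict (Ioo 0 T)), (t, x) ∈ A := by
    filter_upwards [hsecI] with x hx
    filter_upwards [ae_restrict_of_ae (LocallyIntegrable.ae_hasDerivAt_integral
      hx.1.locallyIntegrable)] with t ht
    have hd := ht 0
    rw [← hΦint x hx.1, hasDerivAt_iff_isLittleO_nhds_zero, Asymptotics.isLittleO_iff] at hd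
    intro j
    have hj : (0 : ℝ) < 1 / (j + 1) := by positivity
    obtain ⟨δ, hδ, hball⟩ := Metric.eventually_nhds_iff.mp (hd hj)
    obtain ⟨i, hi⟩ := exists_nat_one_div_lt hδ
    refine ⟨i, fun r hr => ?_⟩
    have := hball (y := (r : ℝ)) (by rw [Real.dist_eq, sub_zero]; exact hr.trans hi)
    rw [Real.norm_eq_abs, Real.norm_eq_abs, smul_eq_mul] at this
    exact this.trans_eq (mul_comm _ _)
  filter_upwards [ae_ae_mem_of_measurableSet hAm hAae,
    ae_prod_of_ae_snd (κ := volume.restrict (Ioo 0 T)) hsecI,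
    ae_prod_of_ae_fst (μ := μ) (ae_restrict_mem (μ := volume) measurableSet_Ioo), hw.1.ae_eq_mk]
    with z hz hx ht hmk
  have hcont : Continuous fun t => Φ (t, z.2) := by
    rw [hΦint _ hx.1]
    exact intervalIntegral.continuous_primitive (fun a b => hx.1.intervalIntegrable) 0
  have hd := hasDerivAt_of_forall_rat hcont hz
  have hval : w₁ z = w z.1 z.2 := by
    have := congrFun (hsec z.2) z.1
    rw [indicator_of_mem ht] at this
    exact this.trans hmk.symm
  rw [hval] at hd
  refine hd.congr_of_eventuallyEq ?_
  filter_upwards [Ioo_mem_nhds ht.1 ht.2] with τ hτ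
  rw [congrFun (hΦint z.2 hx.1) τ, intervalIntegral.integral_of_le hτ.1.le,
    intervalIntegral.integral_of_le hτ.1.le, integral_Ioc_eq_integral_Ioo,
    integral_Ioc_eq_integral_Ioo]
  exact integral_congr_ae (ae_restrict_Ioo_of_le hx.2 hτ.2.le)

/-- Since `k ∗ h = γ (1 - 1 ∗ h)`, convolving it with `v` gives the primitive of `γ (v - h ∗ v)`.
The identity holds at every `t`, as differentiation requires. -/
theorem IsResolventKernel.conv_conv_eq_integral {k l h : ℝ → ℝ} {γ : ℝ}
    (hh : IsResolventKernel γ l h) (hkl : IsPCPair k l) {v : ℝ → ℝ}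
    (hv : IntegrableOn v (Ioo 0 T)) {t : ℝ} (ht : t ∈ Ioo 0 T) :
    conv (conv k h) v t = ∫ s in (0 : ℝ)..t, γ * (v s - conv h v s) := by
  have hT : 0 ≤ T := ht.1.le.trans ht.2.le
  have hi := hh.integrableOn T
  have hvt : IntegrableOn v (Ioo 0 t) := hv.mono_set (Ioo_subset_Ioo_right ht.2.le)
  have hivt : ∀ {f : ℝ → ℝ}, IntegrableOn f (Ioo 0 T) → IntervalIntegrable f volume 0 t :=
    fun hf => intervalIntegrable_of_integrableOn hf le_rfl ht.1.le hT ht.2.le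
  have hHc : ContinuousOn (fun s => ∫ r in (0 : ℝ)..t - s, h r) (Icc 0 t) := by
    refine (continuousOn_integral ht.1.le (hh.integrableOn t)).comp (by fun_prop) ?_
    exact fun s hs => ⟨by linarith [hs.2], by linarith [hs.1]⟩
  obtain ⟨B, hB⟩ := isCompact_Icc.exists_bound_of_continuousOn hHc
  have hHv : IntegrableOn (fun s => (∫ r in (0 : ℝ)..t - s, h r) • v s) (Ioo 0 t) := by
    refine hvt.bdd_mul (c := B) ((hHc.mono Ioo_subset_Icc_self).aestronglyMeasurable
      measurableSet_Ioo) ?_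
    filter_upwards [ae_restrict_mem measurableSet_Ioo] with s hs
    exact hB s (Ioo_subset_Icc_self hs)
  rw [conv_congr (T := T) ht.1.le ht.2.le (hh.conv_k hkl T) (ae_eq_refl v), conv_mul_left,
    conv_sub_left ht.1.le (by simpa using hvt) hHv, ← integral_conv hi hv ht.1.le ht.2.le,
    conv_one, ← intervalIntegral.integral_sub (hivt hv) (hivt (integrableOn_conv hi hv)),
    intervalIntegral.integral_const_mul, smul_eq_mul]

/-- The time derivative in the regularized weak formulation. -/
theorem IsResolventKernel.ae_deriv_conv_eq {k l h : ℝ → ℝ} {γ : ℝ}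
    (hh : IsResolventKernel γ l h) (hkl : IsPCPair k l) {v : ℝ → X → ℝ}
    (hv : Integrable (fun z : ℝ × X => v z.1 z.2) ((volume.restrict (Ioo 0 T)).prod μ)) :
    ∀ᵐ z ∂((volume.restrict (Ioo 0 T)).prod μ),
      deriv (fun τ => conv (conv k h) (fun s => v s z.2) τ) z.1
        = γ * (v z.1 z.2 - conv h (fun s => v s z.2) z.1) := by
  have hi := hh.integrableOn T
  have hw : Integrable (fun z : ℝ × X => γ * (v z.1 z.2 - conv h (fun s => v s z.2) z.1))
      ((volume.restrict (Ioo 0 T)).prod μ) :=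
    (hv.sub (integrable_conv_prod hi hv)).const_mul γ
  filter_upwards [ae_hasDerivAt_integral_prod (w := fun t x => γ * (v t x - conv h (fun s => v s x) t)) hw,
    ae_prod_of_ae_snd (κ := volume.restrict (Ioo 0 T)) hv.prod_left_ae,
    ae_prod_of_ae_fst (μ := μ) (ae_restrict_mem (μ := volume) measurableSet_Ioo)] with z h1 h2 ht
  refine HasDerivAt.deriv (h1.congr_of_eventuallyEq ?_)
  filter_upwards [Ioo_mem_nhds ht.1 ht.2] with τ hτ
  exact hh.conv_conv_eq_integral hkl h2 hτ

end Cylinder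

/-! ### Removing the regularization, and uniformity in the test function. -/

section WeakFormulation

theorem MemLp.ae_section_of_prod {X Y E : Type*} [MeasurableSpace X] [MeasurableSpace Y]
    {μ : Measure X} {κ : Measure Y} [SFinite μ] [SFinite κ] [NormedAddCommGroup E]
    {f : Y × X → E} (hf : MemLp f 2 (κ.prod μ)) :
    ∀ᵐ y ∂κ, MemLp (fun x => f (y, x)) 2 μ := by
  have h2 : Integrable (fun z => ‖f z‖ ^ 2) (κ.prod μ) := hf.integrable_norm_pow two_ne_zero
  filter_upwards [h2.prod_right_ae, hf.1.prodMk_left] with y h3 h4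
  exact (memLp_two_iff_integrable_sq_norm h4).mpr h3

theorem MemLp.swap {X Y E : Type*} [MeasurableSpace X] [MeasurableSpace Y]
    {μ : Measure X} {κ : Measure Y} [SFinite μ] [SFinite κ] [NormedAddCommGroup E] {p : ℝ≥0∞}
    {f : Y × X → E} (hf : MemLp f p (κ.prod μ)) :
    MemLp (fun z : X × Y => f z.swap) p (μ.prod κ) :=
  hf.comp_measurePreserving Measure.measurePreserving_swap

variable {k l h : ℝ → ℝ} {T γ : ℝ}

theorem integrable_conv_section {X F : Type*} [MeasurableSpace X] {μ : Measure X} [SFinite μ]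
    [NormedAddCommGroup F] [NormedSpace ℝ F] {k : ℝ → ℝ} {v : ℝ → X → F} {t : ℝ} (ht : 0 ≤ t)
    (h : Integrable (fun z : ℝ × X => k (t - z.1) • v z.1 z.2)
      ((volume.restrict (Ioo 0 t)).prod μ)) : Integrable (fun x => conv k (fun s => v s x) t) μ := by
  simp only [conv_eq_integral_Ioo _ _ ht]
  exact h.integral_prod_right

theorem conv_inner {E : Type*} [NormedAddCommGroup E] [InnerProductSpace ℝ E] [CompleteSpace E]
    {g : ℝ → E} {t : ℝ} (ht : 0 ≤ t) (hg : IntegrableOn (fun s => k (t - s) • g s) (Ioo 0 t))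
    (c : E) : conv k (fun s => inner ℝ (g s) c) t = inner ℝ (conv k g t) c := by
  rw [conv_eq_integral_Ioo _ _ ht, conv_eq_integral_Ioo _ _ ht, real_inner_comm,
    ← integral_inner (𝕜 := ℝ) hg c]
  refine integral_congr_ae (.of_forall fun s => ?_)
  simp only [inner_smul_right, smul_eq_mul]
  rw [real_inner_comm]

/-- Removing the regularization from a scalar evolutionary inequality. -/
theorem IsPCPair.ae_add_conv_nonpos (hkl : IsPCPair k l) {V A : ℝ → ℝ}
    (hV : IntegrableOn V (Ioo 0 T)) (hA : IntegrableOn A (Ioo 0 T))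
    (hle : ∀ n : ℕ, 0 < n → ∀ h, IsResolventKernel n l h →
      ∀ᵐ t ∂(volume.restrict (Ioo 0 T)), n * (V t - conv h V t) + conv h A t ≤ 0) :
    ∀ᵐ t ∂(volume.restrict (Ioo 0 T)), V t + conv l A t ≤ 0 := by
  choose h hh using fun n : ℕ => exists_isResolventKernel hkl.locInt_l (n : ℝ)
  have hl := hkl.integrableOn_l T
  have hlA := integrableOn_conv hl hA
  refine ae_nonpos_of_conv_resolvent_nonpos hkl (hV.add hlA) (fun n _ => hh n) fun n hn => ?_
  have hi := (hh n).integrableOn T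
  have hhV := integrableOn_conv hi hV
  have hhA := integrableOn_conv hi hA
  have hswap : ∀ {W : ℝ → ℝ}, IntegrableOn W (Ioo 0 T) → ∀ᵐ t ∂(volume.restrict (Ioo 0 T)),
      conv l (conv (h n) W) t = conv (h n) (conv l W) t := by
    intro W hW
    filter_upwards [conv_assoc_ae hl hi hW, conv_assoc_ae hi hl hW] with t h1 h2
    rw [h1, h2, funext (conv_comm l (h n))]
  have hd : IntegrableOn (fun t => n * (V t - conv (h n) V t)) (Ioo 0 T) :=
    (hV.sub hhV).const_mul _
  filter_upwards [(hh n).conv_eq hkl hV, hswap hV, hswap hA, ae_integrableOn_conv_integrand hl hV,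
    ae_integrableOn_conv_integrand hl hhV, ae_integrableOn_conv_integrand hl hd,
    ae_integrableOn_conv_integrand hl hhA, ae_integrableOn_conv_integrand hi hV,
    ae_integrableOn_conv_integrand hi hlA, ae_restrict_mem measurableSet_Ioo]
    with t h1 h2 h3 h4 h5 h6 h7 h8 h9 htT
  -- Convolution with `l ≥ 0` keeps the inequality. As `n (l ∗ V - h_n ∗ (l ∗ V)) = h_n ∗ V`, the
  -- result is `h_n ∗ (V + l ∗ A) ≤ 0`.
  have h10 : 0 ≤ conv l (fun t => -(n * (V t - conv (h n) V t) + conv (h n) A t)) t := by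
    refine conv_nonneg htT.1.le htT.2.le (hkl.ae_nonneg_l T) ?_
    filter_upwards [hle n hn (h n) (hh n)] with s hs
    linarith
  have h11 : conv l (fun t => -(n * (V t - conv (h n) V t) + conv (h n) A t)) t
      = -(conv l (fun t => n * (V t - conv (h n) V t)) t + conv l (conv (h n) A) t) := by
    rw [← conv_add_right htT.1.le h6 h7]
    simp only [conv, smul_neg, intervalIntegral.integral_neg]
  have h12 : conv l (fun t => n * (V t - conv (h n) V t)) t
      = n * (conv l V t - conv l (conv (h n) V) t) := by
    rw [← conv_sub_right htT.1.le h4 h5]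
    exact conv_smul_right l (n : ℝ) _ t
  have h13 : conv (h n) (fun t => V t + conv l A t) t = conv (h n) V t + conv (h n) (conv l A) t :=
    conv_add_right htT.1.le h8 h9
  rw [h11, h12, h2, h3] at h10
  rw [smul_eq_mul] at h1
  rw [h13, h1]
  linarith

variable {N : ℕ} {Ω : Set (Space N)} {bc : BoundaryCondition} {u₀ : Space N → ℝ}
  {f u : ℝ → Space N → ℝ} {G : ℝ → Space N → Space N}

theorem MemEnergySpace.memH1 {ψ : Space N → ℝ} {g : Space N → Space N}
    (hψ : MemEnergySpace bc Ω ψ g) : MemH1 Ω ψ g := by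
  cases bc
  · exact MemH10.memH1 hψ
  · exact hψ

theorem MemH1.congr {ψ ψ' : Space N → ℝ} {g g' : Space N → Space N} (h : MemH1 Ω ψ g)
    (hψ : ψ =ᵐ[volume.restrict Ω] ψ') (hg : g =ᵐ[volume.restrict Ω] g') : MemH1 Ω ψ' g' where
  memLp := h.memLp.ae_eq hψ
  memLp_grad := h.memLp_grad.ae_eq hg
  weakGrad φ hφ i := by
    have e1 : ∫ x in Ω, ψ x * gradient φ x i = ∫ x in Ω, ψ' x * gradient φ x i :=
      integral_congr_ae (hψ.mono fun x hx => by simp only [hx])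
    have e2 : ∫ x in Ω, g x i * φ x = ∫ x in Ω, g' x i * φ x :=
      integral_congr_ae (hg.mono fun x hx => by simp only [hx])
    rw [← e1, ← e2]
    exact h.weakGrad φ hφ i

/-- Test functions are genuine functions; this permits passage to and from classes in `L_2`, where
the density argument takes place. -/
theorem MemEnergySpace.congr {ψ ψ' : Space N → ℝ} {g g' : Space N → Space N}
    (h : MemEnergySpace bc Ω ψ g) (hψ : ψ =ᵐ[volume.restrict Ω] ψ')
    (hg : g =ᵐ[volume.restrict Ω] g') : MemEnergySpace bc Ω ψ' g' := by
  cases bc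
  · have h' : MemH10 Ω ψ g := h
    refine (⟨h'.memH1.congr hψ hg, fun ε hε => ?_⟩ : MemH10 Ω ψ' g')
    obtain ⟨φ, h1, h2, h3⟩ := h'.approx ε hε
    refine ⟨φ, h1, ?_, ?_⟩
    · rwa [← eLpNorm_congr_ae (hψ.mono fun x hx => by
        show φ x - ψ x = φ x - ψ' x; rw [hx])]
    · rwa [← eLpNorm_congr_ae (hg.mono fun x hx => by
        show gradient φ x - g x = gradient φ x - g' x; rw [hx])]
  · exact MemH1.congr h hψ hg

theorem integrable_mul_of_memLp_two {α : Type*} [MeasurableSpace α] {μ : Measure α} {f g : α → ℝ}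
    (hf : MemLp f 2 μ) (hg : MemLp g 2 μ) : Integrable (fun a => f a * g a) μ :=
  hf.integrable_mul hg

theorem cylMeasure_eq_prod (T : ℝ) (Ω : Set (Space N)) :
    cylMeasure T Ω = (volume.restrict (Ioo 0 T)).prod (volume.restrict Ω) := by
  rw [cylMeasure, Measure.prod_restrict, Measure.volume_eq_prod]

/-- The weak inequality integrated against a fixed test function, without the time derivative. -/
theorem WeakInequality.ae_scalar_le (hweak : WeakInequality bc T Ω k l u₀ f u G)
    (hkl : IsPCPair k l) [IsFiniteMeasure (volume.restrict Ω)]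
    (hv : MemLp (fun z : ℝ × Space N => u z.1 z.2 - u₀ z.2) 2
      ((volume.restrict (Ioo 0 T)).prod (volume.restrict Ω)))
    (hf : MemLp (fun z : ℝ × Space N => f z.1 z.2) 2
      ((volume.restrict (Ioo 0 T)).prod (volume.restrict Ω)))
    (hG : MemLp (fun z : ℝ × Space N => G z.1 z.2) 2
      ((volume.restrict (Ioo 0 T)).prod (volume.restrict Ω)))
    {ψ : Space N → ℝ} {g : Space N → Space N} (hψ : MemEnergySpace bc Ω ψ g)
    (hψ0 : ∀ᵐ x ∂(volume.restrict Ω), 0 ≤ ψ x) :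
    ∀ᵐ t ∂(volume.restrict (Ioo 0 T)),
      ∫ x in Ω, (ψ x * (u t x - u₀ x) + inner ℝ (conv l (fun s => G s x) t) (g x)
        - conv l (fun s => f s x) t * ψ x) ≤ 0 := by
  have hψ2 : MemLp (fun z : ℝ × Space N => ψ z.2) 2
      ((volume.restrict (Ioo 0 T)).prod (volume.restrict Ω)) := hψ.memH1.memLp.comp_snd _
  have hg2 : MemLp (fun z : ℝ × Space N => g z.2) 2
      ((volume.restrict (Ioo 0 T)).prod (volume.restrict Ω)) := hψ.memH1.memLp_grad.comp_snd _
  have hψv := integrable_mul_of_memLp_two hψ2 hv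
  have hψf := integrable_mul_of_memLp_two hψ2 hf
  have hGg := integrable_inner_of_memLp hG hg2
  have hGi : Integrable (fun z : ℝ × Space N => G z.1 z.2)
      ((volume.restrict (Ioo 0 T)).prod (volume.restrict Ω)) := hG.integrable one_le_two
  have hvi := hv.integrable one_le_two
  set V : ℝ → ℝ := fun s => ∫ x in Ω, ψ x * (u s x - u₀ x) with hVdef
  set A : ℝ → ℝ := fun s => (∫ x in Ω, inner ℝ (G s x) (g x)) - ∫ x in Ω, ψ x * f s x with hAdef
  have hV : IntegrableOn V (Ioo 0 T) := hψv.integral_prod_left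
  have hA1 : IntegrableOn (fun s => ∫ x in Ω, (inner ℝ (G s x) (g x) : ℝ)) (Ioo 0 T) :=
    hGg.integral_prod_left
  have hA2 : IntegrableOn (fun s => ∫ x in Ω, ψ x * f s x) (Ioo 0 T) := hψf.integral_prod_left
  have hA : IntegrableOn A (Ioo 0 T) := hA1.sub hA2
  -- The kernel is left general because the exchange of space integral and convolution is needed for
  -- `h_n` as well as for `l`.
  have hspace : ∀ {p : ℝ → ℝ}, IntegrableOn p (Ioo 0 T) →
      ∀ᵐ t ∂(volume.restrict (Ioo 0 T)),
        Integrable (fun x => inner ℝ (conv p (fun s => G s x) t) (g x)) (volume.restrict Ω) ∧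
        Integrable (fun x => conv p (fun s => f s x) t * ψ x) (volume.restrict Ω) ∧
        conv p A t = (∫ x in Ω, inner ℝ (conv p (fun s => G s x) t) (g x))
          - ∫ x in Ω, conv p (fun s => f s x) t * ψ x := by
    intro p hp
    filter_upwards [ae_integrable_conv_integrand_prod hp hGi,
      ae_integrable_conv_integrand_prod (v := fun s x => (inner ℝ (G s x) (g x) : ℝ)) hp hGg,
      ae_integrable_conv_integrand_prod (v := fun s x => ψ x * f s x) hp hψf,
      ae_integrableOn_conv_integrand hp hA1, ae_integrableOn_conv_integrand hp hA2,
      ae_restrict_mem measurableSet_Ioo] with t h1 h2 h3 h4 h5 htT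
    have e1 : (fun x => conv p (fun s => (inner ℝ (G s x) (g x) : ℝ)) t)
        =ᵐ[volume.restrict Ω] fun x => inner ℝ (conv p (fun s => G s x) t) (g x) := by
      filter_upwards [h1.prod_left_ae] with x hx
      exact conv_inner htT.1.le hx (g x)
    have e2 : (fun x => conv p (fun s => ψ x * f s x) t)
        = fun x => conv p (fun s => f s x) t * ψ x := by
      ext x
      rw [mul_comm]
      exact conv_smul_right p (ψ x) (fun s => f s x) t
    refine ⟨(integrable_conv_section htT.1.le h2).congr e1, ?_, ?_⟩
    · rw [← e2]
      exact integrable_conv_section htT.1.le h3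
    · rw [← integral_congr_ae e1, ← e2, ← conv_integral_eq_integral_conv htT.1.le h2,
        ← conv_integral_eq_integral_conv htT.1.le h3, ← conv_sub_right htT.1.le h4 h5]
  have hkey : ∀ᵐ t ∂(volume.restrict (Ioo 0 T)), V t + conv l A t ≤ 0 := by
    refine hkl.ae_add_conv_nonpos hV hA fun n hn h hh => ?_
    have hi := hh.integrableOn T
    filter_upwards [hweak n hn h hh ψ g hψ hψ0, hspace hi,
      Measure.ae_ae_of_ae_prod (hh.ae_deriv_conv_eq hkl (v := fun s x => u s x - u₀ x) hvi),
      ae_integrable_conv_integrand_prod (v := fun s x => ψ x * (u s x - u₀ x)) hi hψv,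
      hψv.prod_right_ae, ae_restrict_mem measurableSet_Ioo] with t h1 ⟨h2, h3, h4⟩ h5 h6 h7 htT
    have hc := integrable_conv_section (k := h) (v := fun s x => ψ x * (u s x - u₀ x)) htT.1.le h6
    have e1 : ∫ x in Ω, (ψ x * deriv (fun τ => conv (conv k h) (fun s => u s x - u₀ x) τ) t
        + inner ℝ (conv h (fun s => G s x) t) (g x))
        = (n * (V t - conv h V t)) + ∫ x in Ω, inner ℝ (conv h (fun s => G s x) t) (g x) := by
      have e2 : ∫ x in Ω, (n * (ψ x * (u t x - u₀ x)
          - conv h (fun s => ψ x * (u s x - u₀ x)) t)) = n * (V t - conv h V t) := by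
        rw [integral_const_mul, integral_sub h7 hc, ← conv_integral_eq_integral_conv htT.1.le h6]
      have h8 : Integrable (fun x => n * (ψ x * (u t x - u₀ x)
          - conv h (fun s => ψ x * (u s x - u₀ x)) t)) (volume.restrict Ω) :=
        (h7.sub hc).const_mul _
      rw [← e2, ← integral_add h8 h2]
      refine integral_congr_ae ?_
      filter_upwards [h5] with x hx
      have e3 : conv h (fun s => ψ x * (u s x - u₀ x)) t
          = ψ x * conv h (fun s => u s x - u₀ x) t := conv_smul_right h (ψ x) _ t
      rw [e3, hx]
      ring
    rw [e1] at h1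
    rw [h4]
    linarith
  filter_upwards [hkey, hspace (hkl.integrableOn_l T), hψv.prod_right_ae] with t h1 ⟨h2, h3, h4⟩ h5
  have h52 : Integrable (fun x => ψ x * (u t x - u₀ x)
      + inner ℝ (conv l (fun s => G s x) t) (g x)) (volume.restrict Ω) := h5.add h2
  rw [integral_sub h52 h3, integral_add h5 h2]
  rw [h4] at h1
  simp only [hVdef] at h1
  linarith

/-- The set of nonnegative elements of the energy space, as a subset of `L_2 × L_2`. -/
def nonnegEnergySet (bc : BoundaryCondition) (Ω : Set (Space N)) :
    Set (Lp ℝ 2 (volume.restrict Ω) × Lp (Space N) 2 (volume.restrict Ω)) :=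
  {p | MemEnergySpace bc Ω p.1 p.2 ∧ ∀ᵐ x ∂(volume.restrict Ω), 0 ≤ (p.1 : Space N → ℝ) x}

/-- The weak inequality holds, for almost every time, for all test functions simultaneously. -/
theorem WeakInequality.ae_forall_le (hweak : WeakInequality bc T Ω k l u₀ f u G)
    (hkl : IsPCPair k l) [IsFiniteMeasure (volume.restrict Ω)]
    (hv : MemLp (fun z : ℝ × Space N => u z.1 z.2 - u₀ z.2) 2
      ((volume.restrict (Ioo 0 T)).prod (volume.restrict Ω)))
    (hf : MemLp (fun z : ℝ × Space N => f z.1 z.2) 2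
      ((volume.restrict (Ioo 0 T)).prod (volume.restrict Ω)))
    (hG : MemLp (fun z : ℝ × Space N => G z.1 z.2) 2
      ((volume.restrict (Ioo 0 T)).prod (volume.restrict Ω))) :
    ∀ᵐ t ∂(volume.restrict (Ioo 0 T)), ∀ (ψ : Space N → ℝ) (g : Space N → Space N),
      MemEnergySpace bc Ω ψ g → (∀ᵐ x ∂(volume.restrict Ω), 0 ≤ ψ x) →
      ∫ x in Ω, (ψ x * (u t x - u₀ x) + inner ℝ (conv l (fun s => G s x) t) (g x)
        - conv l (fun s => f s x) t * ψ x) ≤ 0 := by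
  have hl := hkl.integrableOn_l T
  have : Fact ((2 : ℝ≥0∞) ≠ ⊤) := ⟨ENNReal.ofNat_ne_top⟩
  have : SecondCountableTopology (Lp ℝ 2 (volume.restrict Ω)) := Lp.SecondCountableTopology
  have : SecondCountableTopology (Lp (Space N) 2 (volume.restrict Ω)) :=
    Lp.SecondCountableTopology
  -- The null set of bad times depends on the test function. The countable dense family is taken
  -- inside the set of nonnegative elements, so each member is admissible.
  obtain ⟨c, hcS, hc, hSc⟩ := (TopologicalSpace.IsSeparable.of_separableSpace
    (nonnegEnergySet bc Ω)).exists_countable_dense_subset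
  have hall : ∀ᵐ t ∂(volume.restrict (Ioo 0 T)), ∀ p ∈ c,
      ∫ x in Ω, ((p.1 : Space N → ℝ) x * (u t x - u₀ x)
        + inner ℝ (conv l (fun s => G s x) t) ((p.2 : Space N → Space N) x)
        - conv l (fun s => f s x) t * (p.1 : Space N → ℝ) x) ≤ 0 := by
    rw [ae_ball_iff hc]
    exact fun p hp => hweak.ae_scalar_le hkl hv hf hG (hcS hp).1 (hcS hp).2
  filter_upwards [hall, MemLp.ae_section_of_prod hv,
    MemLp.ae_section_of_prod (memLp_two_conv_prod hl hf),
    MemLp.ae_section_of_prod (memLp_two_conv_prod hl hG)] with t h1 h2 h3 h4 ψ g hψ hψ0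
  -- At a fixed good time the left side is a continuous linear functional of `(ψ, g)` in `L_2 ×
  -- L_2`, so the inequality passes to the closure.
  have hform : ∀ (ψ : Space N → ℝ) (g : Space N → Space N) (p : Lp ℝ 2 (volume.restrict Ω) ×
      Lp (Space N) 2 (volume.restrict Ω)), (p.1 : Space N → ℝ) =ᵐ[volume.restrict Ω] ψ →
      (p.2 : Space N → Space N) =ᵐ[volume.restrict Ω] g →
      ∫ x in Ω, (ψ x * (u t x - u₀ x) + inner ℝ (conv l (fun s => G s x) t) (g x)
        - conv l (fun s => f s x) t * ψ x)
      = inner ℝ (h2.toLp _) p.1 + inner ℝ (h4.toLp _) p.2 - inner ℝ (h3.toLp _) p.1 := by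
    intro ψ g p hp1 hp2
    simp only [L2.inner_def]
    rw [← integral_add (L2.integrable_inner _ _) (L2.integrable_inner _ _),
      ← integral_sub ((L2.integrable_inner _ _).add (L2.integrable_inner _ _))
        (L2.integrable_inner _ _)]
    refine integral_congr_ae ?_
    filter_upwards [h2.coeFn_toLp, h3.coeFn_toLp, h4.coeFn_toLp, hp1, hp2] with x e2 e3 e4 e5 e6
    rw [e2, e3, e4, e5, e6]
    simp only [RCLike.inner_apply, conj_trivial]
    ring
  set p : Lp ℝ 2 (volume.restrict Ω) × Lp (Space N) 2 (volume.restrict Ω) :=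
    (hψ.memH1.memLp.toLp ψ, hψ.memH1.memLp_grad.toLp g) with hp
  have hpS : p ∈ nonnegEnergySet bc Ω := by
    refine ⟨hψ.congr hψ.memH1.memLp.coeFn_toLp.symm hψ.memH1.memLp_grad.coeFn_toLp.symm, ?_⟩
    filter_upwards [hψ0, hψ.memH1.memLp.coeFn_toLp] with x hx hx2
    rw [hp, hx2]
    exact hx
  have hclosed : IsClosed {p : Lp ℝ 2 (volume.restrict Ω) × Lp (Space N) 2 (volume.restrict Ω) |
      (inner ℝ (h2.toLp _) p.1 + inner ℝ (h4.toLp _) p.2 - inner ℝ (h3.toLp _) p.1 : ℝ) ≤ 0} :=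
    isClosed_le (by fun_prop) continuous_const
  rw [hform ψ g p hψ.memH1.memLp.coeFn_toLp hψ.memH1.memLp_grad.coeFn_toLp]
  refine closure_minimal (fun q hq => ?_) hclosed (hSc hpS)
  have := h1 q hq
  rwa [hform _ _ q (ae_eq_refl _) (ae_eq_refl _)] at this

end WeakFormulation

/-! ### The energy estimate on the cylinder. -/

section EnergyCylinder

variable {X : Type*} [MeasurableSpace X] {μ : Measure X} [SFinite μ] {T : ℝ} {k l : ℝ → ℝ}
  {E : Type*} [NormedAddCommGroup E] [InnerProductSpace ℝ E]

theorem aestronglyMeasurable_dualConv_prod {G : ℝ → X → E}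
    (hl : AEStronglyMeasurable l (volume.restrict (Ioo 0 T)))
    (hG : AEStronglyMeasurable (fun z : ℝ × X => G z.1 z.2)
      ((volume.restrict (Ioo 0 T)).prod μ)) :
    AEStronglyMeasurable (fun z : ℝ × X => dualConv T l (fun τ => G τ z.2) z.1)
      ((volume.restrict (Ioo 0 T)).prod μ) := by
  have hR : MeasurePreserving (Prod.map (fun t => T - t) (id : X → X))
      ((volume.restrict (Ioo 0 T)).prod μ) ((volume.restrict (Ioo 0 T)).prod μ) :=
    (measurePreserving_const_sub T).prod (MeasurePreserving.id μ)
  have h1 : AEStronglyMeasurable (fun z : ℝ × X => G (T - z.1) z.2)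
      ((volume.restrict (Ioo 0 T)).prod μ) := hG.comp_measurePreserving hR
  have h2 := (aestronglyMeasurable_conv_prod (v := fun s x => G (T - s) x) hl
    h1).comp_measurePreserving hR
  simp only [dualConv_eq_conv]
  exact h2

/-- The energy estimate for the dual convolution on the cylinder. -/
theorem IsPCPair.integral_dual_energy_prod_le [CompleteSpace E] (hkl : IsPCPair k l) (hT : 0 < T)
    {G : ℝ → X → E}
    (hG : MemLp (fun z : ℝ × X => G z.1 z.2) 2 ((volume.restrict (Ioo 0 T)).prod μ)) :
    Integrable (fun z : ℝ × X => (k (T - z.1) + k z.1) *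
        ‖dualConv T l (fun τ => G τ z.2) z.1‖ ^ 2) ((volume.restrict (Ioo 0 T)).prod μ) ∧
      ∫ z, (k (T - z.1) + k z.1) * ‖dualConv T l (fun τ => G τ z.2) z.1‖ ^ 2
          ∂((volume.restrict (Ioo 0 T)).prod μ)
        ≤ 2 * ∫ z, inner ℝ (conv l (fun s => G s z.2) z.1) (G z.1 z.2)
          ∂((volume.restrict (Ioo 0 T)).prod μ) := by
  have hl := hkl.integrableOn_l T
  have hk := (hkl.integrableOn_k T).aestronglyMeasurable
  have hD := aestronglyMeasurable_dualConv_prod (μ := μ) hl.aestronglyMeasurable hG.1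
  have hm : AEStronglyMeasurable (fun z : ℝ × X => (k (T - z.1) + k z.1) *
      ‖dualConv T l (fun τ => G τ z.2) z.1‖ ^ 2) ((volume.restrict (Ioo 0 T)).prod μ) :=
    (((hk.comp_measurePreserving (measurePreserving_const_sub T)).add hk).comp_fst).mul
      (hD.norm.pow 2)
  have hI := integrable_inner_of_memLp (memLp_two_conv_prod hl hG) hG
  have hsec : ∀ᵐ x ∂μ, MemLp (fun t => G t x) 2 (volume.restrict (Ioo 0 T)) :=
    MemLp.ae_section_of_prod (MemLp.swap hG)
  have hJ : Integrable (fun x => ∫ t in Ioo 0 T, inner ℝ (conv l (fun s => G s x) t) (G t x)) μ :=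
    hI.integral_prod_right
  -- The bound is first proved for the lower Lebesgue integral, slice by slice in `x`, because
  -- integrability of the weighted square is part of the claim.
  have hle : ∫⁻ z, ENNReal.ofReal ((k (T - z.1) + k z.1) *
      ‖dualConv T l (fun τ => G τ z.2) z.1‖ ^ 2) ∂((volume.restrict (Ioo 0 T)).prod μ)
      ≤ ENNReal.ofReal (2 * ∫ z, inner ℝ (conv l (fun s => G s z.2) z.1) (G z.1 z.2)
        ∂((volume.restrict (Ioo 0 T)).prod μ)) := by
    rw [lintegral_prod_symm _ hm.aemeasurable.ennreal_ofReal, integral_prod_symm _ hI,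
      ← integral_const_mul, ofReal_integral_eq_lintegral_ofReal (hJ.const_mul 2)]
    · refine lintegral_mono_ae ?_
      filter_upwards [hsec] with x hx
      exact hkl.lintegral_dual_energy_le hT hx
    · filter_upwards [hsec] with x hx
      exact mul_nonneg zero_le_two (hkl.integral_inner_conv_nonneg hT hx)
  have hpos : ∀ᵐ z ∂((volume.restrict (Ioo 0 T)).prod μ), 0 ≤ (k (T - z.1) + k z.1) *
      ‖dualConv T l (fun τ => G τ z.2) z.1‖ ^ 2 := by
    filter_upwards [ae_prod_of_ae_fst (μ := μ) (ae_restrict_mem (μ := volume)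
      (measurableSet_Ioo (a := 0) (b := T)))] with z hz
    exact mul_nonneg (add_nonneg (hkl.nonneg_k _ (sub_pos.mpr hz.2)) (hkl.nonneg_k _ hz.1))
      (sq_nonneg _)
  have hnonneg : 0 ≤ ∫ z, inner ℝ (conv l (fun s => G s z.2) z.1) (G z.1 z.2)
      ∂((volume.restrict (Ioo 0 T)).prod μ) := by
    rw [integral_prod_symm _ hI]
    refine integral_nonneg_of_ae ?_
    filter_upwards [hsec] with x hx
    exact hkl.integral_inner_conv_nonneg hT hx
  refine ⟨⟨hm, (hasFiniteIntegral_iff_ofReal hpos).mpr (hle.trans_lt ENNReal.ofReal_lt_top)⟩, ?_⟩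
  rw [integral_eq_lintegral_of_nonneg_ae hpos hm]
  exact ENNReal.toReal_le_of_le_ofReal (by positivity) hle

end EnergyCylinder

/-! ### Young's inequality with explicit constants. -/

section Absorption

/-- Weighted arithmetic-geometric mean with weights `m/(m+1)` and `1/(m+1)`, the factors normalized
so that `y ^ (m + 1)` has coefficient one. The constant is optimal, attained at `y = d m/(m+1)`. -/
theorem mul_rpow_le_rpow_add {m y d : ℝ} (hm : 0 < m) (hy : 0 ≤ y) (hd : 0 ≤ d) :
    d * y ^ m ≤ y ^ (m + 1) + m ^ m / (m + 1) ^ (m + 1) * d ^ (m + 1) := by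
  have hm1 : 0 < m + 1 := by linarith
  have h := Real.geom_mean_le_arith_mean2_weighted (w₁ := m / (m + 1)) (w₂ := 1 / (m + 1))
    (p₁ := (m + 1) / m * y ^ (m + 1)) (p₂ := (m / (m + 1)) ^ m * d ^ (m + 1))
    (by positivity) (by positivity) (by positivity) (by positivity) (by field_simp)
  have e1 : ((m + 1) / m * y ^ (m + 1)) ^ (m / (m + 1))
      = ((m / (m + 1)) ^ (m / (m + 1)))⁻¹ * y ^ m := by
    rw [Real.mul_rpow (by positivity) (by positivity), ← Real.rpow_mul hy,
      mul_div_cancel₀ m hm1.ne', ← Real.inv_rpow (by positivity), inv_div]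
  have e2 : ((m / (m + 1)) ^ m * d ^ (m + 1)) ^ (1 / (m + 1))
      = (m / (m + 1)) ^ (m / (m + 1)) * d := by
    rw [Real.mul_rpow (by positivity) (by positivity), ← Real.rpow_mul hd,
      mul_one_div_cancel hm1.ne', Real.rpow_one, ← Real.rpow_mul (by positivity), mul_one_div]
  have h0 : (m / (m + 1)) ^ (m / (m + 1)) ≠ 0 := (Real.rpow_pos_of_pos (by positivity) _).ne'
  rw [e1, e2] at h
  have e3 : ((m / (m + 1)) ^ (m / (m + 1)))⁻¹ * y ^ m * ((m / (m + 1)) ^ (m / (m + 1)) * d)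
      = d * y ^ m := by field_simp
  have e4 : m / (m + 1) * ((m + 1) / m * y ^ (m + 1)) = y ^ (m + 1) := by field_simp
  have e5 : 1 / (m + 1) * ((m / (m + 1)) ^ m * d ^ (m + 1))
      = m ^ m / (m + 1) ^ (m + 1) * d ^ (m + 1) := by
    rw [Real.div_rpow hm.le hm1.le, Real.rpow_add_one hm1.ne']
    field_simp
  rwa [e3, e4, e5] at h

theorem add_rpow_le_two_rpow_mul {b c m : ℝ} (hm : 0 ≤ m) (hb : 0 ≤ b) (hc : 0 ≤ c) :
    (b + c) ^ (m + 1) ≤ 2 ^ m * (b ^ (m + 1) + c ^ (m + 1)) := by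
  have h := NNReal.rpow_add_le_mul_rpow_add_rpow ⟨b, hb⟩ ⟨c, hc⟩ (p := m + 1) (by linarith)
  rw [add_sub_cancel_right] at h
  exact_mod_cast h

/-- Source of `C(m)`: the factor `2` contributes `2^{m+1}`, convexity of the power contributes
`2^m`, and `2^{m+1} 2^m m^m = 2 (4m)^m`. -/
theorem two_mul_rpow_mul_add_le {m y r b c : ℝ} (hm : 0 < m) (hy : 0 ≤ y) (hr : 0 ≤ r)
    (hb : 0 ≤ b) (hc : 0 ≤ c) :
    2 * r * (b + c) * y ^ m ≤ y ^ (m + 1)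
      + 2 * (4 * m) ^ m / (m + 1) ^ (m + 1) * r ^ (m + 1) * (b ^ (m + 1) + c ^ (m + 1)) := by
  have hm1 : 0 < m + 1 := by linarith
  refine (mul_rpow_le_rpow_add hm hy (by positivity : 0 ≤ 2 * r * (b + c))).trans ?_
  have h4 : (4 : ℝ) ^ m = 2 ^ m * 2 ^ m := by
    rw [← Real.mul_rpow zero_le_two zero_le_two]
    norm_num
  have e : m ^ m / (m + 1) ^ (m + 1) * (2 * r * (b + c)) ^ (m + 1)
      = 2 * (2 ^ m * m ^ m) / (m + 1) ^ (m + 1) * r ^ (m + 1) * (b + c) ^ (m + 1) := by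
    rw [Real.mul_rpow (by positivity) (by positivity), Real.mul_rpow zero_le_two hr,
      Real.rpow_add_one (two_ne_zero' ℝ)]
    ring
  rw [e, Real.mul_rpow (by norm_num : (0 : ℝ) ≤ 4) hm.le, h4]
  have h := mul_le_mul_of_nonneg_left (add_rpow_le_two_rpow_mul hm.le hb hc)
    (by positivity : 0 ≤ 2 * (2 ^ m * m ^ m) / (m + 1) ^ (m + 1) * r ^ (m + 1))
  have e2 : 2 * (2 ^ m * m ^ m) / (m + 1) ^ (m + 1) * r ^ (m + 1)
        * (2 ^ m * (b ^ (m + 1) + c ^ (m + 1)))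
      = 2 * (2 ^ m * 2 ^ m * m ^ m) / (m + 1) ^ (m + 1) * r ^ (m + 1)
        * (b ^ (m + 1) + c ^ (m + 1)) := by ring
  linarith

end Absorption

/-! ### Testing with the solution. -/

section Estimate

/-- The convolution inequality for `L_q` norms on the cylinder, in terms of real integrals. -/
theorem integral_norm_conv_prod_rpow_le {X F : Type*} [MeasurableSpace X] {μ : Measure X}
    [SFinite μ] [NormedAddCommGroup F] [NormedSpace ℝ F] {T q : ℝ} (hq : 1 ≤ q) {l : ℝ → ℝ}
    {v : ℝ → X → F} (hl : IntegrableOn l (Ioo 0 T))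
    (hv : MemLp (fun z : ℝ × X => v z.1 z.2) (ENNReal.ofReal q)
      ((volume.restrict (Ioo 0 T)).prod μ)) :
    ∫ z, ‖conv l (fun s => v s z.2) z.1‖ ^ q ∂((volume.restrict (Ioo 0 T)).prod μ)
      ≤ (∫ t in Ioo 0 T, ‖l t‖) ^ q
        * ∫ z, ‖v z.1 z.2‖ ^ q ∂((volume.restrict (Ioo 0 T)).prod μ) := by
  have hq0 : 0 < q := by linarith
  have hint : ∀ {w : ℝ × X → F}, MemLp w (ENNReal.ofReal q) ((volume.restrict (Ioo 0 T)).prod μ) →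
      Integrable (fun z => ‖w z‖ ^ q) ((volume.restrict (Ioo 0 T)).prod μ) := by
    intro w hw
    have := hw.integrable_norm_rpow (by simpa using hq0) ENNReal.ofReal_ne_top
    rwa [ENNReal.toReal_ofReal hq0.le] at this
  have hof : ∀ {w : ℝ × X → F}, MemLp w (ENNReal.ofReal q) ((volume.restrict (Ioo 0 T)).prod μ) →
      ENNReal.ofReal (∫ z, ‖w z‖ ^ q ∂((volume.restrict (Ioo 0 T)).prod μ))
        = ∫⁻ z, ‖w z‖ₑ ^ q ∂((volume.restrict (Ioo 0 T)).prod μ) := by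
    intro w hw
    rw [ofReal_integral_eq_lintegral_ofReal (hint hw) (.of_forall fun z => by positivity)]
    refine lintegral_congr fun z => ?_
    rw [← ENNReal.ofReal_rpow_of_nonneg (norm_nonneg _) hq0.le, ofReal_norm]
  have h := lintegral_enorm_conv_prod_rpow_le hq hl.aestronglyMeasurable hv.1
  have hl' : ∫⁻ t in Ioo 0 T, ‖l t‖ₑ = ENNReal.ofReal (∫ t in Ioo 0 T, ‖l t‖) :=
    (ofReal_integral_norm_eq_lintegral_enorm hl).symm
  have hl0 : 0 ≤ ∫ t in Ioo 0 T, ‖l t‖ := integral_nonneg fun t => norm_nonneg _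
  rw [← hof (memLp_conv_prod hq hl hv), ← hof hv, hl', ENNReal.ofReal_rpow_of_nonneg hl0 hq0.le,
    ← ENNReal.ofReal_mul (by positivity)] at h
  refine (ENNReal.ofReal_le_ofReal_iff (mul_nonneg (by positivity) ?_)).mp h
  exact integral_nonneg fun z => by positivity

/-- The weak inequality tested with the solution itself and integrated over the cylinder. -/
theorem WeakInequality.integral_le {N : ℕ} {Ω : Set (Space N)} {bc : BoundaryCondition} {T : ℝ}
    {k l : ℝ → ℝ} {u₀ : Space N → ℝ} {f u w : ℝ → Space N → ℝ} {G : ℝ → Space N → Space N}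
    (hweak : WeakInequality bc T Ω k l u₀ f u G) (hkl : IsPCPair k l)
    [IsFiniteMeasure (volume.restrict Ω)] (hw : MemL2EnergySpace bc T Ω w G)
    (hw0 : ∀ᵐ z ∂(cylMeasure T Ω), 0 ≤ w z.1 z.2)
    (hv : MemLp (fun z : ℝ × Space N => u z.1 z.2 - u₀ z.2) 2 (cylMeasure T Ω))
    (hf : MemLp (fun z : ℝ × Space N => f z.1 z.2) 2 (cylMeasure T Ω)) :
    Integrable (fun z : ℝ × Space N => w z.1 z.2 *
        (u z.1 z.2 - u₀ z.2 - conv l (fun s => f s z.2) z.1)) (cylMeasure T Ω) ∧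
      ∫ z, w z.1 z.2 * (u z.1 z.2 - u₀ z.2 - conv l (fun s => f s z.2) z.1) ∂(cylMeasure T Ω)
        + ∫ z, inner ℝ (conv l (fun s => G s z.2) z.1) (G z.1 z.2) ∂(cylMeasure T Ω) ≤ 0 := by
  have hl := hkl.integrableOn_l T
  have hw2 := hw.memLp
  have hG2 := hw.memLp_grad
  rw [cylMeasure_eq_prod] at *
  have h1 : Integrable (fun z : ℝ × Space N => w z.1 z.2 *
      (u z.1 z.2 - u₀ z.2 - conv l (fun s => f s z.2) z.1))
      ((volume.restrict (Ioo 0 T)).prod (volume.restrict Ω)) :=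
    integrable_mul_of_memLp_two hw2 (hv.sub (memLp_two_conv_prod hl hf))
  have h2 := integrable_inner_of_memLp (memLp_two_conv_prod hl hG2) hG2
  refine ⟨h1, ?_⟩
  have h3 : Integrable (fun z : ℝ × Space N => w z.1 z.2 *
      (u z.1 z.2 - u₀ z.2 - conv l (fun s => f s z.2) z.1)
      + inner ℝ (conv l (fun s => G s z.2) z.1) (G z.1 z.2))
      ((volume.restrict (Ioo 0 T)).prod (volume.restrict Ω)) := h1.add h2
  rw [← integral_add h1 h2, integral_prod _ h3]
  refine integral_nonpos_of_ae ?_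
  -- The test function `w t` varies with the time, which is why one null set must serve all test
  -- functions.
  filter_upwards [hweak.ae_forall_le hkl hv hf hG2, hw.mem, Measure.ae_ae_of_ae_prod hw0]
    with t ht1 ht2 ht3
  refine (le_of_eq ?_).trans (ht1 _ _ ht2 ht3)
  refine integral_congr_ae (.of_forall fun x => ?_)
  simp only
  ring

end Estimate

end Subdiffusion

/-! ### Conclusion: the a priori estimate. -/

theorem mainTheorem1 {N : ℕ} (bc : Subdiffusion.BoundaryCondition)
    (Ω : Set (Subdiffusion.Space N)) (hΩ_open : IsOpen Ω) (hΩ_conn : IsConnected Ω)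
    (hΩ_bdd : Bornology.IsBounded Ω)
    (T : ℝ) (hT : 0 < T)
    (k l : ℝ → ℝ) (hkl : Subdiffusion.IsPCPair k l)
    (m : ℝ) (hm : 1 ≤ m)
    (u₀ : Subdiffusion.Space N → ℝ)
    (hu₀ : MemLp u₀ (ENNReal.ofReal (m + 1)) (volume.restrict Ω))
    (f : ℝ → Subdiffusion.Space N → ℝ)
    (hf : MemLp (fun z : ℝ × Subdiffusion.Space N => f z.1 z.2) (ENNReal.ofReal (m + 1))
      (Subdiffusion.cylMeasure T Ω))
    (a : ℝ → Subdiffusion.Space N → ℝ) (a₁ a₂ : ℝ) (ha₁ : 0 < a₁) (ha₂ : 0 < a₂)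
    (ha : MemLp (fun z : ℝ × Subdiffusion.Space N => a z.1 z.2) ⊤ (Subdiffusion.cylMeasure T Ω))
    (ha_bd : ∀ᵐ z ∂(Subdiffusion.cylMeasure T Ω), a₁ ≤ a z.1 z.2 ∧ a z.1 z.2 ≤ a₂)
    (u : ℝ → Subdiffusion.Space N → ℝ)
    (hu_meas : AEStronglyMeasurable (fun z : ℝ × Subdiffusion.Space N => u z.1 z.2)
      (Subdiffusion.cylMeasure T Ω))
    (hu_nonneg : ∀ᵐ z ∂(Subdiffusion.cylMeasure T Ω), 0 ≤ u z.1 z.2)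
    (G : ℝ → Subdiffusion.Space N → Subdiffusion.Space N)
    (hG : Subdiffusion.MemL2EnergySpace bc T Ω (fun t x => a t x * u t x ^ m) G)
    (hweak : Subdiffusion.WeakInequality bc T Ω k l u₀ f u G)
    (hku : Subdiffusion.ConvContinuousVanishing T Ω k u) :
    Integrable (fun z : ℝ × Subdiffusion.Space N => u z.1 z.2 ^ (m + 1))
        (Subdiffusion.cylMeasure T Ω) ∧
    Integrable (fun z : ℝ × Subdiffusion.Space N => (k (T - z.1) + k z.1) *
        ‖Subdiffusion.dualConv T l (fun τ => G τ z.2) z.1‖ ^ 2) (Subdiffusion.cylMeasure T Ω) ∧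
    ∫ z, u z.1 z.2 ^ (m + 1) ∂(Subdiffusion.cylMeasure T Ω)
      + 1 / a₁ * ∫ z, (k (T - z.1) + k z.1) *
          ‖Subdiffusion.dualConv T l (fun τ => G τ z.2) z.1‖ ^ 2 ∂(Subdiffusion.cylMeasure T Ω)
      ≤ 2 * (4 * m) ^ m / (m + 1) ^ (m + 1) * (a₂ / a₁) ^ (m + 1) *
        (T * (∫ x in Ω, |u₀ x| ^ (m + 1))
          + (∫ t in Ioo 0 T, |l t|) ^ (m + 1) *
            ∫ z, |f z.1 z.2| ^ (m + 1) ∂(Subdiffusion.cylMeasure T Ω)) := by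
  open Subdiffusion in
  have hm0 : 0 < m := by linarith
  have hm1 : 1 ≤ m + 1 := by linarith
  have hm10 : 0 < m + 1 := by linarith
  have hl := hkl.integrableOn_l T
  have : IsFiniteMeasure (volume.restrict Ω) :=
    isFiniteMeasure_restrict.mpr hΩ_bdd.measure_lt_top.ne
  have h2le : (2 : ENNReal) ≤ ENNReal.ofReal (m + 1) := by
    rw [← ENNReal.ofReal_ofNat]
    exact ENNReal.ofReal_le_ofReal (by linarith)
  have hw0 : ∀ᵐ z ∂(cylMeasure T Ω), 0 ≤ a z.1 z.2 * u z.1 z.2 ^ m := by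
    filter_upwards [ha_bd, hu_nonneg] with z h1 h2
    exact mul_nonneg (ha₁.le.trans h1.1) (Real.rpow_nonneg h2 m)
  -- Finiteness comes from `a u^m ∈ L_2`: the lower bound on `a` gives `u^m ∈ L_2`, then `u ≤ 1 +
  -- u^m` on a set of finite measure gives `u ∈ L_2`, and `u^{m+1}` is their product.
  have hum : MemLp (fun z : ℝ × Space N => u z.1 z.2 ^ m) 2 (cylMeasure T Ω) := by
    refine (hG.memLp.const_mul (1 / a₁)).mono
      (hu_meas.aemeasurable.pow_const m).aestronglyMeasurable ?_
    filter_upwards [ha_bd, hu_nonneg] with z h1 h2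
    have h3 := Real.rpow_nonneg h2 m
    rw [Real.norm_of_nonneg h3, Real.norm_of_nonneg (mul_nonneg (by positivity)
      (mul_nonneg (ha₁.le.trans h1.1) h3)), one_div, ← div_eq_inv_mul, le_div_iff₀ ha₁, mul_comm]
    exact mul_le_mul_of_nonneg_right h1.1 h3
  have hfin : IsFiniteMeasure (cylMeasure T Ω) := by
    rw [cylMeasure_eq_prod]; infer_instance
  have hu2 : MemLp (fun z : ℝ × Space N => u z.1 z.2) 2 (cylMeasure T Ω) := by
    refine ((memLp_const (1 : ℝ)).add hum).mono hu_meas ?_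
    filter_upwards [hu_nonneg] with z h2
    have h3 := Real.rpow_nonneg h2 m
    rw [Pi.add_apply, Real.norm_of_nonneg h2, Real.norm_of_nonneg (by positivity)]
    rcases le_total (u z.1 z.2) 1 with h4 | h4
    · linarith
    · linarith [Real.self_le_rpow_of_one_le h4 hm]
  have hum1 : Integrable (fun z : ℝ × Space N => u z.1 z.2 ^ (m + 1)) (cylMeasure T Ω) := by
    refine (integrable_mul_of_memLp_two hum hu2).congr ?_
    filter_upwards [hu_nonneg] with z h2
    exact (Real.rpow_add_one' h2 hm10.ne').symm
  have hu₀' : MemLp (fun z : ℝ × Space N => u₀ z.2) (ENNReal.ofReal (m + 1)) (cylMeasure T Ω) := by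
    rw [cylMeasure_eq_prod]
    exact hu₀.comp_snd _
  have hf2 := hf.mono_exponent h2le
  obtain ⟨hEi, hE⟩ := hkl.integral_dual_energy_prod_le hT
    (by rw [← cylMeasure_eq_prod]; exact hG.memLp_grad)
  obtain ⟨hWi, hW⟩ := hweak.integral_le hkl hG hw0 (hu2.sub (hu₀'.mono_exponent h2le)) hf2
  have hconv : MemLp (fun z : ℝ × Space N => conv l (fun s => f s z.2) z.1)
      (ENNReal.ofReal (m + 1)) (cylMeasure T Ω) := by
    rw [cylMeasure_eq_prod] at hf ⊢
    exact memLp_conv_prod hm1 hl hf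
  have hpow : ∀ {w : ℝ × Space N → ℝ}, MemLp w (ENNReal.ofReal (m + 1)) (cylMeasure T Ω) →
      Integrable (fun z => |w z| ^ (m + 1)) (cylMeasure T Ω) := by
    intro w hw
    have := hw.integrable_norm_rpow (by simpa using hm10) ENNReal.ofReal_ne_top
    rwa [ENNReal.toReal_ofReal hm10.le] at this
  have hYoung : ∫ z, |conv l (fun s => f s z.2) z.1| ^ (m + 1) ∂(cylMeasure T Ω)
      ≤ (∫ t in Ioo 0 T, |l t|) ^ (m + 1) * ∫ z, |f z.1 z.2| ^ (m + 1) ∂(cylMeasure T Ω) := by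
    rw [cylMeasure_eq_prod] at hf ⊢
    exact integral_norm_conv_prod_rpow_le hm1 hl hf
  have hinit : ∫ z : ℝ × Space N, |u₀ z.2| ^ (m + 1) ∂(cylMeasure T Ω)
      = T * ∫ x in Ω, |u₀ x| ^ (m + 1) := by
    rw [cylMeasure_eq_prod, integral_fun_snd (fun x => |u₀ x| ^ (m + 1))]
    simp [hT.le]
  set C : ℝ := 2 * (4 * m) ^ m / (m + 1) ^ (m + 1) * (a₂ / a₁) ^ (m + 1) with hC
  have hC0 : 0 ≤ C := by positivity
  have hr : a₁ * (a₂ / a₁) = a₂ := mul_div_cancel₀ a₂ ha₁.ne'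
  have hSi : Integrable (fun z : ℝ × Space N => a₁ / 2 * (C * (|u₀ z.2| ^ (m + 1)
      + |conv l (fun s => f s z.2) z.1| ^ (m + 1)))) (cylMeasure T Ω) :=
    (((hpow hu₀').add (hpow hconv)).const_mul _).const_mul _
  -- Here `w u ≥ a₁ u^{m+1}`, while `w (u₀ + l ∗ f)` is controlled by Young's inequality with `r =
  -- a₂ / a₁`, scaled by `a₁ / 2` so that exactly half of `a₁ u^{m+1}` is spent.
  have hpt : ∫ z, (a₁ / 2 * u z.1 z.2 ^ (m + 1) - a₁ / 2 * (C * (|u₀ z.2| ^ (m + 1)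
        + |conv l (fun s => f s z.2) z.1| ^ (m + 1)))) ∂(cylMeasure T Ω)
      ≤ ∫ z, a z.1 z.2 * u z.1 z.2 ^ m *
        (u z.1 z.2 - u₀ z.2 - conv l (fun s => f s z.2) z.1) ∂(cylMeasure T Ω) := by
    refine integral_mono_ae ((hum1.const_mul _).sub hSi) hWi ?_
    filter_upwards [ha_bd, hu_nonneg] with z h1 h2
    have h3 := Real.rpow_nonneg h2 m
    have h4 := two_mul_rpow_mul_add_le hm0 h2 (div_nonneg ha₂.le ha₁.le) (abs_nonneg (u₀ z.2))
      (abs_nonneg (conv l (fun s => f s z.2) z.1))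
    have h5 : a z.1 z.2 * u z.1 z.2 ^ m * (u₀ z.2 + conv l (fun s => f s z.2) z.1)
        ≤ a₂ * u z.1 z.2 ^ m * (|u₀ z.2| + |conv l (fun s => f s z.2) z.1|) :=
      mul_le_mul_of_nonneg (mul_le_mul_of_nonneg_right h1.2 h3)
        (add_le_add (le_abs_self _) (le_abs_self _))
        (mul_nonneg (ha₁.le.trans h1.1) h3) (by positivity)
    have h6 : a₁ * u z.1 z.2 ^ (m + 1) ≤ a z.1 z.2 * u z.1 z.2 ^ m * u z.1 z.2 := by
      rw [Real.rpow_add_one' h2 hm10.ne', mul_assoc]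
      exact mul_le_mul_of_nonneg_right h1.1 (mul_nonneg h3 h2)
    have h7 := mul_le_mul_of_nonneg_left h4 (half_pos ha₁).le
    have h8 : a₁ / 2 * (2 * (a₂ / a₁) * (|u₀ z.2| + |conv l (fun s => f s z.2) z.1|)
        * u z.1 z.2 ^ m) = a₂ * u z.1 z.2 ^ m * (|u₀ z.2| + |conv l (fun s => f s z.2) z.1|) := by
      rw [← hr]; field_simp
    rw [h8, ← hC] at h7
    linarith
  rw [integral_sub (hum1.const_mul _) hSi, integral_const_mul,
    integral_const_mul, integral_const_mul, integral_add (hpow hu₀') (hpow hconv), hinit] at hpt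
  rw [← cylMeasure_eq_prod] at hEi hE
  refine ⟨hum1, hEi, ?_⟩
  have h9 := mul_le_mul_of_nonneg_left hYoung hC0
  have h10 := mul_le_mul_of_nonneg_left h9 (half_pos ha₁).le
  -- Multiplied by `a₁ / 2`, the energy term carries the factor `1/2`, which matches its bound by
  -- twice the quadratic form.
  refine le_of_mul_le_mul_left ?_ (half_pos ha₁)
  have h11 : ∀ P : ℝ, a₁ / 2 * (1 / a₁ * P) = P / 2 := fun P => by field_simp
  rw [mul_add, h11]
  linarith
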